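/- Let $d\ge 1$, $1<\alpha<2$, $\Omega=[0,1)^d$, and let $0<\mu_-\le\mu_+<\infty$. Let $\mu\in L_\infty(\mathbb R^d\times\mathbb R^d)$ be real-valued and satisfy, almost everywhere, $\mu_-\le\mu(x,y)\le\mu_+$, $\mu(x,y)=\mu(y,x)$ and $\mu(x+m,y+n)=\mu(x,y)$ for all $m,n\in\mathbb Z^d$. Let $\mathfrak D=\widetilde H^{\alpha/2}(\Omega)$ be the space of those $u\in L_2(\Omega)$ whose $\mathbb Z^d$-periodic extension (again denoted by $u$) belongs to $H^{\alpha/2}_{\rm loc}(\mathbb R^d)$. For $\xi\in\mathbb R^d$ and $u,v\in\mathfrak D$ put $$a(\xi)[u,v]=\frac12\int_{\mathbb R^d}dy\int_\Omega dx\,\mu(x,y)\,\frac{\bigl(e^{i\langle\xi,x\rangle}u(x)-e^{i\langle\xi,y\rangle}u(y)\bigr)\overline{\bigl(e^{i\langle\xi,x\rangle}v(x)-e^{i\langle\xi,y\rangle}v(y)\bigr)}}{|x-y|^{d+\alpha}},$$ $$a^{(j)}[u,v]=-\frac12\int_{\mathbb R^d}dy\int_\Omega dx\,\mu(x,y)\,\frac{x_j-y_j}{|x-y|^{d+\alpha}}\bigl(i\,u(x)\overline{v(y)}-i\,u(y)\overline{v(x)}\bigr),\quad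 j=1,\dots,d.$$ Let $\mathbb A(\xi)$ be the self-adjoint operator in $L_2(\Omega)$ generated by the closed form $a(\xi)$ with domain $\mathfrak D$. Equip $\mathfrak D$ with the inner product $(u,v)_{\mathfrak D}=a(0)[u,v]+\mu_+(u,v)_{L_2(\Omega)}$, and let $\mathbb T(\xi)$ and $\mathbb T_j$ be the operators in $\mathfrak D$ determined by $$(\mathbb T(\xi)u,v)_{\mathfrak D}=a(\xi)[u,v]-a(0)[u,v],\qquad (\mathbb T_ju,v)_{\mathfrak D}=a^{(j)}[u,v],\qquad u,v\in\mathfrak D.$$ Let $\mathfrak N=\mathcal L\{\mathbf 1_\Omega\}$ be the span of $\mathbf 1_\Omega$, which is the kernel of $\mathbb A(0)$, let $P=(\cdot,\mathbf 1_\Omega)\mathbf 1_\Omega$ be the orthogonal projection of $L_2(\Omega)$ onto $\mathfrak N$, and let $P^\perp=I-P$. Put $$c_0(d,\alpha)=\int_{\mathbb R^d}\frac{1-\cos z_1}{|z|^{d+\alpha}}\,dz,\qquad d_0=\mu_-c_0(d,\alpha)\pi^\alpha,\qquad \delta_0=\pi\Bigl(\frac{\mu_-}{3\mu_+}\Bigr)^{1/\alpha},$$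 and let $F(\xi)$ be the spectral projector of $\mathbb A(\xi)$ for the segment $[0,d_0/3]$, that is (the spectrum being discrete), the orthogonal projection onto the closed linear span of the eigenvectors of $\mathbb A(\xi)$ with eigenvalues in $[0,d_0/3]$. Then the operators $\mathbb T_j$, as well as $\mathbb T(\xi)$ for $|\xi|\le\delta_0$, are well defined; for $|\xi|\le\delta_0$ the eigenvectors of $\mathbb A(\xi)$ are complete in $L_2(\Omega)$; the restriction $\mathbb A(0)|_{\mathfrak N^\perp}$ has an inverse $\mathbb A(0)^{-1}$, defined on all of $\mathfrak N^\perp$, which is a bounded operator from $\mathfrak N^\perp$ to $\mathfrak N^\perp$; and with $R_0^\perp(0):=P^\perp\mathbb A(0)^{-1}P^\perp$ and $$G_{jk}:=-\mu_+P\,\mathbb T_jP^\perp\mathbb T_kP-\mu_+^2P\,\mathbb T_jR_0^\perp(0)\mathbb T_kP,\qquad j,k=1,\dots,d,$$ for all $|\xi|\le\delta_0$ one has $$\mathbb A(\xi)F(\xi)=\mu_+P\,\mathbb T(\xi)P+\sum_{j,k=1}^d\xi_j\xi_kG_{jk}+\Phi(\xi),$$ where $$\|G_{jk}\|_{L_2(\Omega)\to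 L_2(\Omega)}\le C_7,\qquad \|\Phi(\xi)\|_{L_2(\Omega)\to L_2(\Omega)}\le C_8|\xi|^{1+\alpha}\quad(|\xi|\le\delta_0),$$ with constants $C_7,C_8$ depending only on $d,\alpha,\mu_-,\mu_+$. -/

import Mathlib

open MeasureTheory Complex

noncomputable section

namespace LevyHom

/-- Euclidean space `ℝ^d`. -/
abbrev E (d : ℕ) := EuclideanSpace ℝ (Fin d)

/-- The periodicity cell `Ω = [0,1)^d`. -/
def cell (d : ℕ) : Set (E d) := {x | ∀ i, x i ∈ Set.Ico (0 : ℝ) 1}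

/-- Lebesgue measure on `Ω`. -/
abbrev cellMeasure (d : ℕ) : Measure (E d) := (volume : Measure (E d)).restrict (cell d)

/-- The complex Hilbert space `L₂(Ω)`. -/
abbrev L2 (d : ℕ) := Lp ℂ 2 (cellMeasure d)

/-- A lattice vector `m ∈ ℤ^d` as a point of `ℝ^d`. -/
def latticePt {d : ℕ} (m : Fin d → ℤ) : E d := WithLp.toLp 2 fun i => (m i : ℝ)

/-- The representative in `Ω` of a point `x` modulo `ℤ^d`. -/
def cellRep {d : ℕ} (x : E d) : E d := WithLp.toLp 2 fun i => Int.fract (x i)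

/-- The `ℤ^d`-periodic extension to `ℝ^d` of a function on `Ω`. -/
def perExt {d : ℕ} (u : E d → ℂ) : E d → ℂ := fun x => u (cellRep x)

lemma measurableSet_cell (d : ℕ) : MeasurableSet (cell d) := by
  have : cell d = ⋂ i, (fun x : E d => x i) ⁻¹' Set.Ico (0 : ℝ) 1 := by
    ext x; simp [cell]
  rw [this]
  refine MeasurableSet.iInter fun i => ?_
  have hm : Measurable fun x : E d => x i := by fun_prop
  exact hm measurableSet_Ico

lemma volume_cell_lt_top (d : ℕ) : (volume : Measure (E d)) (cell d) < ⊤ := by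
  have h : cell d ⊆ Metric.closedBall 0 (Real.sqrt d) := by
    intro x hx
    rw [mem_closedBall_zero_iff, EuclideanSpace.norm_eq]
    apply Real.sqrt_le_sqrt
    calc ∑ i, ‖x i‖ ^ 2 ≤ ∑ _i : Fin d, (1 : ℝ) := by
          refine Finset.sum_le_sum fun i _ => ?_
          have := hx i
          rw [Real.norm_eq_abs, sq_abs]
          nlinarith [this.1, this.2]
      _ = d := by simp
  exact (measure_mono h).trans_lt (Metric.isBounded_closedBall.measure_lt_top)

instance isFiniteMeasure_cellMeasure (d : ℕ) : IsFiniteMeasure (cellMeasure d) :=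
  ⟨by simpa using volume_cell_lt_top d⟩

lemma measurable_cellRep {d : ℕ} : Measurable (cellRep (d := d)) := by
  have h : Measurable fun x : E d => fun i => Int.fract (x i) :=
    measurable_pi_lambda _ fun i => by fun_prop
  exact (WithLp.measurable_toLp 2 (Fin d → ℝ)).comp h

lemma quasiMeasurePreserving_cellRep (d : ℕ) :
    Measure.QuasiMeasurePreserving (cellRep (d := d)) volume (cellMeasure d) := by
  refine ⟨measurable_cellRep, Measure.AbsolutelyContinuous.mk fun s hs h0 => ?_⟩
  rw [Measure.map_apply measurable_cellRep hs]
  rw [Measure.restrict_apply hs] at h0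
  have hsub : cellRep ⁻¹' s ⊆
      ⋃ m : Fin d → ℤ, (fun x : E d => x + latticePt m) ⁻¹' (s ∩ cell d) := by
    intro x hx
    refine Set.mem_iUnion.2 ⟨fun i => -⌊x i⌋, ?_⟩
    have hxe : x + latticePt (fun i => -⌊x i⌋) = cellRep x := by
      ext i
      simp [latticePt, cellRep, Int.fract, sub_eq_add_neg]
    simp only [Set.mem_preimage, hxe]
    exact ⟨hx, fun i => ⟨Int.fract_nonneg _, Int.fract_lt_one _⟩⟩
  refine measure_mono_null hsub (measure_iUnion_null fun m => ?_)
  rw [measure_preimage_add_right]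
  exact h0

/-- Functions on `Ω` that agree a.e. have a.e. equal periodic extensions. -/
lemma perExt_congr {d : ℕ} {u v : E d → ℂ} (h : u =ᵐ[cellMeasure d] v) :
    perExt u =ᵐ[volume] perExt v :=
  (quasiMeasurePreserving_cellRep d).ae_eq_comp h

/-- The difference quotient entering the Gagliardo seminorm of order `s`. -/
def gagliardo {d : ℕ} (s : ℝ) (f : E d → ℂ) (p : E d × E d) : ℝ :=
  ‖f p.1 - f p.2‖ ^ 2 / ‖p.1 - p.2‖ ^ ((d : ℝ) + 2 * s)

/-- `f ∈ H^s(O)` for a fractional order `0 < s < 1`: `f ∈ L₂(O)`, with finite Gagliardo seminorm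
`∫_O ∫_O |f(x) - f(y)|² / |x - y|^{d+2s} dx dy`. -/
def MemH {d : ℕ} (s : ℝ) (O : Set (E d)) (f : E d → ℂ) : Prop :=
  MemLp f 2 (volume.restrict O) ∧
    IntegrableOn (gagliardo s f) (O ×ˢ O) (volume : Measure (E d × E d))

/-- `f ∈ H^s_loc(ℝ^d)`, `0 < s < 1`. -/
def MemHloc {d : ℕ} (s : ℝ) (f : E d → ℂ) : Prop :=
  ∀ r : ℝ, 0 < r → MemH s (Metric.ball 0 r) f

lemma gagliardo_congr {d : ℕ} (s : ℝ) {f g : E d → ℂ} (h : f =ᵐ[volume] g) :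
    gagliardo s f =ᵐ[(volume : Measure (E d × E d))] gagliardo s g := by
  have h1 : ∀ᵐ p : E d × E d, f p.1 = g p.1 :=
    (Measure.quasiMeasurePreserving_fst (μ := (volume : Measure (E d)))
      (ν := (volume : Measure (E d)))).ae h
  have h2 : ∀ᵐ p : E d × E d, f p.2 = g p.2 :=
    (Measure.quasiMeasurePreserving_snd (μ := (volume : Measure (E d)))
      (ν := (volume : Measure (E d)))).ae h
  filter_upwards [h1, h2] with p hp1 hp2
  simp [gagliardo, hp1, hp2]

lemma MemHloc.congr {d : ℕ} {s : ℝ} {f g : E d → ℂ} (hf : MemHloc s f) (h : f =ᵐ[volume] g) :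
    MemHloc s g := fun r hr =>
  ⟨(hf r hr).1.ae_eq (ae_restrict_of_ae h),
    (hf r hr).2.congr (ae_restrict_of_ae (gagliardo_congr s h))⟩

lemma memHloc_const {d : ℕ} (s : ℝ) (c : ℂ) : MemHloc s (fun _ : E d => c) := by
  intro r _
  have : IsFiniteMeasure ((volume : Measure (E d)).restrict (Metric.ball 0 r)) :=
    ⟨by simpa using Metric.isBounded_ball.measure_lt_top⟩
  refine ⟨memLp_const c, ?_⟩
  have h0 : gagliardo s (fun _ : E d => c) = fun _ => 0 := by
    funext p; simp [gagliardo]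
  rw [h0]
  exact integrable_zero _ _ _

lemma MemHloc.smul {d : ℕ} {s : ℝ} {f : E d → ℂ} (hf : MemHloc s f) (c : ℂ) :
    MemHloc s (fun x => c * f x) := by
  intro r hr
  refine ⟨(hf r hr).1.const_mul c, ?_⟩
  have h0 : gagliardo s (fun x => c * f x) = fun p => ‖c‖ ^ 2 * gagliardo s f p := by
    funext p
    simp only [gagliardo, ← mul_sub, norm_mul, mul_pow, mul_div_assoc]
  rw [h0]
  exact (hf r hr).2.const_mul _

lemma MemHloc.add {d : ℕ} {s : ℝ} {f g : E d → ℂ} (hf : MemHloc s f) (hg : MemHloc s g)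
    (hfm : Measurable f) (hgm : Measurable g) : MemHloc s (fun x => f x + g x) := by
  intro r hr
  refine ⟨(hf r hr).1.add (hg r hr).1, ?_⟩
  refine Integrable.mono' (((hf r hr).2.const_mul 2).add ((hg r hr).2.const_mul 2)) ?_ ?_
  · have : Measurable (gagliardo s (fun x => f x + g x)) := by
      unfold gagliardo
      fun_prop
    exact this.aestronglyMeasurable
  · refine Filter.Eventually.of_forall fun p => ?_
    have hD : 0 ≤ ‖p.1 - p.2‖ ^ ((d : ℝ) + 2 * s) := Real.rpow_nonneg (norm_nonneg _) _
    rw [Real.norm_of_nonneg (by unfold gagliardo; positivity)]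
    simp only [Pi.add_apply, gagliardo]
    rw [← mul_div_assoc, ← mul_div_assoc, ← add_div]
    refine div_le_div_of_nonneg_right ?_ hD
    have h1 : ‖f p.1 + g p.1 - (f p.2 + g p.2)‖ ≤ ‖f p.1 - f p.2‖ + ‖g p.1 - g p.2‖ := by
      rw [add_sub_add_comm]; exact norm_add_le _ _
    nlinarith [norm_nonneg (f p.1 + g p.1 - (f p.2 + g p.2)),
      sq_nonneg (‖f p.1 - f p.2‖ - ‖g p.1 - g p.2‖)]

lemma measurable_perExt {d : ℕ} (u : L2 d) : Measurable (perExt (u : E d → ℂ)) :=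
  (Lp.stronglyMeasurable u).measurable.comp measurable_cellRep

/-- The periodic Sobolev space `H̃^s(Ω)`, `0 < s < 1`: the functions in `L₂(Ω)` whose periodic
extension lies in `H^s_loc(ℝ^d)`. -/
def perH (d : ℕ) (s : ℝ) : Submodule ℂ (L2 d) where
  carrier := {u | MemHloc s (perExt (u : E d → ℂ))}
  zero_mem' := by
    refine (memHloc_const s 0).congr ?_
    exact (perExt_congr (Lp.coeFn_zero ℂ 2 (cellMeasure d))).symm
  add_mem' := by
    intro u v hu hv
    refine (MemHloc.add hu hv (measurable_perExt u) (measurable_perExt v)).congr ?_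
    exact (perExt_congr (Lp.coeFn_add u v)).symm
  smul_mem' := by
    intro c u hu
    refine (MemHloc.smul hu c).congr ?_
    exact (perExt_congr (Lp.coeFn_smul c u)).symm

/-- The function `𝟏_Ω ∈ L₂(Ω)`. -/
def one (d : ℕ) : L2 d := (memLp_const (1 : ℂ)).toLp (fun _ => (1 : ℂ))

lemma one_mem_perH (d : ℕ) (s : ℝ) : one d ∈ perH d s := by
  refine (memHloc_const s 1).congr ?_
  exact (perExt_congr (MemLp.coeFn_toLp (memLp_const (1 : ℂ)))).symm

/-- The standing conditions on the coefficient `μ ∈ L_∞(ℝ^d × ℝ^d)`: two-sided bounds, symmetry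
and `ℤ^d`-periodicity in each variable, all almost everywhere. -/
structure IsCoefficient {d : ℕ} (mlo mhi : ℝ) (μ : E d → E d → ℝ) : Prop where
  aestronglyMeasurable :
    AEStronglyMeasurable (fun p : E d × E d => μ p.1 p.2) (volume : Measure (E d × E d))
  bounds : ∀ᵐ p : E d × E d, mlo ≤ μ p.1 p.2 ∧ μ p.1 p.2 ≤ mhi
  symm : ∀ᵐ p : E d × E d, μ p.1 p.2 = μ p.2 p.1
  periodic : ∀ m n : Fin d → ℤ,
    ∀ᵐ p : E d × E d, μ (p.1 + latticePt m) (p.2 + latticePt n) = μ p.1 p.2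

/-- The function `x ↦ e^{i⟨ξ,x⟩} u(x)` on `ℝ^d`, with `u` extended periodically. -/
def twist {d : ℕ} (ξ : E d) (u : L2 d) (x : E d) : ℂ :=
  exp (I * ((inner ℝ ξ x : ℝ) : ℂ)) * perExt (u : E d → ℂ) x

/-- The form `a(ξ)[u,v]` (linear in `u`, antilinear in `v`), the variable `p = (x, y)` running over
`Ω × ℝ^d`. Its domain is `H̃^{α/2}(Ω)`. -/
def aForm {d : ℕ} (α : ℝ) (μ : E d → E d → ℝ) (ξ : E d) (u v : L2 d) : ℂ :=
  (1 / 2 : ℂ) * ∫ p, ((μ p.1 p.2 / ‖p.1 - p.2‖ ^ ((d : ℝ) + α) : ℝ) : ℂ) *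
      ((twist ξ u p.1 - twist ξ u p.2) * star (twist ξ v p.1 - twist ξ v p.2))
    ∂((cellMeasure d).prod volume)

/-- The sesquilinear form `a^{(j)}[u,v]`, whose diagonal is
`a^{(j)}[u,u] = - ∫_{ℝ^d} dy ∫_Ω dx μ(x,y) (x_j - y_j) |x - y|^{-d-α} Re (i u(x) u(y)^*)`. -/
def ajForm {d : ℕ} (α : ℝ) (μ : E d → E d → ℝ) (j : Fin d) (u v : L2 d) : ℂ :=
  -(1 / 2 : ℂ) * ∫ p, ((μ p.1 p.2 * (p.1 j - p.2 j) / ‖p.1 - p.2‖ ^ ((d : ℝ) + α) : ℝ) : ℂ) *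
      (I * perExt (u : E d → ℂ) p.1 * star (perExt (v : E d → ℂ) p.2)
        - I * perExt (u : E d → ℂ) p.2 * star (perExt (v : E d → ℂ) p.1))
    ∂((cellMeasure d).prod volume)

/-- The graph of the self-adjoint operator `𝔸(ξ)` generated in `L₂(Ω)` by the form `a(ξ)` with
domain `H̃^{α/2}(Ω)`: `u ∈ Dom 𝔸(ξ)` and `𝔸(ξ) u = f` iff `u` belongs to the form domain and
`a(ξ)[u,v] = (f,v)` for all `v` in the form domain. -/
def opGraph {d : ℕ} (α : ℝ) (μ : E d → E d → ℝ) (ξ : E d) : Set (L2 d × L2 d) :=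
  {p | p.1 ∈ perH d (α / 2) ∧ ∀ v ∈ perH d (α / 2), aForm α μ ξ p.1 v = inner ℂ v p.2}

/-- The inner product `(u,v)_𝔇 = a(0)[u,v] + μ₊ (u,v)` of `𝔇 = H̃^{α/2}(Ω)`. -/
def innerD {d : ℕ} (α mhi : ℝ) (μ : E d → E d → ℝ) (u v : perH d (α / 2)) : ℂ :=
  aForm α μ 0 u v + (mhi : ℂ) * inner ℂ (v : L2 d) (u : L2 d)

/-- The operator `T` in `𝔇` corresponds to the form `b`: `(T u, v)_𝔇 = b[u,v]`. -/
def Represents {d : ℕ} (α mhi : ℝ) (μ : E d → E d → ℝ) (b : L2 d → L2 d → ℂ)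
    (T : perH d (α / 2) →ₗ[ℂ] perH d (α / 2)) : Prop :=
  ∀ u v : perH d (α / 2), innerD α mhi μ (T u) v = b u v

open Classical in
/-- The operator in `𝔇` corresponding to the form `b` (zero if there is none). -/
def formOperator {d : ℕ} (α mhi : ℝ) (μ : E d → E d → ℝ) (b : L2 d → L2 d → ℂ) :
    perH d (α / 2) →ₗ[ℂ] perH d (α / 2) :=
  if h : ∃ T, Represents α mhi μ b T then h.choose else 0

/-- `𝕋(ξ)`, the operator in `𝔇` corresponding to the form `a(ξ) - a(0)`. -/
def opT {d : ℕ} (α mhi : ℝ) (μ : E d → E d → ℝ) (ξ : E d) :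
    perH d (α / 2) →ₗ[ℂ] perH d (α / 2) :=
  formOperator α mhi μ fun u v => aForm α μ ξ u v - aForm α μ 0 u v

/-- `𝕋_j`, the operator in `𝔇` corresponding to the form `a^{(j)}`. -/
def opTj {d : ℕ} (α mhi : ℝ) (μ : E d → E d → ℝ) (j : Fin d) :
    perH d (α / 2) →ₗ[ℂ] perH d (α / 2) :=
  formOperator α mhi μ (ajForm α μ j)

/-- `P = (·, 𝟏_Ω) 𝟏_Ω`, regarded as a map from `L₂(Ω)` to `H̃^s(Ω)`. -/
def projP (d : ℕ) (s : ℝ) : L2 d →ₗ[ℂ] perH d s :=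
  (innerSL ℂ (one d)).toLinearMap.smulRight ⟨one d, one_mem_perH d s⟩

/-- `R = P^⊥ 𝔸(0)^{-1} P^⊥`, with `𝔸(0)^{-1}` the inverse of the restriction of `𝔸(0)` to the
orthogonal complement of `𝟏_Ω`: for each `f`, `R f` is orthogonal to `𝟏_Ω` and
`𝔸(0) R f = P^⊥ f`. -/
def IsReducedInverse {d : ℕ} (α : ℝ) (μ : E d → E d → ℝ)
    (R : L2 d →ₗ[ℂ] perH d (α / 2)) : Prop :=
  ∀ f : L2 d, inner ℂ (one d) (R f : L2 d) = 0 ∧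
    ((R f : L2 d), f - (projP d (α / 2) f : L2 d)) ∈ opGraph α μ 0

open Classical in
/-- `R_0^⊥(0) = P^⊥ 𝔸(0)^{-1} P^⊥` (zero if this inverse does not exist). -/
def opR {d : ℕ} (α : ℝ) (μ : E d → E d → ℝ) : L2 d →ₗ[ℂ] perH d (α / 2) :=
  if h : ∃ R, IsReducedInverse α μ R then h.choose else 0

/-- `P 𝕋(ξ) P` as an operator in `L₂(Ω)`. -/
def opPTP {d : ℕ} (α mhi : ℝ) (μ : E d → E d → ℝ) (ξ : E d) : L2 d →ₗ[ℂ] L2 d :=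
  let ι := (perH d (α / 2)).subtype
  let P := projP d (α / 2)
  ι ∘ₗ P ∘ₗ ι ∘ₗ opT α mhi μ ξ ∘ₗ P

/-- `G_{jk} = - μ₊ P 𝕋_j P^⊥ 𝕋_k P - μ₊² P 𝕋_j R_0^⊥(0) 𝕋_k P` as an operator in `L₂(Ω)`. -/
def opG {d : ℕ} (α mhi : ℝ) (μ : E d → E d → ℝ) (j k : Fin d) : L2 d →ₗ[ℂ] L2 d :=
  let ι := (perH d (α / 2)).subtype
  let P := projP d (α / 2)
  (-(mhi : ℂ)) • (ι ∘ₗ P ∘ₗ ι ∘ₗ opTj α mhi μ j ∘ₗ (LinearMap.id - P ∘ₗ ι) ∘ₗ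
      opTj α mhi μ k ∘ₗ P)
    - ((mhi : ℂ) ^ 2) • (ι ∘ₗ P ∘ₗ ι ∘ₗ opTj α mhi μ j ∘ₗ opR α μ ∘ₗ ι ∘ₗ
      opTj α mhi μ k ∘ₗ P)

/-- The constant `c₀(d,α) = ∫_{ℝ^d} (1 - cos z₁) / |z|^{d+α} dz`. -/
def c0 (d : ℕ) [NeZero d] (α : ℝ) : ℝ :=
  ∫ z : E d, (1 - Real.cos (z 0)) / ‖z‖ ^ ((d : ℝ) + α)

/-- `d₀ = μ₋ c₀(d,α) π^α`. -/
def d0 (d : ℕ) [NeZero d] (α mlo : ℝ) : ℝ := mlo * c0 d α * Real.pi ^ α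

/-- `δ₀(α,μ) = π (μ₋ / (3 μ₊))^{1/α}`. -/
def delta0 (α mlo mhi : ℝ) : ℝ := Real.pi * (mlo / (3 * mhi)) ^ (1 / α)

/-- The closed linear span of the eigenvectors of `𝔸(ξ)` with eigenvalues in `S`. -/
def spectralSubspace {d : ℕ} (α : ℝ) (μ : E d → E d → ℝ) (ξ : E d) (S : Set ℝ) :
    Submodule ℂ (L2 d) :=
  (Submodule.span ℂ {u : L2 d | ∃ t ∈ S, (u, (t : ℂ) • u) ∈ opGraph α μ ξ}).topologicalClosure

instance completeSpace_spectralSubspace {d : ℕ} (α : ℝ) (μ : E d → E d → ℝ) (ξ : E d)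
    (S : Set ℝ) : CompleteSpace (spectralSubspace α μ ξ S) :=
  Submodule.topologicalClosure.completeSpace _

/-- `F(ξ)`, the spectral projector of `𝔸(ξ)` for the segment `[0, d₀/3]`. Since the spectrum of
`𝔸(ξ)` is discrete, this is the orthogonal projection onto the closed span of the eigenvectors
with eigenvalues in this segment. -/
def opF {d : ℕ} [NeZero d] (α mlo : ℝ) (μ : E d → E d → ℝ) (ξ : E d) : L2 d →L[ℂ] L2 d :=
  (spectralSubspace α μ ξ (Set.Icc 0 (d0 d α mlo / 3))).starProjection

end LevyHom

end

/-! The proof works with quadratic forms throughout; no resolvent is integrated over a contour.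
Expanding `e^{i⟨ξ,x-y⟩}` under the integral gives a(ξ) = a(0) + Σ ξ_j a^{(j)} + remainder. The
Taylor remainder of the exponential is bounded by min(|s|, s²) with |s| ≤ |ξ||x-y|, and scaling
against `|z|^{-d-α}` turns this weight into `|ξ|^α` (`norm_aForm_sub_le`). The first-order kernel is
not integrable at the diagonal, but the antisymmetry of its numerator lets increments of u and v
compensate (`jump_product_le`).

For μ = 1 the form is diagonal in the Fourier basis, with symbol `c₀|ξ+2πn|^α` (`energy_eq`).
Bounding μ from both sides then yields the form domain, the compactness of the resolvents, and the
gap a(ξ) ≥ d₀ on the complement of 𝟏 for |ξ| ≤ π. Since a(ξ)[𝟏,𝟏] ≤ d₀/3 for |ξ| ≤ δ₀, the segment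
[0, d₀/3] contains exactly one eigenvalue l, and it is simple.

Normalize its eigenvector as 𝟏 + r with r ⊥ 𝟏. Three choices of test function in the eigenvalue
equation give everything. Testing with r gives r = O(|ξ|), and testing with 𝟏 then gives l =
O(|ξ|^α). Let w solve the cell problem a(0)[w,v] = Σ ξ_j a^{(j)}[𝟏,v]; testing with r + w gives r =
-w + O(|ξ|^α). Returning to 𝟏, l = a(ξ)[𝟏,𝟏] - Σ ξ_j a^{(j)}[w,𝟏] + O(|ξ|^{1+α}). The projection
F(ξ) differs from P by O(|ξ|), so replacing F(ξ) by P in lF(ξ) costs O(|ξ|^α·|ξ|). This is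
`IsPerturbation.exists_expansion`.

It remains to recognize the coefficients. Since a(0)[·,𝟏] = 0, pairing with 𝟏 in 𝔇 is μ₊ times
pairing in L₂, so μ₊P𝕋(ξ)P = a(ξ)[𝟏,𝟏]P (`mul_opPTP_apply`). The cell solution in direction k is
𝕋_k𝟏 + μ₊R_0^⊥(0)𝕋_k𝟏, which is exactly the combination appearing in G_{jk} (`opG_apply`). -/

noncomputable section

namespace LevyHom

/-! ### Sesquilinear forms on a dense domain, Lax-Milgram and solution operators. -/

section Forms

variable {H : Type*} [NormedAddCommGroup H] [InnerProductSpace ℂ H]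

/-- `b` is linear in the first and antilinear in the second argument on the subspace `D`. -/
structure IsSesqOn (D : Submodule ℂ H) (b : H → H → ℂ) : Prop where
  add_left : ∀ u ∈ D, ∀ u' ∈ D, ∀ v ∈ D, b (u + u') v = b u v + b u' v
  smul_left : ∀ c : ℂ, ∀ u ∈ D, ∀ v ∈ D, b (c • u) v = c * b u v
  add_right : ∀ u ∈ D, ∀ v ∈ D, ∀ v' ∈ D, b u (v + v') = b u v + b u v'
  smul_right : ∀ c : ℂ, ∀ u ∈ D, ∀ v ∈ D, b u (c • v) = star c * b u v

namespace IsSesqOn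

variable {D : Submodule ℂ H} {b b' : H → H → ℂ}

lemma inner (D : Submodule ℂ H) : IsSesqOn D fun u v => inner ℂ v u where
  add_left _ _ _ _ _ _ := inner_add_right _ _ _
  smul_left _ _ _ _ _ := inner_smul_right _ _ _
  add_right _ _ _ _ _ _ := inner_add_left _ _ _
  smul_right _ _ _ _ _ := inner_smul_left _ _ _

lemma add (hb : IsSesqOn D b) (hb' : IsSesqOn D b') :
    IsSesqOn D fun u v => b u v + b' u v where
  add_left u hu u' hu' v hv := by rw [hb.add_left u hu u' hu' v hv, hb'.add_left u hu u' hu' v hv]; ring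
  smul_left c u hu v hv := by rw [hb.smul_left c u hu v hv, hb'.smul_left c u hu v hv]; ring
  add_right u hu v hv v' hv' := by
    rw [hb.add_right u hu v hv v' hv', hb'.add_right u hu v hv v' hv']; ring
  smul_right c u hu v hv := by rw [hb.smul_right c u hu v hv, hb'.smul_right c u hu v hv]; ring

lemma const_mul (hb : IsSesqOn D b) (k : ℂ) : IsSesqOn D fun u v => k * b u v where
  add_left u hu u' hu' v hv := by rw [hb.add_left u hu u' hu' v hv]; ring
  smul_left c u hu v hv := by rw [hb.smul_left c u hu v hv]; ring
  add_right u hu v hv v' hv' := by rw [hb.add_right u hu v hv v' hv']; ring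
  smul_right c u hu v hv := by rw [hb.smul_right c u hu v hv]; ring

lemma sub (hb : IsSesqOn D b) (hb' : IsSesqOn D b') :
    IsSesqOn D fun u v => b u v - b' u v := by
  simpa [sub_eq_add_neg] using hb.add (hb'.const_mul (-1))

lemma sum {ι : Type*} (s : Finset ι) {b : ι → H → H → ℂ} (hb : ∀ i, IsSesqOn D (b i)) :
    IsSesqOn D fun u v => ∑ i ∈ s, b i u v where
  add_left u hu u' hu' v hv := by
    rw [← Finset.sum_add_distrib]
    exact Finset.sum_congr rfl fun i _ => (hb i).add_left u hu u' hu' v hv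
  smul_left c u hu v hv := by
    rw [Finset.mul_sum]; exact Finset.sum_congr rfl fun i _ => (hb i).smul_left c u hu v hv
  add_right u hu v hv v' hv' := by
    rw [← Finset.sum_add_distrib]
    exact Finset.sum_congr rfl fun i _ => (hb i).add_right u hu v hv v' hv'
  smul_right c u hu v hv := by
    rw [Finset.mul_sum]; exact Finset.sum_congr rfl fun i _ => (hb i).smul_right c u hu v hv

lemma sub_left (hb : IsSesqOn D b) {u u' v : H} (hu : u ∈ D) (hu' : u' ∈ D) (hv : v ∈ D) :
    b (u - u') v = b u v - b u' v := by
  have := hb.add_left u hu ((-1 : ℂ) • u') (D.smul_mem _ hu') v hv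
  rw [hb.smul_left _ u' hu' v hv] at this
  simpa [sub_eq_add_neg] using this

/-- A bound by the sum of the squares of a homogeneous functional gives a bound by its product. -/
lemma norm_le_of_sq_le (hb : IsSesqOn D b) {N : H → ℝ} (hN0 : ∀ u ∈ D, 0 ≤ N u)
    (hN : ∀ c : ℂ, ∀ u ∈ D, N (c • u) = ‖c‖ * N u) {C : ℝ}
    (h : ∀ u ∈ D, ∀ v ∈ D, ‖b u v‖ ≤ C * (N u ^ 2 + N v ^ 2)) {u v : H} (hu : u ∈ D) (hv : v ∈ D) :
    ‖b u v‖ ≤ 2 * C * N u * N v := by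
  -- Replacing u, v by tu, v/t leaves the form unchanged, so the quadratic bound may be optimized in
  -- t.
  have key : ∀ t : ℝ, 0 < t → ‖b u v‖ ≤ C * (t ^ 2 * N u ^ 2 + (t ^ 2)⁻¹ * N v ^ 2) := by
    intro t ht
    have h1 : b u v = b ((t : ℂ) • u) (((t⁻¹ : ℝ) : ℂ) • v) := by
      rw [hb.smul_left _ u hu _ (D.smul_mem _ hv), hb.smul_right _ u hu v hv]
      simp only [RCLike.star_def, Complex.conj_ofReal, ← mul_assoc, ← Complex.ofReal_mul]
      rw [mul_inv_cancel₀ ht.ne']; simp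
    rw [h1]
    refine (h _ (D.smul_mem _ hu) _ (D.smul_mem _ hv)).trans (le_of_eq ?_)
    rw [hN _ u hu, hN _ v hv, Complex.norm_real, Complex.norm_real, Real.norm_of_nonneg ht.le,
      Real.norm_of_nonneg (inv_nonneg.2 ht.le), mul_pow, mul_pow, inv_pow]
  have key' : ∀ s : ℝ, 0 < s → ‖b u v‖ ≤ C * (s * N u ^ 2 + s⁻¹ * N v ^ 2) := by
    intro s hs
    have := key (Real.sqrt s) (Real.sqrt_pos.2 hs)
    rwa [Real.sq_sqrt hs.le] at this
  have hu0 := hN0 u hu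
  have hv0 := hN0 v hv
  -- Degenerate case: if N vanishes at one argument, no optimal parameter exists and a limit
  -- replaces it.
  have lim : ∀ K : ℝ, (∀ s : ℝ, 0 < s → ‖b u v‖ ≤ s * K) → ‖b u v‖ ≤ 0 := by
    intro K hK
    refine le_of_forall_pos_le_add fun ε hε => ?_
    have h1 := hK (ε / (|K| + 1)) (by positivity)
    refine h1.trans ?_
    rw [zero_add, div_mul_eq_mul_div, div_le_iff₀ (by positivity)]
    nlinarith [le_abs_self K]
  rcases hu0.eq_or_lt with h0 | hupos
  · rw [← h0]
    have := lim (C * N v ^ 2) fun s hs => by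
      refine (key' s⁻¹ (inv_pos.2 hs)).trans (le_of_eq ?_)
      rw [← h0, inv_inv]; ring
    simpa using this
  rcases hv0.eq_or_lt with h0 | hvpos
  · rw [← h0]
    have := lim (C * N u ^ 2) fun s hs => by
      refine (key' s hs).trans (le_of_eq ?_)
      rw [← h0]; ring
    simpa using this
  -- This parameter makes the two squares equal, each to N u · N v.
  · refine (key' (N v / N u) (by positivity)).trans (le_of_eq ?_)
    field_simp
    ring

end IsSesqOn

variable [CompleteSpace H] {D : Submodule ℂ H} {W : H →L[ℂ] H} {b q : H → H → ℂ}

/-- A form on `D = Ran W`, bounded with respect to the norm transported by `W`, is given by a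
bounded operator. -/
lemma IsSesqOn.exists_operator (hb : IsSesqOn D b) (hW : ∀ f, W f ∈ D) {C : ℝ}
    (hC : ∀ f g, ‖b (W f) (W g)‖ ≤ C * ‖f‖ * ‖g‖) :
    ∃ B : H →L[ℂ] H, ∀ f g, Inner.inner ℂ g (B f) = b (W f) (W g) := by
  -- The conjugate is taken because the Riesz construction expects antilinearity in the first slot.
  let L : H →L⋆[ℂ] H →L[ℂ] ℂ := LinearMap.mkContinuous₂
    (LinearMap.mk₂'ₛₗ (starRingEnd ℂ) (RingHom.id ℂ) (fun f g => star (b (W f) (W g)))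
      (fun f f' g => by rw [map_add, hb.add_left _ (hW f) _ (hW f') _ (hW g), star_add])
      (fun c f g => by
        rw [map_smul, hb.smul_left _ _ (hW f) _ (hW g), star_mul', smul_eq_mul]; rfl)
      (fun f g g' => by rw [map_add, hb.add_right _ (hW f) _ (hW g) _ (hW g'), star_add])
      (fun c f g => by
        rw [map_smul, hb.smul_right _ _ (hW f) _ (hW g), star_mul', star_star, smul_eq_mul]; rfl))
    C (fun f g => by simpa using hC f g)
  refine ⟨InnerProductSpace.continuousLinearMapOfBilin L, fun f g => ?_⟩
  rw [← inner_conj_symm, InnerProductSpace.continuousLinearMapOfBilin_apply]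
  exact star_star (b (W f) (W g))

/-- Lax-Milgram: a bounded coercive operator is invertible. -/
lemma exists_inverse_of_coercive (S : H →L[ℂ] H) {c : ℝ} (hc : 0 < c)
    (h : ∀ f, c * ‖f‖ ^ 2 ≤ (Inner.inner ℂ f (S f) : ℂ).re) :
    ∃ S' : H →L[ℂ] H, (∀ f, S (S' f) = f) ∧ ∀ f, S' (S f) = f := by
  have hu : IsUnit S := by
    refine ContinuousLinearMap.isUnit_of_forall_le_norm_inner_map S (c := ⟨c, hc.le⟩) hc fun x => ?_
    rw [← inner_conj_symm, RCLike.norm_conj]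
    calc ‖x‖ ^ 2 * c = c * ‖x‖ ^ 2 := mul_comm _ _
      _ ≤ _ := h x
      _ ≤ _ := Complex.re_le_norm _
  obtain ⟨U, rfl⟩ := hu
  refine ⟨(U⁻¹ : (H →L[ℂ] H)ˣ), fun f => ?_, fun f => ?_⟩
  · rw [← mul_apply_eq_comp, ← Units.val_mul, mul_inv_cancel]; rfl
  · rw [← mul_apply_eq_comp, ← Units.val_mul, inv_mul_cancel]; rfl

/-- The operator in `D` that represents `b` with respect to the coercive form `q`. -/
lemma IsSesqOn.exists_represents (hq : IsSesqOn D q) (hb : IsSesqOn D b) (J : H ≃ₗ[ℂ] D)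
    (hJ : ∀ f, (J f : H) = W f) {C C' c : ℝ} (hc : 0 < c)
    (hqC : ∀ f g, ‖q (W f) (W g)‖ ≤ C * ‖f‖ * ‖g‖)
    (hbC : ∀ f g, ‖b (W f) (W g)‖ ≤ C' * ‖f‖ * ‖g‖)
    (hqc : ∀ f, c * ‖f‖ ^ 2 ≤ (q (W f) (W f)).re) :
    ∃ T : D →ₗ[ℂ] D, ∀ u v : D, q (T u) v = b u v := by
  have hW : ∀ f, W f ∈ D := fun f => hJ f ▸ (J f).2
  obtain ⟨S, hS⟩ := hq.exists_operator hW hqC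
  obtain ⟨B, hB⟩ := hb.exists_operator hW hbC
  obtain ⟨S', hS', -⟩ := exists_inverse_of_coercive S hc (fun f => by rw [hS]; exact hqc f)
  -- Transported to H, the forms q and b become operators S and B, so the representing operator is
  -- S⁻¹B conjugated by J.
  refine ⟨J.toLinearMap ∘ₗ (S' ∘L B).toLinearMap ∘ₗ J.symm.toLinearMap, fun u v => ?_⟩
  obtain ⟨f, rfl⟩ := J.surjective u
  obtain ⟨g, rfl⟩ := J.surjective v
  simp only [LinearMap.comp_apply, LinearEquiv.coe_coe, LinearEquiv.symm_apply_apply,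
    ContinuousLinearMap.coe_coe, ContinuousLinearMap.comp_apply, hJ]
  rw [← hS, ← hB, hS']

/-- The solution operator `h ↦ u`, `q[u, v] = (h, v)`, of a coercive form `q`. -/
lemma IsSesqOn.exists_solution (hq : IsSesqOn D q) (J : H ≃ₗ[ℂ] D)
    (hJ : ∀ f, (J f : H) = W f) {C c : ℝ} (hc : 0 < c)
    (hqC : ∀ f g, ‖q (W f) (W g)‖ ≤ C * ‖f‖ * ‖g‖)
    (hqc : ∀ f, c * ‖f‖ ^ 2 ≤ (q (W f) (W f)).re) (hWK : IsCompactOperator W) :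
    ∃ R : H →L[ℂ] H, (∀ h, R h ∈ D) ∧ (∀ h, ∀ v ∈ D, q (R h) v = Inner.inner ℂ v h) ∧
      IsCompactOperator R := by
  have hW : ∀ f, W f ∈ D := fun f => hJ f ▸ (J f).2
  obtain ⟨S, hS⟩ := hq.exists_operator hW hqC
  obtain ⟨S', hS', -⟩ := exists_inverse_of_coercive S hc (fun f => by rw [hS]; exact hqc f)
  -- The solution operator factors as W S⁻¹ W*, so it inherits compactness from W.
  refine ⟨W ∘L (S' ∘L (ContinuousLinearMap.adjoint W)), fun h => hW _, fun h v hv => ?_,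
    hWK.comp_clm _⟩
  obtain ⟨g, hg⟩ := J.surjective ⟨v, hv⟩
  have hv' : v = W g := by rw [← hJ, hg]
  rw [hv']
  simp only [ContinuousLinearMap.comp_apply]
  rw [← hS, hS', ContinuousLinearMap.adjoint_inner_right]

end Forms

/-! ### Compact resolvents: completeness of eigenvectors and the lowest eigenvalue. -/

section Spectral

variable {H : Type*} [NormedAddCommGroup H] [InnerProductSpace ℂ H]

/-- The eigenvectors, with eigenvalues in `S`, of the operator generated by the form `a` on `D`. -/
def eigenvectors (D : Submodule ℂ H) (a : H → H → ℂ) (S : Set ℝ) : Set H :=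
  {u | ∃ t ∈ S, u ∈ D ∧ ∀ v ∈ D, a u v = inner ℂ v ((t : ℂ) • u)}

variable {D : Submodule ℂ H} {a : H → H → ℂ} {R : H →L[ℂ] H}

/-- The bounded operator `R` is the inverse of `A + 1`, where `A` is the operator generated by the
form `a` on `D`. -/
structure IsShiftedInverse (D : Submodule ℂ H) (a : H → H → ℂ) (R : H →L[ℂ] H) : Prop where
  mem : ∀ h, R h ∈ D
  form_apply : ∀ h, ∀ v ∈ D, a (R h) v + inner ℂ v (R h) = inner ℂ v h

namespace IsShiftedInverse

/-- Testing the equation of R h with R h itself. Positivity is what forces the extreme spectral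
point of R to be +‖R‖ rather than -‖R‖. -/
lemma inner_apply_re_nonneg (hR : IsShiftedInverse D a R) (hpos : ∀ u ∈ D, 0 ≤ (a u u).re) (h : H) :
    0 ≤ (inner ℂ (R h) h : ℂ).re := by
  rw [← hR.form_apply h _ (hR.mem h), Complex.add_re]
  exact add_nonneg (hpos _ (hR.mem h)) (inner_self_nonneg (𝕜 := ℂ))

/-- Both sides are the values of the hermitian form a + (·,·) at the pair R h, R k. -/
lemma isSymmetric (hR : IsShiftedInverse D a R) (hsymm : ∀ u ∈ D, ∀ v ∈ D, star (a u v) = a v u) :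
    R.IsSymmetric := by
  intro h k
  change inner ℂ (R h) k = inner ℂ h (R k)
  rw [← hR.form_apply k _ (hR.mem h), ← inner_conj_symm h (R k), ← hR.form_apply h _ (hR.mem k),
    map_add, inner_conj_symm]
  congr 1
  exact (hsymm _ (hR.mem h) _ (hR.mem k)).symm

lemma injective (hR : IsShiftedInverse D a R) (ha : IsSesqOn D a) (hD : Dense (D : Set H)) {h : H}
    (h0 : R h = 0) : h = 0 := by
  refine hD.eq_zero_of_inner_right ℂ fun v hv => ?_
  have hz := ha.smul_left 0 0 D.zero_mem v hv
  rw [← hR.form_apply h v hv, h0, inner_zero_right, add_zero]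
  simpa using hz

/-- With R = (A + 1)⁻¹, an eigenvalue z of R corresponds to the eigenvalue 1/z - 1 of A. -/
lemma mem_eigenvectors (hR : IsShiftedInverse D a R) (ha : IsSesqOn D a) {u : H} {z : ℝ}
    (hz : z ≠ 0) (hu : R u = (z : ℂ) • u) {S : Set ℝ} (hS : z⁻¹ - 1 ∈ S) :
    u ∈ eigenvectors D a S := by
  have hz' : (z : ℂ) ≠ 0 := Complex.ofReal_ne_zero.2 hz
  have huD : u ∈ D := by
    have := D.smul_mem (z : ℂ)⁻¹ (hR.mem u)
    rwa [hu, smul_smul, inv_mul_cancel₀ hz', one_smul] at this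
  refine ⟨_, hS, huD, fun v hv => ?_⟩
  have h1 := hR.form_apply u v hv
  rw [hu, ha.smul_left _ _ huD _ hv, inner_smul_right] at h1
  rw [inner_smul_right]
  push_cast
  field_simp
  linear_combination h1

variable [CompleteSpace H]

/-- The spectral theorem for the compact symmetric operator R: its eigenspaces are total. The
eigenvalue 0 is excluded by injectivity, and the others are real, so each eigenvector of R is one of
A. -/
lemma closure_span_eigenvectors (hR : IsShiftedInverse D a R) (hK : IsCompactOperator R)
    (ha : IsSesqOn D a) (hD : Dense (D : Set H))
    (hsymm : ∀ u ∈ D, ∀ v ∈ D, star (a u v) = a v u) :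
    (Submodule.span ℂ (eigenvectors D a Set.univ)).topologicalClosure = ⊤ := by
  rw [Submodule.topologicalClosure_eq_top_iff, eq_bot_iff,
    ← ContinuousLinearMap.orthogonalComplement_iSup_eigenspaces_eq_bot hK (hR.isSymmetric hsymm)]
  refine Submodule.orthogonal_le (iSup_le fun ν u hu => ?_)
  rcases eq_or_ne u 0 with rfl | hu0
  · exact Submodule.zero_mem _
  have hu' : R u = ν • u := Module.End.mem_eigenspace_iff.1 hu
  have hν0 : ν ≠ 0 := by
    rintro rfl
    rw [zero_smul] at hu'
    exact hu0 (hR.injective ha hD hu')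
  have hev : Module.End.HasEigenvalue (R : Module.End ℂ H) ν :=
    Module.End.hasEigenvalue_of_hasEigenvector ⟨hu, hu0⟩
  have hν : (starRingEnd ℂ) ν = ν := (hR.isSymmetric hsymm).conj_eigenvalue_eq_self hev
  obtain ⟨z, rfl⟩ := Complex.conj_eq_iff_real.1 hν
  exact Submodule.subset_span
    (hR.mem_eigenvectors ha (Complex.ofReal_ne_zero.1 hν0) hu' (Set.mem_univ _))

/-- The variational principle: there is an eigenvalue not exceeding `a[e, e]`, `‖e‖ = 1`. -/
lemma exists_eigenvector_le (hR : IsShiftedInverse D a R) (hK : IsCompactOperator R)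
    (ha : IsSesqOn D a) (hsymm : ∀ u ∈ D, ∀ v ∈ D, star (a u v) = a v u)
    (hpos : ∀ u ∈ D, 0 ≤ (a u u).re) {e : H} (he : e ∈ D) (he1 : ‖e‖ = 1) {κ : ℝ}
    (hκ : (a e e).re ≤ κ) :
    ∃ u ∈ eigenvectors D a (Set.Icc 0 κ), u ≠ 0 := by
  have hκ0 : 0 ≤ κ := (hpos e he).trans hκ
  have : Nontrivial H := ⟨e, 0, fun h => by simp [h] at he1⟩
  have hee : (inner ℂ e e : ℂ) = 1 := by simp [inner_self_eq_norm_sq_to_K, he1]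
  -- Let q = a + (·,·) and s = 1/(1+κ). Positivity of q at R e - s e gives 0 ≤ (R e, e) - 2s + s²
  -- q[e,e] ≤ ‖R‖ - s.
  have hRe : (1 + κ)⁻¹ ≤ ‖R‖ := by
    set s : ℝ := (1 + κ)⁻¹ with hs
    have hs0 : 0 < s := by positivity
    have hq := ha.add (IsSesqOn.inner D)
    set w := R e - (s : ℂ) • e with hw
    have hwD : w ∈ D := D.sub_mem (hR.mem e) (D.smul_mem _ he)
    have h0 : 0 ≤ (a w w + inner ℂ w w).re := by
      rw [Complex.add_re]; exact add_nonneg (hpos w hwD) (inner_self_nonneg (𝕜 := ℂ))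
    have h1 : a w w + inner ℂ w w
        = inner ℂ w e - (s : ℂ) * (star (a w e + inner ℂ e w)) := by
      have := hq.sub_left (hR.mem e) (D.smul_mem (s : ℂ) he) hwD
      rw [← hw] at this
      rw [this, hR.form_apply e w hwD, hq.smul_left _ e he w hwD]
      congr 2
      rw [star_add, hsymm w hwD e he]
      congr 1
      exact (inner_conj_symm _ _).symm
    have h2 : a w e + inner ℂ e w = 1 - s * (a e e + 1) := by
      have := hq.sub_left (hR.mem e) (D.smul_mem (s : ℂ) he) he
      rw [← hw] at this
      rw [this, hR.form_apply e e he, hq.smul_left _ e he e he, hee]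
    have h3 : (inner ℂ w e : ℂ) = inner ℂ (R e) e - s := by
      rw [hw, inner_sub_left, inner_smul_left, hee]; simp
    rw [h1, h2, h3] at h0
    have h4 : (inner ℂ (R e) e : ℂ).re ≤ ‖R‖ := by
      refine (Complex.re_le_norm _).trans ((norm_inner_le_norm _ _).trans ?_)
      rw [he1, mul_one]
      simpa [he1] using R.le_opNorm e
    simp only [Complex.sub_re, Complex.mul_re, Complex.ofReal_re, Complex.ofReal_im, zero_mul,
      sub_zero, RCLike.star_def, Complex.conj_re, Complex.add_re, Complex.one_re] at h0
    have h5 : s * (1 + κ) = 1 := inv_mul_cancel₀ (by positivity)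
    have h6 : s * (s * ((a e e).re + 1)) ≤ s := by
      have : s * ((a e e).re + 1) ≤ 1 := by nlinarith
      nlinarith
    nlinarith
  have hRpos : 0 < ‖R‖ := lt_of_lt_of_le (by positivity) hRe
  -- For a self-adjoint operator the spectral radius is the norm. The point attaining it is nonzero,
  -- hence an eigenvalue by compactness, and it equals ‖R‖ by positivity. The eigenvalue of A is
  -- then 1/‖R‖ - 1 ≤ κ.
  obtain ⟨z, hz, hzR⟩ := spectrum.exists_nnnorm_eq_spectralRadius R
  rw [ContinuousLinearMap.spectralRadius_eq_nnnorm R (hR.isSymmetric hsymm).isSelfAdjoint,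
    ENNReal.coe_inj] at hzR
  have hzR' : ‖z‖ = ‖R‖ := congrArg NNReal.toReal hzR
  have hz0 : z ≠ 0 := by rintro rfl; simp at hzR'; simp [← hzR'] at hRpos
  have hev := (hK.hasEigenvalue_iff_mem_spectrum hz0).2 hz
  obtain ⟨u, hu⟩ := hev.exists_hasEigenvector
  have hν : (starRingEnd ℂ) z = z := (hR.isSymmetric hsymm).conj_eigenvalue_eq_self hev
  obtain ⟨x, rfl⟩ := Complex.conj_eq_iff_real.1 hν
  have hux : R u = (x : ℂ) • u := Module.End.mem_eigenspace_iff.1 hu.1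
  have hu0 : 0 < ‖u‖ := norm_pos_iff.2 hu.2
  have hx0 : 0 ≤ x := by
    have h1 := hR.inner_apply_re_nonneg hpos u
    rw [hux, inner_smul_left, inner_self_eq_norm_sq_to_K] at h1
    have h2 : 0 ≤ x * ‖u‖ ^ 2 := by
      simpa [← Complex.ofReal_pow] using h1
    exact nonneg_of_mul_nonneg_left h2 (by positivity)
  have hxR : x = ‖R‖ := by
    rw [← hzR', Complex.norm_real, Real.norm_of_nonneg hx0]
  have hxpos : 0 < x := hxR ▸ hRpos
  obtain ⟨t, ht, huD, hut⟩ := hR.mem_eigenvectors ha hxpos.ne' hux (Set.mem_singleton (x⁻¹ - 1))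
  refine ⟨u, ⟨t, ⟨?_, ?_⟩, huD, hut⟩, hu.2⟩
  · have h1 := hpos u huD
    rw [hut u huD, inner_smul_right, inner_self_eq_norm_sq_to_K] at h1
    have h2 : 0 ≤ t * ‖u‖ ^ 2 := by
      simpa [← Complex.ofReal_pow] using h1
    exact nonneg_of_mul_nonneg_left h2 (by positivity)
  · rw [Set.mem_singleton_iff.1 ht, sub_le_iff_le_add, add_comm, hxR]
    exact inv_le_of_inv_le₀ (by positivity) hRe

end IsShiftedInverse

end Spectral

/-! ### Abstract perturbation of a simple lowest eigenvalue. -/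

section Perturbation

variable {H : Type*} [NormedAddCommGroup H] [InnerProductSpace ℂ H]

/-- A form `a` that is a perturbation of `a₀`, with first-order part `a₁` of size `t` and remainder
of size `p`, on a form domain with norm `N`; `e` spans the kernel of `a₀`, and both forms are
coercive on its orthogonal complement. -/
structure IsPerturbation (D : Submodule ℂ H) (N : H → ℝ) (a₀ a a₁ : H → H → ℂ) (e : H)
    (t p C₁ C₂ c γ : ℝ) : Prop where
  sesq₀ : IsSesqOn D a₀
  sesq : IsSesqOn D a
  sesq₁ : IsSesqOn D a₁
  mem : e ∈ D
  norm_e : ‖e‖ = 1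
  N_e : N e = 1
  norm_le : ∀ u ∈ D, ‖u‖ ≤ N u
  rem_le : ∀ u ∈ D, ∀ v ∈ D, ‖a u v - a₀ u v - a₁ u v‖ ≤ C₁ * p * N u * N v
  first_le : ∀ u ∈ D, ∀ v ∈ D, ‖a₁ u v‖ ≤ C₂ * t * N u * N v
  coercive₀ : ∀ v ∈ D, inner ℂ e v = 0 → c * N v ^ 2 ≤ (a₀ v v).re
  coercive : ∀ v ∈ D, inner ℂ e v = 0 → c * N v ^ 2 ≤ (a v v).re
  lower : ∀ v ∈ D, inner ℂ e v = 0 → γ * ‖v‖ ^ 2 ≤ (a v v).re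
  kernel_left : ∀ v ∈ D, a₀ e v = 0
  kernel_right : ∀ v ∈ D, a₀ v e = 0
  first_e : a₁ e e = 0
  t_nonneg : 0 ≤ t
  p_nonneg : 0 ≤ p
  -- In the application t = |ξ| ≤ π and p = |ξ|^α with 1 < α < 2. The number 4 is a round bound for
  -- π, and the conditions say that p lies between t² and t up to constants.
  t_le : t ≤ 4
  p_le : p ≤ 4 * t
  t_sq_le : t ^ 2 ≤ 4 * p
  C₁_nonneg : 0 ≤ C₁
  C₂_nonneg : 0 ≤ C₂
  c_pos : 0 < c
  γ_pos : 0 < γ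

/-- The constant in the bound for the correction of the eigenvector. -/
def corrConst (C₁ C₂ c : ℝ) : ℝ := 3 / (2 * c) * (4 * C₁ + C₂)

/-- The constant in the bound for the eigenvalue. -/
def eigConst (C₁ C₂ c : ℝ) : ℝ := C₁ + 4 * (4 * C₁ + C₂) * corrConst C₁ C₂ c

/-- The constant in the bound for the second-order correction of the eigenvector. -/
def corrConst₂ (C₁ C₂ c : ℝ) : ℝ :=
  (4 * eigConst C₁ C₂ c * corrConst C₁ C₂ c + 4 * C₂ * corrConst C₁ C₂ c
    + C₁ * (1 + 4 * corrConst C₁ C₂ c)) / c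

/-- The constant in the bound for the remainder in the expansion of the eigenvalue. -/
def remConst (C₁ C₂ c : ℝ) : ℝ := C₂ * corrConst₂ C₁ C₂ c + C₁ * corrConst C₁ C₂ c

namespace IsPerturbation

variable {D : Submodule ℂ H} {N : H → ℝ} {a₀ a a₁ : H → H → ℂ} {e r w : H}
  {t p C₁ C₂ c γ l : ℝ}

lemma N_nonneg (h : IsPerturbation D N a₀ a a₁ e t p C₁ C₂ c γ) {u : H} (hu : u ∈ D) : 0 ≤ N u :=
  (norm_nonneg u).trans (h.norm_le u hu)

lemma corrConst_nonneg (h : IsPerturbation D N a₀ a a₁ e t p C₁ C₂ c γ) :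
    0 ≤ corrConst C₁ C₂ c := by
  have := h.C₁_nonneg; have := h.C₂_nonneg; have := h.c_pos
  unfold corrConst; positivity

lemma eigConst_nonneg (h : IsPerturbation D N a₀ a a₁ e t p C₁ C₂ c γ) :
    0 ≤ eigConst C₁ C₂ c := by
  have := h.C₁_nonneg; have := h.C₂_nonneg; have := h.corrConst_nonneg
  unfold eigConst; positivity

/-- `a - a₀` is of size `t`. -/
lemma sub_le (h : IsPerturbation D N a₀ a a₁ e t p C₁ C₂ c γ) {u v : H} (hu : u ∈ D) (hv : v ∈ D) :
    ‖a u v - a₀ u v‖ ≤ (4 * C₁ + C₂) * t * N u * N v := by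
  have h1 := norm_add_le (a u v - a₀ u v - a₁ u v) (a₁ u v)
  rw [sub_add_cancel] at h1
  have h2 : C₁ * p * N u * N v ≤ C₁ * (4 * t) * N u * N v := by
    have := h.N_nonneg hu; have := h.N_nonneg hv; have := h.C₁_nonneg; have := h.p_le
    gcongr
  linarith [h.rem_le u hu v hv, h.first_le u hu v hv]

/-- First-order bound for the correction `r` of the eigenvector `e + r`. -/
lemma correction_le (h : IsPerturbation D N a₀ a a₁ e t p C₁ C₂ c γ) (hr : r ∈ D)
    (hre : inner ℂ e r = 0) (hl : l ≤ γ / 3)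
    (heig : ∀ v ∈ D, a (e + r) v = inner ℂ v ((l : ℂ) • (e + r))) :
    N r ≤ corrConst C₁ C₂ c * t := by
  have hre' : inner ℂ r e = 0 := inner_eq_zero_symm.1 hre
  -- The eigenvalue equation tested with r; the pairing of r with e drops out by orthogonality.
  have h1 : a r r = l * (‖r‖ ^ 2 : ℝ) - (a e r - a₀ e r) := by
    have := heig r hr
    rw [h.sesq.add_left e h.mem r hr r hr, inner_smul_right, inner_add_right, hre',
      inner_self_eq_norm_sq_to_K] at this
    rw [h.kernel_left r hr]
    push_cast
    linear_combination this
  have h2 : (a r r).re ≤ l * ‖r‖ ^ 2 + (4 * C₁ + C₂) * t * N r := by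
    rw [h1, Complex.sub_re, ← Complex.ofReal_mul, Complex.ofReal_re]
    have := (neg_le_abs _).trans ((Complex.abs_re_le_norm _).trans (h.sub_le h.mem hr))
    rw [h.N_e, mul_one] at this
    linarith
  have h3 := h.lower r hr hre
  have h4 := h.coercive r hr hre
  have h5 : l * ‖r‖ ^ 2 ≤ γ / 3 * ‖r‖ ^ 2 := by gcongr
  -- The term l‖r‖² is at most a third of a[r,r] by the gap. Absorbing it on the left leaves two
  -- thirds, hence the factor 3/2.
  have h6 : c * N r ^ 2 ≤ 3 / 2 * ((4 * C₁ + C₂) * t * N r) := by linarith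
  rcases (h.N_nonneg hr).eq_or_lt with h0 | hpos
  · rw [← h0]; exact mul_nonneg h.corrConst_nonneg h.t_nonneg
  · have hc := h.c_pos
    have h7 : c * N r ≤ 3 / 2 * ((4 * C₁ + C₂) * t) := by
      refine le_of_mul_le_mul_right ?_ hpos
      linarith
    unfold corrConst
    have : N r = (c * N r) / c := by field_simp
    rw [this, div_le_iff₀ hc]
    refine h7.trans (le_of_eq ?_)
    field_simp

/-- The eigenvalue equation tested with e, using that e is normalized and orthogonal to r. -/
lemma eigenvalue_eq (h : IsPerturbation D N a₀ a a₁ e t p C₁ C₂ c γ) (hr : r ∈ D)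
    (hre : inner ℂ e r = 0)
    (heig : ∀ v ∈ D, a (e + r) v = inner ℂ v ((l : ℂ) • (e + r))) :
    (l : ℂ) = a e e + a r e := by
  have := heig e h.mem
  rw [h.sesq.add_left e h.mem r hr e h.mem, inner_smul_right, inner_add_right, hre,
    inner_self_eq_norm_sq_to_K, h.norm_e] at this
  rw [this]; simp

/-- In l = a[e,e] + a[r,e], the first term is pure remainder, since a₀ and a₁ vanish at (e, e), and
is of order p. The second is of order t · N r, hence of order t², which p dominates. -/
lemma eigenvalue_le (h : IsPerturbation D N a₀ a a₁ e t p C₁ C₂ c γ) (hr : r ∈ D)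
    (hre : inner ℂ e r = 0) (hl : l ≤ γ / 3)
    (heig : ∀ v ∈ D, a (e + r) v = inner ℂ v ((l : ℂ) • (e + r))) :
    |l| ≤ eigConst C₁ C₂ c * p := by
  have hN := h.correction_le hr hre hl heig
  have h1 := h.eigenvalue_eq hr hre heig
  have h2 : ‖a e e‖ ≤ C₁ * p := by
    have := h.rem_le e h.mem e h.mem
    rwa [h.kernel_left e h.mem, h.first_e, sub_zero, sub_zero, h.N_e, mul_one, mul_one] at this
  have h3 : ‖a r e‖ ≤ (4 * C₁ + C₂) * t * N r := by
    have := h.sub_le hr h.mem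
    rwa [h.kernel_right r hr, sub_zero, h.N_e, mul_one] at this
  have hC₁ := h.C₁_nonneg; have hC₂ := h.C₂_nonneg; have ht := h.t_nonneg
  have hcc := h.corrConst_nonneg
  have h4 : (4 * C₁ + C₂) * t * N r ≤ (4 * C₁ + C₂) * corrConst C₁ C₂ c * (4 * p) := by
    calc (4 * C₁ + C₂) * t * N r ≤ (4 * C₁ + C₂) * t * (corrConst C₁ C₂ c * t) := by gcongr
      _ = (4 * C₁ + C₂) * corrConst C₁ C₂ c * t ^ 2 := by ring
      _ ≤ _ := by gcongr; exact h.t_sq_le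
  have h5 : |l| = ‖(l : ℂ)‖ := by simp
  rw [h5, h1]
  refine (norm_add_le _ _).trans ?_
  unfold eigConst
  linarith

/-- Second-order bound for the correction of the eigenvector. -/
lemma correction_add_le (h : IsPerturbation D N a₀ a a₁ e t p C₁ C₂ c γ) (hr : r ∈ D)
    (hre : inner ℂ e r = 0) (hl : l ≤ γ / 3)
    (heig : ∀ v ∈ D, a (e + r) v = inner ℂ v ((l : ℂ) • (e + r)))
    (hw : w ∈ D) (hwe : inner ℂ e w = 0) (hcell : ∀ v ∈ D, a₀ w v = a₁ e v) :
    N (r + w) ≤ corrConst₂ C₁ C₂ c * p := by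
  have hN := h.correction_le hr hre hl heig
  have hl' := h.eigenvalue_le hr hre hl heig
  set s := r + w with hs
  have hsD : s ∈ D := D.add_mem hr hw
  have hse : inner ℂ e s = 0 := by rw [hs, inner_add_right, hre, hwe, add_zero]
  have hse' : inner ℂ s e = 0 := inner_eq_zero_symm.1 hse
  -- The source a₁[e,s] of the cell problem cancels the first-order part of a[e,s]. The terms left
  -- over are of order pt, t², p and pt, all dominated by p.
  have h1 : a₀ s s = l * inner ℂ s r - a₁ r s - (a e s - a₀ e s - a₁ e s)
      - (a r s - a₀ r s - a₁ r s) := by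
    have h2 := h.sesq₀.add_left r hr w hw s hsD
    rw [← hs, hcell s hsD] at h2
    have h3 := heig s hsD
    rw [h.sesq.add_left e h.mem r hr s hsD, inner_smul_right, inner_add_right, hse', zero_add] at h3
    rw [h2, ← h3, h.kernel_left s hsD]
    ring
  have hC₁ := h.C₁_nonneg; have hC₂ := h.C₂_nonneg; have ht := h.t_nonneg; have hp := h.p_nonneg
  have hcc := h.corrConst_nonneg; have hec := h.eigConst_nonneg
  have hNs := h.N_nonneg hsD; have hNr := h.N_nonneg hr
  have hcct : corrConst C₁ C₂ c * t ≤ corrConst C₁ C₂ c * 4 := by gcongr; exact h.t_le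
  set k := corrConst C₁ C₂ c
  have e1 : ‖(l : ℂ) * inner ℂ s r‖ ≤ eigConst C₁ C₂ c * p * (k * 4) * N s := by
    rw [norm_mul, Complex.norm_real, Real.norm_eq_abs]
    calc |l| * ‖inner ℂ s r‖ ≤ (eigConst C₁ C₂ c * p) * (‖s‖ * ‖r‖) := by
          gcongr; exact norm_inner_le_norm _ _
      _ ≤ (eigConst C₁ C₂ c * p) * (N s * (k * 4)) := by
          gcongr
          · exact h.norm_le s hsD
          · exact (h.norm_le r hr).trans (hN.trans hcct)
      _ = _ := by ring
  have e2 : ‖a₁ r s‖ ≤ C₂ * k * (4 * p) * N s := by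
    calc ‖a₁ r s‖ ≤ C₂ * t * N r * N s := h.first_le r hr s hsD
      _ ≤ C₂ * t * (k * t) * N s := by gcongr
      _ = C₂ * k * t ^ 2 * N s := by ring
      _ ≤ _ := by gcongr; exact h.t_sq_le
  have e3 : ‖a e s - a₀ e s - a₁ e s‖ ≤ C₁ * p * N s := by
    have := h.rem_le e h.mem s hsD
    rwa [h.N_e, mul_one] at this
  have e4 : ‖a r s - a₀ r s - a₁ r s‖ ≤ C₁ * p * (k * 4) * N s := by
    refine (h.rem_le r hr s hsD).trans ?_
    gcongr
    exact hN.trans hcct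
  have h5 : c * N s ^ 2 ≤ (4 * eigConst C₁ C₂ c * k + 4 * C₂ * k + C₁ * (1 + 4 * k)) * p * N s := by
    refine (h.coercive₀ s hsD hse).trans ((Complex.re_le_norm _).trans ?_)
    rw [h1]
    have n1 := norm_sub_le ((l : ℂ) * inner ℂ s r - a₁ r s - (a e s - a₀ e s - a₁ e s))
      (a r s - a₀ r s - a₁ r s)
    have n2 := norm_sub_le ((l : ℂ) * inner ℂ s r - a₁ r s) (a e s - a₀ e s - a₁ e s)
    have n3 := norm_sub_le ((l : ℂ) * inner ℂ s r) (a₁ r s)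
    linarith
  have hc := h.c_pos
  rcases hNs.eq_or_lt with h0 | hpos
  · rw [← h0]
    unfold corrConst₂
    positivity
  · unfold corrConst₂
    rw [div_mul_eq_mul_div, le_div_iff₀ hc]
    refine le_of_mul_le_mul_right ?_ hpos
    linarith

/-- The expansion of the eigenvalue. -/
lemma eigenvalue_sub_le (h : IsPerturbation D N a₀ a a₁ e t p C₁ C₂ c γ) (hr : r ∈ D)
    (hre : inner ℂ e r = 0) (hl : l ≤ γ / 3)
    (heig : ∀ v ∈ D, a (e + r) v = inner ℂ v ((l : ℂ) • (e + r)))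
    (hw : w ∈ D) (hwe : inner ℂ e w = 0) (hcell : ∀ v ∈ D, a₀ w v = a₁ e v) :
    ‖(l : ℂ) - (a e e - a₁ w e)‖ ≤ remConst C₁ C₂ c * (t * p) := by
  have hN := h.correction_le hr hre hl heig
  have hNs := h.correction_add_le hr hre hl heig hw hwe hcell
  -- Two replacements are made in a[r,e]: the form a by a₁ (error p · t), then r by -w (error t ·
  -- p).
  have h1 : (l : ℂ) - (a e e - a₁ w e) = a₁ (r + w) e + (a r e - a₀ r e - a₁ r e) := by
    rw [h.eigenvalue_eq hr hre heig, h.sesq₁.add_left r hr w hw e h.mem, h.kernel_right r hr]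
    ring
  have hC₁ := h.C₁_nonneg; have hC₂ := h.C₂_nonneg; have ht := h.t_nonneg; have hp := h.p_nonneg
  have e1 : ‖a₁ (r + w) e‖ ≤ C₂ * t * (corrConst₂ C₁ C₂ c * p) := by
    refine (h.first_le _ (D.add_mem hr hw) e h.mem).trans ?_
    rw [h.N_e, mul_one]
    gcongr
  have e2 : ‖a r e - a₀ r e - a₁ r e‖ ≤ C₁ * p * (corrConst C₁ C₂ c * t) := by
    refine (h.rem_le r hr e h.mem).trans ?_
    rw [h.N_e, mul_one]
    gcongr
  rw [h1]
  refine (norm_add_le _ _).trans ((add_le_add e1 e2).trans (le_of_eq ?_))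
  unfold remConst
  ring

/-- An eigenvector with eigenvalue at most `γ / 3` is not orthogonal to `e`. -/
lemma inner_ne_zero (h : IsPerturbation D N a₀ a a₁ e t p C₁ C₂ c γ) {u : H}
    (hu : u ∈ eigenvectors D a (Set.Icc 0 (γ / 3))) (hu0 : u ≠ 0) : inner ℂ e u ≠ 0 := by
  obtain ⟨l, hl, huD, heig⟩ := hu
  intro h0
  have h1 := h.lower u huD h0
  rw [heig u huD, inner_smul_right, inner_self_eq_norm_sq_to_K] at h1
  have h2 : γ * ‖u‖ ^ 2 ≤ l * ‖u‖ ^ 2 := by simpa [← Complex.ofReal_pow] using h1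
  have h3 : 0 < ‖u‖ ^ 2 := by have := norm_pos_iff.2 hu0; positivity
  have := le_of_mul_le_mul_right h2 h3
  linarith [hl.2, h.γ_pos]

lemma smul_mem_eigenvectors (ha : IsSesqOn D a) {S : Set ℝ} {u : H} (k : ℂ)
    (hu : u ∈ eigenvectors D a S) : k • u ∈ eigenvectors D a S := by
  obtain ⟨l, hl, huD, heig⟩ := hu
  refine ⟨l, hl, D.smul_mem _ huD, fun v hv => ?_⟩
  rw [ha.smul_left k u huD v hv, heig v hv, smul_comm (l : ℂ) k u, inner_smul_right v _ k]

/-- The eigenvectors with eigenvalues at most `γ / 3` are proportional to each other. -/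
lemma eq_of_mem_eigenvectors (h : IsPerturbation D N a₀ a a₁ e t p C₁ C₂ c γ)
    (hsymm : ∀ u ∈ D, ∀ v ∈ D, star (a u v) = a v u) {u u' : H}
    (hu : u ∈ eigenvectors D a (Set.Icc 0 (γ / 3)))
    (hu' : u' ∈ eigenvectors D a (Set.Icc 0 (γ / 3))) (he : inner ℂ e u = inner ℂ e u') :
    u = u' := by
  obtain ⟨l, hl, huD, heig⟩ := hu
  obtain ⟨l', hl', huD', heig'⟩ := hu'
  have hwD := D.sub_mem huD huD'
  have hwe : inner ℂ e (u - u') = 0 := by rw [inner_sub_right, he, sub_self]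
  -- The difference is orthogonal to e, so the gap demands γ‖u - u'‖², three times what the
  -- eigenvalues allow; hence it vanishes.
  have key : (a (u - u') (u - u')).re ≤ γ / 3 * ‖u - u'‖ ^ 2 := by
    have h1 : a (u - u') (u - u') = l * inner ℂ (u - u') u - l' * inner ℂ (u - u') u' := by
      rw [h.sesq.sub_left huD huD' hwD, heig _ hwD, heig' _ hwD, inner_smul_right, inner_smul_right]
    -- By symmetry either the eigenvalues coincide or the eigenvectors are orthogonal; in both cases
    -- the form of the difference is controlled by its squared norm.
    have h2 : ((l : ℂ) - l') * inner ℂ u u' = 0 := by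
      have h3 := heig' u huD
      rw [← hsymm u huD u' huD', heig u' huD', inner_smul_right, inner_smul_right, star_mul',
        RCLike.star_def, Complex.conj_ofReal, inner_conj_symm] at h3
      linear_combination h3
    rcases mul_eq_zero.1 h2 with h3 | h3
    · have h4 : l = l' := by exact_mod_cast sub_eq_zero.1 h3
      rw [h1, ← h4, ← mul_sub, ← inner_sub_right, inner_self_eq_norm_sq_to_K]
      have : l * ‖u - u'‖ ^ 2 ≤ γ / 3 * ‖u - u'‖ ^ 2 := by gcongr; exact hl.2
      simpa [← Complex.ofReal_pow] using this
    · have h4 : inner ℂ u' u = 0 := inner_eq_zero_symm.1 h3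
      have h5 : ‖u - u'‖ ^ 2 = ‖u‖ ^ 2 + ‖u'‖ ^ 2 := by
        rw [@norm_sub_sq ℂ, h3]; simp
      rw [h1, inner_sub_left, inner_sub_left, h3, h4, inner_self_eq_norm_sq_to_K,
        inner_self_eq_norm_sq_to_K, h5]
      have e1 : l * ‖u‖ ^ 2 ≤ γ / 3 * ‖u‖ ^ 2 := by gcongr; exact hl.2
      have e2 : l' * ‖u'‖ ^ 2 ≤ γ / 3 * ‖u'‖ ^ 2 := by gcongr; exact hl'.2
      have e3 : ((l : ℂ) * ((‖u‖ : ℂ) ^ 2 - 0) - l' * (0 - (‖u'‖ : ℂ) ^ 2)).re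
          = l * ‖u‖ ^ 2 + l' * ‖u'‖ ^ 2 := by
        simp [← Complex.ofReal_pow]
      refine le_of_eq_of_le e3 ?_
      linarith
  have h6 := h.lower _ hwD hwe
  have h7 : ‖u - u'‖ ^ 2 ≤ 0 := by
    have := h.γ_pos
    nlinarith [sq_nonneg ‖u - u'‖]
  have h8 : ‖u - u'‖ = 0 := by nlinarith [norm_nonneg (u - u')]
  exact sub_eq_zero.1 (norm_eq_zero.1 h8)

/-- The projection is x ↦ (φ,x)φ/(1 + ‖r‖²) with φ = e + r; after clearing the denominator every
surviving term contains r. The constant 4 comes from 2ρ + 2ρ² ≤ 4ρ(1 + ρ²), valid for all ρ ≥ 0, so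
r need not be small. -/
lemma norm_projection_sub_le {e r : H} (he : ‖e‖ = 1) (hre : inner ℂ e r = 0) (x : H) :
    ‖(ℂ ∙ (e + r)).starProjection x - inner ℂ e x • e‖ ≤ 4 * ‖r‖ * ‖x‖ := by
  have hn : ‖e + r‖ ^ 2 = 1 + ‖r‖ ^ 2 := by rw [@norm_add_sq ℂ, hre, he]; simp
  have hn0 : (0 : ℝ) < 1 + ‖r‖ ^ 2 := by positivity
  have h1 : ‖((1 + ‖r‖ ^ 2 : ℝ) : ℂ) • ((ℂ ∙ (e + r)).starProjection x - inner ℂ e x • e)‖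
      ≤ (2 * ‖r‖ + 2 * ‖r‖ ^ 2) * ‖x‖ := by
    have h2 : ((1 + ‖r‖ ^ 2 : ℝ) : ℂ) • ((ℂ ∙ (e + r)).starProjection x - inner ℂ e x • e)
        = inner ℂ e x • r + inner ℂ r x • e + inner ℂ r x • r
          - (((‖r‖ ^ 2 : ℝ) : ℂ) * inner ℂ e x) • e := by
      have h3 := Submodule.smul_starProjection_singleton ℂ (v := e + r) x
      rw [smul_sub, ← hn]
      erw [h3]
      rw [hn, inner_add_left]
      push_cast
      module
    rw [h2]
    have i1 : ‖inner ℂ e x‖ ≤ ‖x‖ := by simpa [he] using norm_inner_le_norm (𝕜 := ℂ) e x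
    have i2 : ‖inner ℂ r x‖ ≤ ‖r‖ * ‖x‖ := norm_inner_le_norm _ _
    have j1 : ‖inner ℂ e x • r‖ ≤ ‖x‖ * ‖r‖ := by rw [norm_smul]; gcongr
    have j2 : ‖inner ℂ r x • e‖ ≤ ‖r‖ * ‖x‖ := by rw [norm_smul, he, mul_one]; exact i2
    have j3 : ‖inner ℂ r x • r‖ ≤ ‖r‖ * ‖x‖ * ‖r‖ := by rw [norm_smul]; gcongr
    have j4 : ‖(((‖r‖ ^ 2 : ℝ) : ℂ) * inner ℂ e x) • e‖ ≤ ‖r‖ ^ 2 * ‖x‖ := by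
      rw [norm_smul, norm_mul, he, mul_one, Complex.norm_real, Real.norm_of_nonneg (by positivity)]
      gcongr
    have k1 := norm_sub_le (inner ℂ e x • r + inner ℂ r x • e + inner ℂ r x • r)
      ((((‖r‖ ^ 2 : ℝ) : ℂ) * inner ℂ e x) • e)
    have k2 := norm_add_le (inner ℂ e x • r + inner ℂ r x • e) (inner ℂ r x • r)
    have k3 := norm_add_le (inner ℂ e x • r) (inner ℂ r x • e)
    nlinarith
  rw [norm_smul, Complex.norm_real, Real.norm_of_nonneg hn0.le] at h1
  refine le_of_mul_le_mul_left (h1.trans ?_) hn0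
  have h4 : 2 * ‖r‖ + 2 * ‖r‖ ^ 2 ≤ (1 + ‖r‖ ^ 2) * (4 * ‖r‖) := by
    have h0 := norm_nonneg r
    have : 0 ≤ 2 * ‖r‖ * (2 * ‖r‖ ^ 2 - ‖r‖ + 1) := by
      have : 0 ≤ 2 * ‖r‖ ^ 2 - ‖r‖ + 1 := by nlinarith [sq_nonneg (2 * ‖r‖ - 1)]
      positivity
    nlinarith
  calc _ ≤ (1 + ‖r‖ ^ 2) * (4 * ‖r‖) * ‖x‖ := by gcongr
    _ = _ := by ring

variable [CompleteSpace H]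

/-- The expansion of the operator of a perturbed form on the spectral subspace of its lowest
eigenvalue. -/
theorem exists_expansion (h : IsPerturbation D N a₀ a a₁ e t p C₁ C₂ c γ)
    (hsymm : ∀ u ∈ D, ∀ v ∈ D, star (a u v) = a v u) (hpos : ∀ u ∈ D, 0 ≤ (a u u).re)
    {R : H →L[ℂ] H} (hR : IsShiftedInverse D a R) (hK : IsCompactOperator R)
    (hae : (a e e).re ≤ γ / 3)
    (hw : w ∈ D) (hwe : inner ℂ e w = 0) (hcell : ∀ v ∈ D, a₀ w v = a₁ e v)
    {V : Submodule ℂ H} [V.HasOrthogonalProjection]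
    (hV : V = (Submodule.span ℂ (eigenvectors D a (Set.Icc 0 (γ / 3)))).topologicalClosure) :
    ∃ Φ : H →L[ℂ] H,
      ‖Φ‖ ≤ (4 * eigConst C₁ C₂ c * corrConst C₁ C₂ c + remConst C₁ C₂ c) * (t * p) ∧
      ∀ u, V.starProjection u ∈ D ∧ ∀ v ∈ D, a (V.starProjection u) v
        = inner ℂ v (((a e e - a₁ w e) * inner ℂ e u) • e + Φ u) := by
  obtain ⟨u, hu, hu0⟩ := hR.exists_eigenvector_le hK h.sesq hsymm hpos h.mem h.norm_e hae
  have hue := h.inner_ne_zero hu hu0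
  -- The eigenvector is normalized by its component along e, not by its norm, so that φ - e is
  -- orthogonal to e.
  set φ := (inner ℂ e u)⁻¹ • u with hφ
  have hφS := smul_mem_eigenvectors h.sesq (inner ℂ e u)⁻¹ hu
  rw [← hφ] at hφS
  have hee : (inner ℂ e e : ℂ) = 1 := by simp [inner_self_eq_norm_sq_to_K, h.norm_e]
  have heφ : inner ℂ e φ = 1 := by rw [hφ, inner_smul_right, inv_mul_cancel₀ hue]
  have hspan : Submodule.span ℂ (eigenvectors D a (Set.Icc 0 (γ / 3))) = ℂ ∙ φ := by
    refine le_antisymm (Submodule.span_le.2 fun ψ hψ => ?_)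
      (Submodule.span_mono (Set.singleton_subset_iff.2 hφS))
    refine Submodule.mem_span_singleton.2 ⟨inner ℂ e ψ, ?_⟩
    refine h.eq_of_mem_eigenvectors hsymm (smul_mem_eigenvectors h.sesq _ hφS) hψ ?_
    rw [inner_smul_right, heφ, mul_one]
  have hVφ : V = ℂ ∙ φ := by
    rw [hV, hspan]
    exact (Submodule.closed_of_finiteDimensional _).submodule_topologicalClosure_eq
  subst hVφ
  obtain ⟨l, hl, hφD, heig⟩ := hφS
  set r := φ - e with hr
  have hφr : φ = e + r := by rw [hr]; abel
  have hrD : r ∈ D := D.sub_mem hφD h.mem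
  have hre : inner ℂ e r = 0 := by rw [hr, inner_sub_right, heφ, hee, sub_self]
  have heig' := heig
  rw [hφr] at heig'
  have hN := h.correction_le hrD hre hl.2 heig'
  have hlp := h.eigenvalue_le hrD hre hl.2 heig'
  have hlm := h.eigenvalue_sub_le hrD hre hl.2 heig' hw hwe hcell
  set m := a e e - a₁ w e
  -- With F the projection onto φ and P that onto e, the error lF - mP equals l(F - P) + (l - m)P.
  -- Each summand is of order t · p.
  let Φ : H →L[ℂ] H := (l : ℂ) • (ℂ ∙ φ).starProjection - m • (innerSL ℂ e).smulRight e
  have hΦ : ∀ x, Φ x = (l : ℂ) • (ℂ ∙ φ).starProjection x - m • inner ℂ e x • e := fun x => rfl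
  refine ⟨Φ, ?_, fun x => ?_⟩
  · refine ContinuousLinearMap.opNorm_le_bound _ ?_ fun x => ?_
    · have := h.eigConst_nonneg; have := h.corrConst_nonneg; have := h.t_nonneg
      have := h.p_nonneg
      have h0 : 0 ≤ remConst C₁ C₂ c * (t * p) := (norm_nonneg _).trans hlm
      rw [add_mul]
      positivity
    · rw [hΦ]
      have h1 : (l : ℂ) • (ℂ ∙ φ).starProjection x - m • inner ℂ e x • e
          = (l : ℂ) • ((ℂ ∙ φ).starProjection x - inner ℂ e x • e)
            + (l - m) • inner ℂ e x • e := by module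
      rw [h1]
      refine (norm_add_le _ _).trans ?_
      rw [norm_smul, norm_smul, norm_smul, h.norm_e, mul_one, Complex.norm_real, Real.norm_eq_abs]
      have h2 : ‖(ℂ ∙ φ).starProjection x - inner ℂ e x • e‖ ≤ 4 * ‖r‖ * ‖x‖ := by
        have := norm_projection_sub_le h.norm_e hre x
        rwa [← hφr] at this
      have h3 : ‖r‖ ≤ corrConst C₁ C₂ c * t := (h.norm_le r hrD).trans hN
      have i1 : ‖inner ℂ e x‖ ≤ ‖x‖ := by simpa [h.norm_e] using norm_inner_le_norm (𝕜 := ℂ) e x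
      have := h.eigConst_nonneg; have := h.corrConst_nonneg; have := h.t_nonneg
      have := h.p_nonneg
      calc |l| * ‖(ℂ ∙ φ).starProjection x - inner ℂ e x • e‖ + ‖(l : ℂ) - m‖ * ‖inner ℂ e x‖
          ≤ (eigConst C₁ C₂ c * p) * (4 * (corrConst C₁ C₂ c * t) * ‖x‖)
            + (remConst C₁ C₂ c * (t * p)) * ‖x‖ := by
            refine add_le_add (mul_le_mul hlp (h2.trans (by gcongr)) (norm_nonneg _) (by positivity))
              (mul_le_mul hlm i1 (norm_nonneg _) ((norm_nonneg _).trans hlm))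
        _ = _ := by ring
  · obtain ⟨k, hk⟩ := Submodule.mem_span_singleton.1 ((ℂ ∙ φ).starProjection_apply_mem x)
    have hmem : (ℂ ∙ φ).starProjection x ∈ D := by rw [← hk]; exact D.smul_mem _ hφD
    refine ⟨hmem, fun v hv => ?_⟩
    have h4 : (m * inner ℂ e x) • e + Φ x = (l : ℂ) • (ℂ ∙ φ).starProjection x := by
      rw [hΦ, mul_smul]; abel
    rw [h4, ← hk, h.sesq.smul_left k φ hφD v hv, heig v hv, smul_comm (l : ℂ) k φ,
      inner_smul_right v _ k]

end IsPerturbation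

end Perturbation

/-! ### Integration of periodic functions over the cell. -/

section Cell

variable {d : ℕ}

lemma cellRep_eq_self {x : E d} (hx : x ∈ cell d) : cellRep x = x := by
  ext i
  exact Int.fract_eq_self.2 (hx i)

lemma cellRep_add_latticePt (x : E d) (m : Fin d → ℤ) : cellRep (x + latticePt m) = cellRep x := by
  ext i
  simp [cellRep, latticePt]

/-- The standard basis of `ℝ^d`. -/
abbrev stdBasis (d : ℕ) : Module.Basis (Fin d) ℝ (E d) := (EuclideanSpace.basisFun (Fin d) ℝ).toBasis

lemma fundamentalDomain_stdBasis (d : ℕ) : ZSpan.fundamentalDomain (stdBasis d) = cell d := by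
  ext x
  simp [ZSpan.mem_fundamentalDomain, cell]

lemma fract_stdBasis (x : E d) : ZSpan.fract (stdBasis d) x = cellRep x := by
  ext i
  have key : ∀ y : E d, (stdBasis d).repr y i = y i := fun y => by simp
  rw [← key, ZSpan.repr_fract_apply, key]
  rfl

lemma cellRep_vadd (g : Submodule.span ℤ (Set.range (stdBasis d))) (x : E d) :
    cellRep (g +ᵥ x) = cellRep x := by
  rw [← fract_stdBasis, ← fract_stdBasis]
  exact ZSpan.fract_zSpan_add _ _ g.2

instance vaddInvariantMeasure_stdBasis (d : ℕ) :
    VAddInvariantMeasure (Submodule.span ℤ (Set.range (stdBasis d))) (E d) volume :=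
  ⟨fun c s _ => measure_preimage_add volume (c : E d) s⟩

lemma isAddFundamentalDomain_cell (d : ℕ) :
    IsAddFundamentalDomain (Submodule.span ℤ (Set.range (stdBasis d))) (cell d) volume := by
  rw [← fundamentalDomain_stdBasis]
  exact ZSpan.isAddFundamentalDomain _ _

/-- Translations commute with the lattice action, so a translate of a fundamental domain is again
one. -/
lemma isAddFundamentalDomain_cell_translate (z : E d) :
    IsAddFundamentalDomain (Submodule.span ℤ (Set.range (stdBasis d)))
      ((fun x => x - z) ⁻¹' cell d) volume := by
  refine (isAddFundamentalDomain_cell d).preimage_of_equiv (f := fun x : E d => x - z)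
    (e := id) ?_ Function.bijective_id ?_
  · exact (measurePreserving_sub_right volume z).quasiMeasurePreserving
  · intro g x
    simp only [id, Submodule.vadd_def, vadd_eq_add]
    abel

/-- The shift moves the cell to another fundamental domain, over which a periodic function has the
same integral. -/
lemma setLIntegral_cell_sub (h : E d → ENNReal) (z : E d) :
    ∫⁻ x in cell d, h (cellRep (x - z)) = ∫⁻ x in cell d, h x := by
  have h1 : ∫⁻ x in cell d, h (cellRep (x - z)) = ∫⁻ x in (fun x => x - (-z)) ⁻¹' (cell d),
      h (cellRep x) := by
    have hs : cell d = (fun x => x - z) ⁻¹' ((fun x => x - (-z)) ⁻¹' cell d) := by ext; simp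
    conv_lhs => rw [hs]
    exact (measurePreserving_sub_right volume z).setLIntegral_comp_preimage_emb
      (MeasurableEquiv.subRight z).measurableEmbedding (fun x => h (cellRep x)) _
  rw [h1, (isAddFundamentalDomain_cell_translate (-z)).setLIntegral_eq
    (isAddFundamentalDomain_cell d) (fun x => h (cellRep x)) fun g x => by rw [cellRep_vadd]]
  exact setLIntegral_congr_fun (measurableSet_cell d) fun x hx => by simp only [cellRep_eq_self hx]

lemma setIntegral_cell_sub (h : E d → ℂ) (z : E d) :
    ∫ x in cell d, h (cellRep (x - z)) = ∫ x in cell d, h x := by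
  have h1 : ∫ x in cell d, h (cellRep (x - z)) = ∫ x in (fun x => x - (-z)) ⁻¹' (cell d),
      h (cellRep x) := by
    have hs : cell d = (fun x => x - z) ⁻¹' ((fun x => x - (-z)) ⁻¹' cell d) := by ext; simp
    conv_lhs => rw [hs]
    exact (measurePreserving_sub_right volume z).setIntegral_preimage_emb
      (MeasurableEquiv.subRight z).measurableEmbedding (fun x => h (cellRep x)) _
  rw [h1, (isAddFundamentalDomain_cell_translate (-z)).setIntegral_eq
    (isAddFundamentalDomain_cell d) (f := fun x => h (cellRep x)) fun g x => by rw [cellRep_vadd]]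
  exact setIntegral_congr_fun (measurableSet_cell d) fun x hx => by simp only [cellRep_eq_self hx]

/-- The substitution y = x - z separates the kernel, which depends on z only, from the correlation
of the function with its translate. -/
lemma lintegral_cell_prod {F : E d × E d → ENNReal} (hF : Measurable F) :
    ∫⁻ p, F p ∂((cellMeasure d).prod volume) = ∫⁻ z, ∫⁻ x in cell d, F (x, x - z) := by
  have h1 : ∀ x : E d, ∫⁻ y, F (x, y) = ∫⁻ z, F (x, x - z) := fun x =>
    (lintegral_sub_left_eq_self (μ := volume) (fun y => F (x, y)) x).symm
  rw [lintegral_prod _ hF.aemeasurable]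
  simp_rw [h1]
  exact lintegral_lintegral_swap
    (hF.comp (by fun_prop : Measurable fun p : E d × E d => (p.1, p.1 - p.2))).aemeasurable

lemma lintegral_cell_prod_fst {k h : E d → ENNReal} (hk : Measurable k) (hh : Measurable h) :
    ∫⁻ p, k (p.1 - p.2) * h (cellRep p.1) ∂((cellMeasure d).prod volume)
      = (∫⁻ z, k z) * ∫⁻ x in cell d, h x := by
  have := measurable_cellRep (d := d)
  rw [lintegral_cell_prod (by fun_prop), ← lintegral_mul_const _ hk]
  refine lintegral_congr fun z => ?_
  simp only [sub_sub_cancel]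
  rw [lintegral_const_mul _ (by fun_prop)]
  congr 1
  exact setLIntegral_congr_fun (measurableSet_cell d) fun x hx => by simp only [cellRep_eq_self hx]

/-- Although y ranges over all of ℝ^d, for fixed z the point x - z runs through a translated cell,
so the integral factorizes as it does for functions of x. -/
lemma lintegral_cell_prod_snd {k h : E d → ENNReal} (hk : Measurable k) (hh : Measurable h) :
    ∫⁻ p, k (p.1 - p.2) * h (cellRep p.2) ∂((cellMeasure d).prod volume)
      = (∫⁻ z, k z) * ∫⁻ x in cell d, h x := by
  have := measurable_cellRep (d := d)
  rw [lintegral_cell_prod (by fun_prop), ← lintegral_mul_const _ hk]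
  refine lintegral_congr fun z => ?_
  simp only [sub_sub_cancel]
  rw [lintegral_const_mul _ (by fun_prop), setLIntegral_cell_sub]

end Cell

/-! ### The Fourier basis of `L₂(Ω)`. -/

section Fourier

variable {d : ℕ}

/-- The frequency `2πn`, `n ∈ ℤ^d`. -/
def freq (n : Fin d → ℤ) : E d := (2 * Real.pi) • latticePt n

/-- The character `x ↦ e^{i⟨k,x⟩}`. -/
def character (k x : E d) : ℂ := exp (I * ((inner ℝ k x : ℝ) : ℂ))

lemma continuous_character (k : E d) : Continuous (character k) := by
  unfold character; fun_prop

lemma norm_character (k x : E d) : ‖character k x‖ = 1 := by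
  rw [character, mul_comm]; exact Complex.norm_exp_ofReal_mul_I _

lemma character_sub (k x y : E d) : character k (x - y) = character k x * star (character k y) := by
  simp only [character, RCLike.star_def, ← Complex.exp_conj, ← Complex.exp_add]
  congr 1
  simp [inner_sub_right]
  ring

lemma character_add_left (k l x : E d) : character (k + l) x = character k x * character l x := by
  simp only [character, ← Complex.exp_add]
  congr 1
  simp [inner_add_left]
  ring

lemma character_zero_left (x : E d) : character 0 x = 1 := by simp [character]

lemma freq_apply (n : Fin d → ℤ) (i : Fin d) : freq n i = 2 * Real.pi * n i := by
  simp [freq, latticePt]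

lemma freq_zero : freq (0 : Fin d → ℤ) = 0 := by
  ext i; simp [freq_apply]

lemma character_freq_eq (n : Fin d → ℤ) (x : E d) :
    character (freq n) x = UnitAddTorus.mFourier n (fun i => (x i : UnitAddCircle)) := by
  have h1 : ∀ i, fourier (n i) ((x i : ℝ) : UnitAddCircle) = exp (I * ((freq n i * x i : ℝ) : ℂ)) := by
    intro i
    rw [fourier_coe_apply, freq_apply]
    congr 1
    push_cast
    ring
  simp only [UnitAddTorus.mFourier, ContinuousMap.coe_mk, h1, ← Complex.exp_sum, character,
    ← Finset.mul_sum, ← Complex.ofReal_sum]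
  simp [PiLp.inner_apply, mul_comm]

lemma character_freq_cellRep (n : Fin d → ℤ) (x : E d) :
    character (freq n) (cellRep x) = character (freq n) x := by
  rw [character_freq_eq, character_freq_eq]
  congr 1
  funext i
  simp only [cellRep]
  rw [QuotientAddGroup.eq]
  refine AddSubgroup.mem_zmultiples_iff.2 ⟨⌊x i⌋, ?_⟩
  simp only [zsmul_eq_mul, mul_one]
  linarith [Int.self_sub_floor (x i)]

-- Haar probability measure is the normalization for which the characters of the torus are
-- orthonormal.
local instance : MeasureSpace UnitAddCircle := ⟨AddCircle.haarAddCircle⟩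

/-- The representative in `(0, 1]^d` of a point of the torus. -/
def torusSection (θ : UnitAddTorus (Fin d)) : E d :=
  WithLp.toLp 2 (UnitAddTorus.measurableEquivPiIoc (fun _ => 0) θ).1

/-- The point of the torus represented by a point of `ℝ^d`. -/
def toTorus (x : E d) : UnitAddTorus (Fin d) := fun i => (x i : UnitAddCircle)

lemma measurable_toTorus : Measurable (toTorus (d := d)) :=
  measurable_pi_lambda _ fun i => AddCircle.measurable_mk'.comp (by fun_prop)

lemma toTorus_torusSection (θ : UnitAddTorus (Fin d)) : toTorus (torusSection θ) = θ :=
  (UnitAddTorus.measurableEquivPiIoc (fun _ => 0)).symm_apply_apply θ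

/-- The section takes values in (0,1]^d while the cell is [0,1)^d; the two boxes differ by a null
set. -/
lemma measurePreserving_torusSection :
    MeasurePreserving (torusSection (d := d)) volume (cellMeasure d) := by
  have h1 := UnitAddTorus.measurePreserving_equivPiIoc (d := Fin d) (fun _ => (0 : ℝ))
  have hm : MeasurableSet {x : Fin d → ℝ | ∀ i, x i ∈ Set.Ioc (0 : ℝ) (0 + 1)} :=
    MeasurableSet.univ_pi' fun i => measurableSet_Ioc
  have h2 : MeasurePreserving (Subtype.val : {x : Fin d → ℝ | ∀ i, x i ∈ Set.Ioc (0 : ℝ) (0 + 1)} → _)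
      (Measure.comap Subtype.val volume) (volume.restrict _) :=
    ⟨measurable_subtype_coe, map_comap_subtype_coe hm _⟩
  have h3 : (volume : Measure (Fin d → ℝ)).restrict
      {x : Fin d → ℝ | ∀ i, x i ∈ Set.Ioc (0 : ℝ) (0 + 1)}
      = volume.restrict (Set.univ.pi fun _ => Set.Ico (0 : ℝ) 1) := by
    refine Measure.restrict_congr_set ?_
    have : {x : Fin d → ℝ | ∀ i, x i ∈ Set.Ioc (0 : ℝ) (0 + 1)}
      = Set.univ.pi fun _ => Set.Ioc (0 : ℝ) 1 := by ext; simp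
    rw [this]
    exact Measure.univ_pi_Ioc_ae_eq_Icc.trans Measure.univ_pi_Ico_ae_eq_Icc.symm
  have h4 := (PiLp.volume_preserving_toLp (Fin d)).restrict_preimage (measurableSet_cell d)
  have h5 : (WithLp.toLp 2 : (Fin d → ℝ) → E d) ⁻¹' cell d
      = Set.univ.pi fun _ => Set.Ico (0 : ℝ) 1 := by ext; simp [cell]
  rw [h5, ← h3] at h4
  exact h4.comp (h2.comp h1)

lemma measurePreserving_toTorus :
    MeasurePreserving (toTorus (d := d)) (cellMeasure d) volume := by
  refine ⟨measurable_toTorus, ?_⟩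
  rw [← measurePreserving_torusSection.map_eq, Measure.map_map measurable_toTorus
    measurePreserving_torusSection.measurable]
  have : toTorus ∘ torusSection (d := d) = id := funext toTorus_torusSection
  rw [this, Measure.map_id]

/-- `L₂(Ω)` as the `L₂`-space of the torus. -/
def torusIsometry (d : ℕ) :
    L2 d ≃ₗᵢ[ℂ] Lp ℂ 2 (volume : Measure (UnitAddTorus (Fin d))) :=
  LinearIsometryEquiv.ofSurjective
    (Lp.compMeasurePreservingₗᵢ ℂ torusSection measurePreserving_torusSection) <| by
  intro f
  refine ⟨Lp.compMeasurePreserving toTorus measurePreserving_toTorus f, ?_⟩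
  apply Lp.ext
  have h1 := Lp.coeFn_compMeasurePreserving
    (Lp.compMeasurePreserving toTorus measurePreserving_toTorus f) measurePreserving_torusSection
  have h2 := measurePreserving_torusSection.quasiMeasurePreserving.ae_eq_comp
    (Lp.coeFn_compMeasurePreserving f (measurePreserving_toTorus (d := d)))
  refine h1.trans (h2.trans (Filter.Eventually.of_forall fun θ => ?_))
  simp [toTorus_torusSection]

/-- The Fourier basis of `L₂(Ω)`. -/
def fourierBasis (d : ℕ) : HilbertBasis (Fin d → ℤ) ℂ (L2 d) :=
  HilbertBasis.ofRepr ((torusIsometry d).trans UnitAddTorus.mFourierBasis.repr)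

lemma memLp_character (k : E d) : MemLp (character k) 2 (cellMeasure d) :=
  MemLp.of_bound (continuous_character k).aestronglyMeasurable 1
    (Filter.Eventually.of_forall fun x => (norm_character k x).le)

/-- The basis is defined by transport from the torus; this identifies its vectors concretely, so
that coefficients become integrals over the cell. -/
lemma fourierBasis_eq (n : Fin d → ℤ) :
    fourierBasis d n = (memLp_character (freq n)).toLp (character (freq n)) := by
  have h0 : fourierBasis d n = (torusIsometry d).symm (UnitAddTorus.mFourierLp 2 n) := by
    rw [← UnitAddTorus.coe_mFourierBasis]
    classical
    rw [← HilbertBasis.repr_symm_single, ← HilbertBasis.repr_symm_single]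
    rfl
  rw [h0, LinearIsometryEquiv.symm_apply_eq]
  apply Lp.ext
  refine (UnitAddTorus.coeFn_mFourierLp 2 n).trans ?_
  refine Filter.EventuallyEq.symm ((Lp.coeFn_compMeasurePreserving _
    measurePreserving_torusSection).trans ?_)
  refine (measurePreserving_torusSection.quasiMeasurePreserving.ae_eq_comp
    (memLp_character (freq n)).coeFn_toLp).trans (Filter.Eventually.of_forall fun θ => ?_)
  simp only [Function.comp_apply, character_freq_eq]
  exact congrArg _ (toTorus_torusSection θ)

lemma fourierBasis_zero : fourierBasis d 0 = one d := by
  rw [fourierBasis_eq]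
  apply Lp.ext
  refine (MemLp.coeFn_toLp _).trans (Filter.EventuallyEq.trans ?_
    (MemLp.coeFn_toLp (memLp_const (1 : ℂ))).symm)
  exact Filter.Eventually.of_forall fun x => by simp only [freq_zero, character_zero_left]

lemma norm_one (d : ℕ) : ‖one d‖ = 1 := by
  rw [← fourierBasis_zero]
  exact (fourierBasis d).orthonormal.1 0

/-- The Fourier coefficients of a square-integrable function on `Ω`. -/
lemma fourierBasis_repr_toLp {f : E d → ℂ} (hf : MemLp f 2 (cellMeasure d)) (n : Fin d → ℤ) :
    (fourierBasis d).repr (hf.toLp f) n = ∫ x in cell d, star (character (freq n) x) * f x := by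
  rw [HilbertBasis.repr_apply_apply, fourierBasis_eq, L2.inner_def]
  refine integral_congr_ae ?_
  filter_upwards [(memLp_character (freq n)).coeFn_toLp, hf.coeFn_toLp] with x h1 h2
  rw [h1, h2, RCLike.inner_apply, mul_comm]
  rfl

lemma hasSum_sq_repr (u : L2 d) :
    HasSum (fun n => ‖(fourierBasis d).repr u n‖ ^ 2) (‖u‖ ^ 2) := by
  have h1 := lp.hasSum_norm (p := 2) (by norm_num) ((fourierBasis d).repr u)
  rw [LinearIsometryEquiv.norm_map] at h1
  simpa using h1

lemma lintegral_enorm_sq (u : L2 d) :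
    ∫⁻ x in cell d, ‖(u : E d → ℂ) x‖ₑ ^ 2 = ENNReal.ofReal (‖u‖ ^ 2) := by
  have h1 := Lp.enorm_def u
  rw [eLpNorm_eq_lintegral_rpow_enorm_toReal (by norm_num) (by norm_num)] at h1
  rw [ENNReal.ofReal_pow (norm_nonneg _), ofReal_norm, h1, ← ENNReal.rpow_natCast,
    ← ENNReal.rpow_mul]
  simp

end Fourier

/-! ### The Lévy kernel: integrability, scaling and symbol. -/

section Kernel

variable {d : ℕ} {α : ℝ}

/-- The Lévy kernel `|z|^{-d-α}`. -/
def kernel (α : ℝ) (z : E d) : ℝ := (‖z‖ ^ ((d : ℝ) + α))⁻¹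

lemma kernel_nonneg (z : E d) : 0 ≤ kernel α z := inv_nonneg.2 (Real.rpow_nonneg (norm_nonneg _) _)

@[fun_prop]
lemma measurable_kernel : Measurable (kernel (d := d) α) := by
  unfold kernel; fun_prop

/-- The function `min (r, r²)`, which controls the small and the large jumps. -/
def jumpWeight (r : ℝ) : ℝ := min r (r ^ 2)

lemma jumpWeight_nonneg {r : ℝ} (hr : 0 ≤ r) : 0 ≤ jumpWeight r := le_min hr (sq_nonneg r)

lemma jumpWeight_mono {r s : ℝ} (hr : 0 ≤ r) (h : r ≤ s) : jumpWeight r ≤ jumpWeight s :=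
  min_le_min h (by gcongr)

@[fun_prop]
lemma measurable_jumpWeight : Measurable jumpWeight := by
  unfold jumpWeight; fun_prop

lemma one_sub_cos_le (s : ℝ) : 1 - Real.cos s ≤ 2 * jumpWeight |s| := by
  have h1 := Real.one_sub_sq_div_two_le_cos (x := s)
  have h2 := Real.neg_one_le_cos s
  have h3 := Real.cos_le_one s
  unfold jumpWeight
  rw [sq_abs]
  rcases min_cases |s| (s ^ 2) with ⟨h, h'⟩ | ⟨h, h'⟩ <;> rw [h]
  · by_cases hs : 1 ≤ |s|
    · linarith
    · have h0 := abs_nonneg s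
      have : |s| ^ 2 ≤ |s| := by nlinarith
      rw [sq_abs] at this
      linarith
  · nlinarith [sq_nonneg s]

/-- Taylor's bound serves for |s| ≤ 1 and the trivial linear bound for |s| > 1. The estimate is the
source of the order `|ξ|^α` of the remainder. -/
lemma norm_exp_sub_one_sub_le (s : ℝ) :
    ‖1 - exp (I * (s : ℂ)) + I * s‖ ≤ 2 * jumpWeight |s| := by
  have hn : ‖exp (I * (s : ℂ))‖ = 1 := by rw [mul_comm]; exact Complex.norm_exp_ofReal_mul_I _
  have hI : ‖I * (s : ℂ)‖ = |s| := by simp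
  have key1 : ‖1 - exp (I * (s : ℂ)) + I * s‖ ≤ 2 * |s| := by
    have h1 : ‖exp (I * (s : ℂ)) - 1‖ ≤ |s| := by
      have := Real.norm_exp_I_mul_ofReal_sub_one_le (x := s)
      simpa using this
    have h2 := norm_add_le (1 - exp (I * (s : ℂ))) (I * s)
    rw [norm_sub_rev, hI] at h2
    linarith
  have key2 : |s| ≤ 1 → ‖1 - exp (I * (s : ℂ)) + I * s‖ ≤ |s| ^ 2 := by
    intro hs
    have := Complex.norm_exp_sub_one_sub_id_le (x := I * (s : ℂ)) (by rw [hI]; exact hs)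
    rw [hI] at this
    rw [← norm_neg]
    refine le_of_eq_of_le (congrArg norm ?_) this
    ring
  have h0 := abs_nonneg s
  unfold jumpWeight
  by_cases hs : |s| ≤ 1
  · have : |s| ^ 2 ≤ |s| := by nlinarith
    rw [min_eq_right this]
    have := key2 hs
    nlinarith [sq_nonneg |s|]
  · have : |s| ≤ |s| ^ 2 := by nlinarith
    rw [min_eq_left this]
    exact key1

/-- In polar coordinates the integrand is `r^{1-α}` near 0 and `r^{-α}` near infinity; the two ends
use α < 2 and α > 1 respectively. -/
lemma integrable_kernel [NeZero d] (hα₁ : 1 < α) (hα₂ : α < 2) :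
    Integrable (fun z : E d => jumpWeight ‖z‖ * kernel α z) := by
  have hd : 0 < d := Nat.pos_of_ne_zero (NeZero.ne d)
  have : Nonempty (Fin d) := ⟨⟨0, hd⟩⟩
  have hfin : Module.finrank ℝ (E d) = d := by simp
  refine (integrable_fun_norm_addHaar (volume : Measure (E d))
    (f := fun r => jumpWeight r * (r ^ ((d : ℝ) + α))⁻¹)).2 ?_
  rw [hfin]
  have hmeas : Measurable fun y : ℝ => y ^ (d - 1) • (jumpWeight y * (y ^ ((d : ℝ) + α))⁻¹) := by
    fun_prop
  have hpow : ∀ y : ℝ, 0 < y → y ^ (d - 1) * (y ^ ((d : ℝ) + α))⁻¹ = y ^ (-1 - α) := by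
    intro y hy
    rw [← Real.rpow_natCast, ← Real.rpow_neg hy.le, ← Real.rpow_add hy, Nat.cast_sub hd]
    congr 1
    push_cast
    ring
  rw [← Set.Ioc_union_Ioi_eq_Ioi zero_le_one]
  refine IntegrableOn.union ?_ ?_
  · have h1 : IntegrableOn (fun y : ℝ => y ^ (1 - α)) (Set.Ioc 0 1) := by
      rw [← intervalIntegrable_iff_integrableOn_Ioc_of_le zero_le_one]
      exact intervalIntegral.intervalIntegrable_rpow' (by linarith)
    refine Integrable.mono' h1 hmeas.aestronglyMeasurable ?_
    refine (ae_restrict_mem measurableSet_Ioc).mono fun y hy => ?_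
    have hy0 := hy.1
    rw [smul_eq_mul, mul_left_comm, hpow y hy0, Real.norm_of_nonneg
      (mul_nonneg (jumpWeight_nonneg hy0.le) (Real.rpow_nonneg hy0.le _))]
    calc jumpWeight y * y ^ (-1 - α) ≤ y ^ 2 * y ^ (-1 - α) := by
          gcongr; exact min_le_right _ _
      _ = y ^ (1 - α) := by
          rw [← Real.rpow_natCast, ← Real.rpow_add hy0]; congr 1; push_cast; ring
  · have h1 : IntegrableOn (fun y : ℝ => y ^ (-α)) (Set.Ioi 1) :=
      integrableOn_Ioi_rpow_of_lt (by linarith) one_pos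
    refine Integrable.mono' h1 hmeas.aestronglyMeasurable ?_
    refine (ae_restrict_mem measurableSet_Ioi).mono fun y hy => ?_
    have hy0 : 0 < y := one_pos.trans hy
    rw [smul_eq_mul, mul_left_comm, hpow y hy0, Real.norm_of_nonneg
      (mul_nonneg (jumpWeight_nonneg hy0.le) (Real.rpow_nonneg hy0.le _))]
    calc jumpWeight y * y ^ (-1 - α) ≤ y * y ^ (-1 - α) := by
          gcongr; exact min_le_left _ _
      _ = y ^ (-α) := by
          nth_rw 1 [← Real.rpow_one y]; rw [← Real.rpow_add hy0]; congr 1; ring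

/-- The total mass of the kernel with the weight `min (|z|, |z|²)`. -/
def kernelMass (d : ℕ) (α : ℝ) : ℝ := ∫ z : E d, jumpWeight ‖z‖ * kernel α z

lemma kernelMass_nonneg : 0 ≤ kernelMass d α :=
  integral_nonneg fun z => mul_nonneg (jumpWeight_nonneg (norm_nonneg _)) (kernel_nonneg z)

lemma lintegral_kernel [NeZero d] (hα₁ : 1 < α) (hα₂ : α < 2) :
    ∫⁻ z : E d, ENNReal.ofReal (jumpWeight ‖z‖ * kernel α z) = ENNReal.ofReal (kernelMass d α) :=
  (ofReal_integral_eq_lintegral_ofReal (integrable_kernel hα₁ hα₂) (Filter.Eventually.of_forall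
    fun z => mul_nonneg (jumpWeight_nonneg (norm_nonneg _)) (kernel_nonneg z))).symm

/-- Scaling of the kernel. -/
lemma lintegral_comp_smul_kernel {g : E d → ℝ} (hg : Measurable g) {t : ℝ}
    (ht : 0 < t) :
    ∫⁻ z : E d, ENNReal.ofReal (g (t • z) * kernel α z)
      = ENNReal.ofReal (t ^ α) * ∫⁻ z : E d, ENNReal.ofReal (g z * kernel α z) := by
  have hm : Measurable fun z : E d => ENNReal.ofReal (g z * kernel α z) := by fun_prop
  have h1 : ∀ z : E d, ENNReal.ofReal (g (t • z) * kernel α z)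
      = ENNReal.ofReal (t ^ ((d : ℝ) + α)) * ENNReal.ofReal (g (t • z) * kernel α (t • z)) := by
    intro z
    rw [← ENNReal.ofReal_mul (Real.rpow_nonneg ht.le _)]
    congr 1
    unfold kernel
    rw [norm_smul, Real.norm_of_nonneg ht.le, Real.mul_rpow ht.le (norm_nonneg _), mul_inv]
    have : t ^ ((d : ℝ) + α) ≠ 0 := (Real.rpow_pos_of_pos ht _).ne'
    field_simp
  have h2 : ∫⁻ z : E d, ENNReal.ofReal (g (t • z) * kernel α (t • z))
      = ENNReal.ofReal (t ^ d)⁻¹ * ∫⁻ z : E d, ENNReal.ofReal (g z * kernel α z) := by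
    rw [← lintegral_map (f := fun z : E d => ENNReal.ofReal (g z * kernel α z)) hm
      (measurable_const_smul t), Measure.map_addHaar_smul _ ht.ne', lintegral_smul_measure]
    simp [abs_of_pos ht]
  simp_rw [h1]
  have hm' : Measurable fun z : E d => ENNReal.ofReal (g (t • z) * kernel α (t • z)) :=
    hm.comp (measurable_const_smul t)
  rw [lintegral_const_mul _ hm', h2, ← mul_assoc,
    ← ENNReal.ofReal_mul (Real.rpow_nonneg ht.le _)]
  congr 2
  rw [Real.rpow_add ht, Real.rpow_natCast]
  field_simp

lemma integrable_symbol [NeZero d] (hα₁ : 1 < α) (hα₂ : α < 2) :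
    Integrable (fun z : E d => (1 - Real.cos (z 0)) * kernel α z) := by
  refine ((integrable_kernel (d := d) hα₁ hα₂).const_mul 2).mono' (by fun_prop)
    (Filter.Eventually.of_forall fun z => ?_)
  have h1 : |z 0| ≤ ‖z‖ := by simpa using PiLp.norm_apply_le z 0
  have h2 : 0 ≤ 1 - Real.cos (z 0) := by linarith [Real.cos_le_one (z 0)]
  rw [Real.norm_of_nonneg (mul_nonneg h2 (kernel_nonneg z)), ← mul_assoc]
  refine mul_le_mul_of_nonneg_right ?_ (kernel_nonneg z)
  refine (one_sub_cos_le _).trans ?_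
  have := jumpWeight_mono (abs_nonneg _) h1
  linarith

lemma c0_eq [NeZero d] : c0 d α = ∫ z : E d, (1 - Real.cos (z 0)) * kernel α z := by
  simp [c0, kernel, div_eq_mul_inv]

/-- The nonnegative integrand is strictly positive on the open slab 0 < z₁ < 1. -/
lemma c0_pos [NeZero d] (hα₁ : 1 < α) (hα₂ : α < 2) : 0 < c0 d α := by
  have hnn : ∀ z : E d, 0 ≤ (1 - Real.cos (z 0)) * kernel α z := fun z =>
    mul_nonneg (by linarith [Real.cos_le_one (z 0)]) (kernel_nonneg z)
  rw [c0_eq, integral_pos_iff_support_of_nonneg hnn (integrable_symbol hα₁ hα₂)]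
  have hcont : Continuous fun z : E d => z 0 := by fun_prop
  have hopen : IsOpen {z : E d | 0 < z 0 ∧ z 0 < 1} :=
    (isOpen_lt continuous_const hcont).inter (isOpen_lt hcont continuous_const)
  have hne : {z : E d | 0 < z 0 ∧ z 0 < 1}.Nonempty :=
    ⟨WithLp.toLp 2 fun _ => 1 / 2, by norm_num⟩
  refine (hopen.measure_pos volume hne).trans_le (measure_mono fun z hz => ?_)
  have hz0 : z ≠ 0 := by rintro rfl; simp at hz
  have h1 : Real.cos (z 0) < 1 := by
    rw [← Real.cos_zero]
    exact Real.cos_lt_cos_of_nonneg_of_le_pi le_rfl (by linarith [Real.pi_gt_three, hz.2]) hz.1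
  have h2 : 0 < kernel α z := inv_pos.2 (Real.rpow_pos_of_pos (norm_pos_iff.2 hz0) _)
  exact (mul_pos (by linarith) h2).ne'

/-- The symbol of the isotropic Lévy operator. -/
lemma lintegral_symbol [NeZero d] (hα₁ : 1 < α) (hα₂ : α < 2) (k : E d) :
    ∫⁻ z : E d, ENNReal.ofReal ((1 - Real.cos (inner ℝ k z)) * kernel α z)
      = ENNReal.ofReal (c0 d α * ‖k‖ ^ α) := by
  rcases eq_or_ne k 0 with rfl | hk
  · simp [Real.zero_rpow (by linarith : α ≠ 0)]
  have hk0 : 0 < ‖k‖ := norm_pos_iff.2 hk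
  set e : E d := EuclideanSpace.single 0 1 with he
  have hen : ‖e‖ = 1 := by simp [he]
  set v : E d := ‖k‖⁻¹ • k with hv
  have hvn : ‖v‖ = 1 := by rw [hv, norm_smul, norm_inv, norm_norm, inv_mul_cancel₀ hk0.ne']
  -- This reflection takes k/|k| to the first basis vector and preserves the kernel, which reduces
  -- the symbol to the integral defining c₀; scaling by |k| supplies the power.
  set Q := (ℝ ∙ (v - e))ᗮ.reflection with hQ
  have hQv : Q v = e := Submodule.reflection_sub (hvn.trans hen.symm)
  have h1 : ∀ z : E d, (1 - Real.cos (inner ℝ k z)) * kernel α z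
      = (fun y : E d => (1 - Real.cos ((‖k‖ • y) 0)) * kernel α y) (Q z) := by
    intro z
    have h2 : inner ℝ k z = ‖k‖ * (Q z) 0 := by
      have : k = ‖k‖ • v := by rw [hv, smul_smul, mul_inv_cancel₀ hk0.ne', one_smul]
      rw [this, inner_smul_left, ← Q.inner_map_map v z, hQv, he, EuclideanSpace.inner_single_left]
      simp [hvn, norm_smul]
    simp only [kernel, Q.norm_map, h2, PiLp.smul_apply, smul_eq_mul]
  simp_rw [h1]
  rw [(LinearIsometryEquiv.measurePreserving Q).lintegral_comp
    (f := fun y : E d => ENNReal.ofReal ((1 - Real.cos ((‖k‖ • y) 0)) * kernel α y)) (by fun_prop),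
    lintegral_comp_smul_kernel (g := fun y : E d => 1 - Real.cos (y 0)) (by fun_prop) hk0,
    ← ofReal_integral_eq_lintegral_ofReal (integrable_symbol hα₁ hα₂)
      (Filter.Eventually.of_forall fun z => mul_nonneg (by linarith [Real.cos_le_one (z 0)])
        (kernel_nonneg z)), ← c0_eq, ← ENNReal.ofReal_mul (Real.rpow_nonneg hk0.le _), mul_comm]

/-- Homogeneity of the kernel; the case t = 0 is separate because the change of variables needs t >
0. -/
lemma lintegral_jumpWeight_smul [NeZero d] (hα₁ : 1 < α) (hα₂ : α < 2) {t : ℝ} (ht : 0 ≤ t) :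
    ∫⁻ z : E d, ENNReal.ofReal (jumpWeight (t * ‖z‖) * kernel α z)
      = ENNReal.ofReal (t ^ α * kernelMass d α) := by
  rcases ht.eq_or_lt with rfl | ht
  · simp [jumpWeight, Real.zero_rpow (by linarith : α ≠ 0)]
  rw [ENNReal.ofReal_mul (Real.rpow_nonneg ht.le _), ← lintegral_kernel hα₁ hα₂,
    ← lintegral_comp_smul_kernel (g := fun y : E d => jumpWeight ‖y‖) (by fun_prop) ht]
  simp only [norm_smul, Real.norm_of_nonneg ht.le]

end Kernel

/-! ### The isotropic form in Fourier variables and the form domain. -/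

section Energy

variable {d : ℕ} {α : ℝ}

lemma twist_eq (ξ : E d) (u : L2 d) (x : E d) :
    twist ξ u x = character ξ x * perExt (u : E d → ℂ) x := rfl

lemma twist_zero (u : L2 d) : twist 0 u = perExt (u : E d → ℂ) := by
  funext x; rw [twist_eq, character_zero_left, one_mul]

lemma measurable_twist (ξ : E d) (u : L2 d) : Measurable (twist ξ u) :=
  (continuous_character ξ).measurable.mul (measurable_perExt u)

/-- Twice the form `a(ξ)` with `μ = 1` on the diagonal, as an extended nonnegative number. -/
def energy (α : ℝ) (ξ : E d) (u : L2 d) : ENNReal :=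
  ∫⁻ p, ENNReal.ofReal (kernel α (p.1 - p.2)) * ‖twist ξ u p.1 - twist ξ u p.2‖ₑ ^ 2
    ∂((cellMeasure d).prod volume)

lemma measurePreserving_cellRep_sub (z : E d) :
    MeasurePreserving (fun x => cellRep (x - z)) (cellMeasure d) (cellMeasure d) := by
  have hm : Measurable fun x : E d => cellRep (x - z) :=
    measurable_cellRep.comp (measurable_id.sub_const z)
  refine ⟨hm, Measure.ext fun s hs => ?_⟩
  rw [Measure.map_apply hm hs, ← lintegral_indicator_one hs, ← lintegral_indicator_one (hm hs)]
  exact setLIntegral_cell_sub (s.indicator 1) z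

lemma perExt_ae_eq (u : E d → ℂ) : perExt u =ᵐ[cellMeasure d] u :=
  (ae_restrict_mem (measurableSet_cell d)).mono fun x hx => by rw [perExt, cellRep_eq_self hx]

lemma memLp_perExt (u : L2 d) : MemLp (perExt (u : E d → ℂ)) 2 (cellMeasure d) :=
  (memLp_congr_ae (perExt_ae_eq _)).2 (Lp.memLp u)

lemma repr_eq_integral (u : L2 d) (n : Fin d → ℤ) :
    (fourierBasis d).repr u n
      = ∫ x in cell d, star (character (freq n) x) * perExt (u : E d → ℂ) x := by
  have h : (memLp_perExt u).toLp _ = u :=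
    Lp.ext ((memLp_perExt u).coeFn_toLp.trans (perExt_ae_eq _))
  rw [← fourierBasis_repr_toLp (memLp_perExt u), h]

/-- A translation multiplies the n-th Fourier coefficient by the conjugate character at z, because
the characters are multiplicative and periodic. -/
lemma integral_character_mul_translate (u : L2 d) (n : Fin d → ℤ) (z : E d) :
    ∫ x in cell d, star (character (freq n) x) * perExt (u : E d → ℂ) (x - z)
      = star (character (freq n) z) * (fourierBasis d).repr u n := by
  have h1 : ∀ x, star (character (freq n) x) * perExt (u : E d → ℂ) (x - z)
      = star (character (freq n) z) * ((fun y => star (character (freq n) y) * (u : E d → ℂ) y)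
        (cellRep (x - z))) := by
    intro x
    simp only [character_freq_cellRep, perExt, ← mul_assoc]
    congr 1
    rw [mul_comm, ← star_mul']
    congr 1
    rw [character_sub, mul_assoc]
    have : star (character (freq n) z) * character (freq n) z = 1 := by
      rw [RCLike.star_def, Complex.conj_mul', norm_character]; simp
    rw [this, mul_one]
  have h2 := setIntegral_cell_sub (fun y => star (character (freq n) y) * (u : E d → ℂ) y) z
  rw [integral_congr_ae (Filter.Eventually.of_forall h1), integral_const_mul, h2, repr_eq_integral]
  congr 1
  refine integral_congr_ae ?_
  filter_upwards [perExt_ae_eq (u : E d → ℂ)] with x hx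
  rw [hx]

lemma norm_one_sub_character_sq (k z : E d) :
    ‖1 - star (character k z)‖ ^ 2 = 2 * (1 - Real.cos (inner ℝ k z)) := by
  have h1 : character k z = Real.cos (inner ℝ k z) + Real.sin (inner ℝ k z) * I := by
    rw [character, mul_comm, Complex.exp_mul_I]; simp
  rw [h1, Complex.sq_norm, Complex.normSq_apply]
  simp only [Complex.sub_re, Complex.one_re, RCLike.star_def, Complex.conj_re, Complex.conj_im,
    Complex.add_re, Complex.add_im, Complex.mul_re, Complex.mul_im, Complex.ofReal_re,
    Complex.ofReal_im, Complex.I_re, Complex.I_im, Complex.sub_im, Complex.one_im]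
  nlinarith [Real.sin_sq_add_cos_sq (inner ℝ k z)]

/-- Up to the unimodular factor `e^{i⟨ξ,x⟩}`, the increment is a periodic function with n-th
coefficient (1 - e^{-i⟨ξ+2πn,z⟩})û(n). The claim is Parseval's identity for it. -/
lemma lintegral_twist_sub (ξ : E d) (u : L2 d) (z : E d) :
    ∫⁻ x in cell d, ‖twist ξ u x - twist ξ u (x - z)‖ₑ ^ 2
      = ∑' n, ENNReal.ofReal (2 * (1 - Real.cos (inner ℝ (ξ + freq n) z))
          * ‖(fourierBasis d).repr u n‖ ^ 2) := by
  set f : E d → ℂ := fun x => perExt (u : E d → ℂ) x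
    - star (character ξ z) * perExt (u : E d → ℂ) (x - z) with hf
  have htr : MemLp (fun x => perExt (u : E d → ℂ) (x - z)) 2 (cellMeasure d) :=
    (Lp.memLp u).comp_measurePreserving (measurePreserving_cellRep_sub z)
  have hfL : MemLp f 2 (cellMeasure d) := (memLp_perExt u).sub (htr.const_mul _)
  have h1 : ∀ x, ‖twist ξ u x - twist ξ u (x - z)‖ₑ = ‖f x‖ₑ := by
    intro x
    have : twist ξ u x - twist ξ u (x - z) = character ξ x * f x := by
      rw [twist_eq, twist_eq, hf, character_sub]; ring
    rw [this, enorm_mul, ← ofReal_norm, norm_character]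
    simp
  simp_rw [h1]
  have h2 : ∫⁻ x in cell d, ‖f x‖ₑ ^ 2 = ENNReal.ofReal (‖hfL.toLp f‖ ^ 2) := by
    rw [← lintegral_enorm_sq]
    refine lintegral_congr_ae ?_
    filter_upwards [hfL.coeFn_toLp] with x hx
    rw [hx]
  have h3 := hasSum_sq_repr (hfL.toLp f)
  have h4 : ∀ n, ‖(fourierBasis d).repr (hfL.toLp f) n‖ ^ 2
      = 2 * (1 - Real.cos (inner ℝ (ξ + freq n) z)) * ‖(fourierBasis d).repr u n‖ ^ 2 := by
    intro n
    have hbd : ∀ {g : E d → ℂ}, MemLp g 2 (cellMeasure d) →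
        Integrable (fun x => star (character (freq n) x) * g x) (cellMeasure d) := by
      intro g hg
      refine (hg.integrable (by norm_num)).bdd_mul (c := 1)
        (continuous_character (freq n)).star.aestronglyMeasurable
        (Filter.Eventually.of_forall fun x => ?_)
      rw [norm_star, norm_character]
    have h5 : (fourierBasis d).repr (hfL.toLp f) n
        = (1 - star (character (ξ + freq n) z)) * (fourierBasis d).repr u n := by
      rw [fourierBasis_repr_toLp]
      have : ∀ x, star (character (freq n) x) * f x
          = star (character (freq n) x) * perExt (u : E d → ℂ) x - star (character ξ z) *
            (star (character (freq n) x) * perExt (u : E d → ℂ) (x - z)) := by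
        intro x; rw [hf]; ring
      simp_rw [this]
      rw [integral_sub (hbd (memLp_perExt u)) ((hbd htr).const_mul _), integral_const_mul,
        integral_character_mul_translate, ← repr_eq_integral, character_add_left, star_mul']
      ring
    rw [h5, norm_mul, mul_pow, norm_one_sub_character_sq]
  rw [h2, ← h3.tsum_eq, ENNReal.ofReal_tsum_of_nonneg (fun n => by positivity) h3.summable]
  exact tsum_congr fun n => by rw [h4]

/-- The isotropic form in the Fourier representation. -/
lemma energy_eq [NeZero d] (hα₁ : 1 < α) (hα₂ : α < 2) (ξ : E d) (u : L2 d) :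
    energy α ξ u = ∑' n, ENNReal.ofReal (2 * c0 d α * ‖ξ + freq n‖ ^ α
      * ‖(fourierBasis d).repr u n‖ ^ 2) := by
  have hm := measurable_twist ξ u
  unfold energy
  rw [lintegral_cell_prod (by fun_prop)]
  simp only [sub_sub_cancel]
  have h1 : ∀ z, ∫⁻ x in cell d, ENNReal.ofReal (kernel α z)
        * ‖twist ξ u x - twist ξ u (x - z)‖ₑ ^ 2
      = ∑' n, ENNReal.ofReal (2 * ‖(fourierBasis d).repr u n‖ ^ 2) *
        ENNReal.ofReal ((1 - Real.cos (inner ℝ (ξ + freq n) z)) * kernel α z) := by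
    intro z
    rw [lintegral_const_mul _ (by fun_prop), lintegral_twist_sub, ← ENNReal.tsum_mul_left]
    refine tsum_congr fun n => ?_
    rw [← ENNReal.ofReal_mul (kernel_nonneg z), ← ENNReal.ofReal_mul (by positivity)]
    congr 1
    ring
  simp_rw [h1]
  rw [lintegral_tsum (fun n => by fun_prop)]
  refine tsum_congr fun n => ?_
  rw [lintegral_const_mul _ (by fun_prop), lintegral_symbol hα₁ hα₂,
    ← ENNReal.ofReal_mul (by positivity)]
  congr 1
  ring

/-- The inner integral of the energy of a function on `ℝ^d`. -/
def localEnergy (α : ℝ) (f : E d → ℂ) (x : E d) : ENNReal :=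
  ∫⁻ y, ENNReal.ofReal (kernel α (x - y)) * ‖f x - f y‖ₑ ^ 2

lemma localEnergy_add_latticePt (u : E d → ℂ) (x : E d) (m : Fin d → ℤ) :
    localEnergy α (perExt u) (x + latticePt m) = localEnergy α (perExt u) x := by
  unfold localEnergy
  rw [← lintegral_add_right_eq_self _ (latticePt m)]
  simp only [perExt, cellRep_add_latticePt, add_sub_add_right_eq_sub]

lemma energy_zero_eq (u : L2 d) :
    energy α 0 u = ∫⁻ x in cell d, localEnergy α (perExt (u : E d → ℂ)) x := by
  have hm := measurable_perExt u
  unfold energy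
  rw [twist_zero, lintegral_prod _ (by fun_prop)]
  rfl

/-- The integral of a periodic function over a ball is controlled by that over the cell. -/
lemma exists_lintegral_ball_le (r : ℝ) : ∃ K : ℕ, ∀ g : E d → ENNReal,
    (∀ x m, g (x + latticePt m) = g x) →
      ∫⁻ x in Metric.ball 0 r, g x ≤ K * ∫⁻ x in cell d, g x := by
  classical
  -- Every point of the ball has its integer part in the box [-M, M]^d, so finitely many lattice
  -- cells cover the ball.
  set M : ℤ := ⌈r⌉ + 1
  let S : Finset (Fin d → ℤ) := Finset.Icc (fun _ => -M) (fun _ => M)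
  refine ⟨S.card, fun g hg => ?_⟩
  have hcover : Metric.ball (0 : E d) r ⊆ ⋃ m : S, (fun x => x - latticePt m.1) ⁻¹' cell d := by
    intro x hx
    rw [mem_ball_zero_iff] at hx
    refine Set.mem_iUnion.2 ⟨⟨fun i => ⌊x i⌋, ?_⟩, fun i => ?_⟩
    · have hi : ∀ i, |x i| < r := fun i => lt_of_le_of_lt (by simpa using PiLp.norm_apply_le x i) hx
      refine Finset.mem_Icc.2 ⟨fun i => ?_, fun i => ?_⟩
      · refine Int.le_floor.2 ?_
        have := Int.le_ceil r
        push_cast [M]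
        linarith [(abs_lt.1 (hi i)).1]
      · have h1 : (⌊x i⌋ : ℝ) < M := by
          have := Int.le_ceil r
          push_cast [M]
          linarith [(abs_lt.1 (hi i)).2, Int.floor_le (x i)]
        exact_mod_cast h1.le
    · have : (x - latticePt (fun i => ⌊x i⌋)) i = Int.fract (x i) := rfl
      exact this ▸ ⟨Int.fract_nonneg _, Int.fract_lt_one _⟩
  have hpart : ∀ m : Fin d → ℤ, ∫⁻ x in (fun x => x - latticePt m) ⁻¹' cell d, g x
      = ∫⁻ x in cell d, g x := by
    intro m
    rw [← (measurePreserving_sub_right volume (latticePt m)).setLIntegral_comp_preimage_emb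
      (MeasurableEquiv.subRight (latticePt m)).measurableEmbedding g (cell d)]
    refine lintegral_congr fun x => ?_
    rw [← hg (x - latticePt m) m, sub_add_cancel]
  calc ∫⁻ x in Metric.ball 0 r, g x
      ≤ ∫⁻ x in ⋃ m : S, (fun x => x - latticePt m.1) ⁻¹' cell d, g x := lintegral_mono_set hcover
    _ ≤ ∑' m : S, ∫⁻ x in (fun x => x - latticePt m.1) ⁻¹' cell d, g x := lintegral_iUnion_le _ _
    _ = S.card * ∫⁻ x in cell d, g x := by
        rw [tsum_congr fun m : S => hpart m.1, tsum_fintype, Finset.sum_const, nsmul_eq_mul,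
          Finset.card_univ, Fintype.card_coe]

lemma ofReal_gagliardo (f : E d → ℂ) (p : E d × E d) :
    ‖gagliardo (α / 2) f p‖ₑ = ENNReal.ofReal (kernel α (p.1 - p.2)) * ‖f p.1 - f p.2‖ₑ ^ 2 := by
  have h0 : 0 ≤ gagliardo (α / 2) f p := by unfold gagliardo; positivity
  rw [Real.enorm_of_nonneg h0, ← ofReal_norm, ← ENNReal.ofReal_pow (norm_nonneg _),
    ← ENNReal.ofReal_mul (kernel_nonneg _)]
  unfold gagliardo kernel
  congr 1
  rw [div_eq_inv_mul]
  congr 4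
  ring

lemma measurable_gagliardo {s : ℝ} {f : E d → ℂ} (hf : Measurable f) :
    Measurable (gagliardo s f) := by
  unfold gagliardo; fun_prop

/-- The local seminorm over ball × ball is enlarged by letting y run over the whole space. The
resulting inner integral is periodic in x, so the ball costs only a finite multiple of the cell. -/
lemma mem_perH_of_energy_lt_top {u : L2 d} (h : energy α 0 u < ⊤) : u ∈ perH d (α / 2) := by
  intro r _
  obtain ⟨K, hK⟩ := exists_lintegral_ball_le (d := d) r
  have hm := measurable_perExt u
  have hK' : (K : ENNReal) < ⊤ := ENNReal.natCast_lt_top K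
  refine ⟨⟨hm.aestronglyMeasurable, ?_⟩, ⟨(measurable_gagliardo hm).aestronglyMeasurable, ?_⟩⟩
  · rw [eLpNorm_lt_top_iff_lintegral_rpow_enorm_lt_top (by norm_num) (by norm_num)]
    refine (hK _ fun x m => ?_).trans_lt (ENNReal.mul_lt_top hK' ?_)
    · simp only [perExt, cellRep_add_latticePt]
    · have h2 := (memLp_perExt u).2
      rwa [eLpNorm_lt_top_iff_lintegral_rpow_enorm_lt_top (by norm_num) (by norm_num)] at h2
  · unfold HasFiniteIntegral
    simp_rw [ofReal_gagliardo]
    rw [Measure.volume_eq_prod, ← Measure.prod_restrict, lintegral_prod _ (by fun_prop)]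
    calc _ ≤ ∫⁻ x in Metric.ball 0 r, localEnergy α (perExt (u : E d → ℂ)) x :=
          lintegral_mono fun x => setLIntegral_le_lintegral _ _
      _ ≤ K * energy α 0 u := by
          rw [energy_zero_eq]; exact hK _ fun x m => localEnergy_add_latticePt _ _ _
      _ < ⊤ := ENNReal.mul_lt_top hK' h

lemma cell_subset_closedBall : cell d ⊆ Metric.closedBall 0 (Real.sqrt d) := by
  intro x hx
  rw [mem_closedBall_zero_iff, EuclideanSpace.norm_eq]
  apply Real.sqrt_le_sqrt
  calc ∑ i, ‖x i‖ ^ 2 ≤ ∑ _i : Fin d, (1 : ℝ) := by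
        refine Finset.sum_le_sum fun i _ => ?_
        rw [Real.norm_eq_abs, sq_abs]
        nlinarith [(hx i).1, (hx i).2]
    _ = d := by simp

lemma enorm_sub_sq_le (a b : ℂ) : ‖a - b‖ₑ ^ 2 ≤ 2 * (‖a‖ₑ ^ 2 + ‖b‖ₑ ^ 2) := by
  simp only [← ofReal_norm, ← ENNReal.ofReal_pow (norm_nonneg _)]
  rw [← ENNReal.ofReal_add (by positivity) (by positivity), show (2 : ENNReal) = ENNReal.ofReal 2 by simp,
    ← ENNReal.ofReal_mul (by norm_num)]
  refine ENNReal.ofReal_le_ofReal ?_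
  have := norm_sub_le a b
  nlinarith [norm_nonneg (a - b), sq_nonneg (‖a‖ - ‖b‖)]

/-- Jumps of length at most 1 starting in the cell stay in a fixed ball, where the local seminorm is
finite. Longer jumps are controlled by the `L₂` norm and the integrability of the kernel away from
0. -/
lemma energy_lt_top_of_mem_perH [NeZero d] (hα₁ : 1 < α) (hα₂ : α < 2) {u : L2 d}
    (hu : u ∈ perH d (α / 2)) : energy α 0 u < ⊤ := by
  -- The cell lies in the closed ball of radius √d, a short jump adds at most 1, and a further 1
  -- makes the inclusion in the open ball strict.
  set B : Set (E d) := Metric.ball 0 (Real.sqrt d + 2) with hB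
  have hm := measurable_perExt u
  have h1 := (hu (Real.sqrt d + 2) (by positivity)).2.2
  unfold HasFiniteIntegral at h1
  simp_rw [ofReal_gagliardo] at h1
  set F : E d × E d → ENNReal := fun p => ENNReal.ofReal (kernel α (p.1 - p.2))
    * ‖perExt (u : E d → ℂ) p.1 - perExt (u : E d → ℂ) p.2‖ₑ ^ 2 with hF
  have hBm : MeasurableSet (B ×ˢ B) := Metric.isOpen_ball.measurableSet.prod
    Metric.isOpen_ball.measurableSet
  set k : E d → ENNReal := fun z => ENNReal.ofReal (jumpWeight ‖z‖ * kernel α z) with hk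
  set h : E d → ENNReal := fun x => ‖(u : E d → ℂ) x‖ₑ ^ 2 with hh
  have hum : Measurable (u : E d → ℂ) := (Lp.stronglyMeasurable u).measurable
  have hkm : Measurable k := by fun_prop
  have hhm : Measurable h := by fun_prop
  have := measurable_cellRep (d := d)
  have hpt : ∀ᵐ p ∂((cellMeasure d).prod volume), F p ≤ (B ×ˢ B).indicator F p
      + 2 * (k (p.1 - p.2) * h (cellRep p.1) + k (p.1 - p.2) * h (cellRep p.2)) := by
    have hc : ∀ᵐ p ∂((cellMeasure d).prod (volume : Measure (E d))), p.1 ∈ cell d :=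
      Measure.quasiMeasurePreserving_fst.ae (ae_restrict_mem (measurableSet_cell d))
    filter_upwards [hc] with p hp
    by_cases hd1 : ‖p.1 - p.2‖ ≤ 1
    · have h1 : ‖p.1‖ ≤ Real.sqrt d := mem_closedBall_zero_iff.1 (cell_subset_closedBall hp)
      have h2 : p ∈ B ×ˢ B := by
        refine ⟨mem_ball_zero_iff.2 (by linarith), mem_ball_zero_iff.2 ?_⟩
        have := norm_sub_le p.1 (p.1 - p.2)
        rw [sub_sub_cancel] at this
        linarith
      rw [Set.indicator_of_mem h2]
      exact le_self_add
    · refine le_add_left ?_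
      have h3 : ENNReal.ofReal (kernel α (p.1 - p.2)) ≤ k (p.1 - p.2) := by
        refine ENNReal.ofReal_le_ofReal (le_mul_of_one_le_left (kernel_nonneg _) ?_)
        push Not at hd1
        exact le_min hd1.le (by nlinarith)
      calc F p ≤ k (p.1 - p.2) * (2 * (h (cellRep p.1) + h (cellRep p.2))) :=
            mul_le_mul' h3 (enorm_sub_sq_le _ _)
        _ = _ := by ring
  have hfin : ENNReal.ofReal (‖u‖ ^ 2) < ⊤ := ENNReal.ofReal_lt_top
  have hE : energy α 0 u = ∫⁻ p, F p ∂((cellMeasure d).prod volume) := by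
    unfold energy; rw [twist_zero]
  rw [hE]
  refine (lintegral_mono_ae hpt).trans_lt ?_
  rw [lintegral_add_right _ (by fun_prop), lintegral_const_mul _ (by fun_prop),
    lintegral_add_right _ (by fun_prop), lintegral_cell_prod_fst hkm hhm,
    lintegral_cell_prod_snd hkm hhm, lintegral_enorm_sq, lintegral_kernel hα₁ hα₂]
  refine ENNReal.add_lt_top.2 ⟨?_, ?_⟩
  · rw [lintegral_indicator hBm]
    refine lt_of_le_of_lt (lintegral_mono' (Measure.restrict_mono le_rfl ?_) le_rfl) h1
    rw [Measure.volume_eq_prod]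
    exact Measure.prod_mono Measure.restrict_le_self le_rfl
  · refine ENNReal.mul_lt_top (by simp) (ENNReal.add_lt_top.2 ⟨?_, ?_⟩) <;>
      exact ENNReal.mul_lt_top ENNReal.ofReal_lt_top hfin

lemma mem_perH_iff [NeZero d] (hα₁ : 1 < α) (hα₂ : α < 2) {u : L2 d} :
    u ∈ perH d (α / 2) ↔ energy α 0 u < ⊤ :=
  ⟨energy_lt_top_of_mem_perH hα₁ hα₂, mem_perH_of_energy_lt_top⟩

end Energy

/-! ### Operators diagonal in a Hilbert basis. -/

section Diagonal

variable {ι H : Type*} [NormedAddCommGroup H] [InnerProductSpace ℂ H] (b : HilbertBasis ι ℂ H)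

lemma HilbertBasis.hasSum_norm_sq (u : H) : HasSum (fun n => ‖b.repr u n‖ ^ 2) (‖u‖ ^ 2) := by
  have h1 := lp.hasSum_norm (p := 2) (by norm_num) (b.repr u)
  rw [LinearIsometryEquiv.norm_map] at h1
  simpa using h1

lemma memℓp_mul {w : ι → ℝ} {C : ℝ} (hw : ∀ n, |w n| ≤ C) (f : lp (fun _ : ι => ℂ) 2) :
    Memℓp (fun n => (w n : ℂ) * f n) 2 := by
  have h1 := (lp.memℓp f).summable (by norm_num)
  refine memℓp_gen ((h1.mul_left (C ^ 2)).of_nonneg_of_le (fun n => by positivity) fun n => ?_)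
  simp only [norm_mul, Complex.norm_real, Real.norm_eq_abs, ENNReal.toReal_ofNat, Real.rpow_ofNat,
    mul_pow]
  have := hw n
  gcongr

/-- The operator that is diagonal in the Hilbert basis `b`, with a bounded sequence `w` of
eigenvalues. -/
def diagOp {w : ι → ℝ} {C : ℝ} (hw : ∀ n, |w n| ≤ C) : H →L[ℂ] H :=
  LinearMap.mkContinuous
    { toFun := fun f => b.repr.symm ⟨_, memℓp_mul hw (b.repr f)⟩
      map_add' := fun f g => by
        rw [← map_add]
        congr 1
        ext n
        change (w n : ℂ) * b.repr (f + g) n = w n * b.repr f n + w n * b.repr g n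
        rw [map_add]
        exact mul_add _ _ _
      map_smul' := fun c f => by
        rw [← map_smul]
        congr 1
        ext n
        simp [mul_left_comm] } C <| fun f => by
  -- C ≥ 0 follows from the bound on the weights only if there is an index; otherwise the space is
  -- trivial.
  rcases isEmpty_or_nonempty ι with he | ⟨⟨n₀⟩⟩
  · have h0 : ∀ x : H, x = 0 := fun x => by
      apply b.repr.injective
      ext n
      exact he.elim n
    refine le_of_eq ?_
    rw [h0 f, norm_zero, mul_zero, norm_eq_zero]
    exact h0 _
  have hC : 0 ≤ C := (abs_nonneg _).trans (hw n₀)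
  refine le_of_sq_le_sq ?_ (by positivity)
  rw [mul_pow]
  refine hasSum_le (fun n => ?_) (HilbertBasis.hasSum_norm_sq b _)
    ((HilbertBasis.hasSum_norm_sq b f).mul_left (C ^ 2))
  simp only [LinearMap.coe_mk, AddHom.coe_mk, LinearIsometryEquiv.apply_symm_apply, norm_mul,
    Complex.norm_real, Real.norm_eq_abs, mul_pow]
  have := hw n
  gcongr

@[simp]
lemma repr_diagOp {w : ι → ℝ} {C : ℝ} (hw : ∀ n, |w n| ≤ C) (f : H) (n : ι) :
    b.repr (diagOp b hw f) n = w n * b.repr f n := by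
  change b.repr (b.repr.symm _) n = _
  rw [LinearIsometryEquiv.apply_symm_apply]

/-- Cutting off the weights below ε/2 leaves a finite-rank operator within ε/2 in norm, and compact
operators form a closed set. -/
lemma isCompactOperator_diagOp [CompleteSpace H] {w : ι → ℝ} {C : ℝ} (hw : ∀ n, |w n| ≤ C)
    (h0 : ∀ ε > 0, {n | ε ≤ |w n|}.Finite) : IsCompactOperator (diagOp b hw) := by
  classical
  have hcl := isClosed_setOfPred_isCompactOperator (σ₁₂ := RingHom.id ℂ) (M₁ := H) (M₂ := H)
  refine hcl.closure_subset (Metric.mem_closure_iff.2 fun ε hε => ?_)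
  set S := (h0 (ε / 2) (by positivity)).toFinset with hS
  let R : ι → H →L[ℂ] H := fun n => (w n : ℂ) • (innerSL ℂ (b n)).smulRight (b n)
  have hR : ∀ n, IsCompactOperator (R n) := fun n => by
    have h1 : IsCompactOperator ((1 : ℂ →L[ℂ] ℂ).smulRight (b n)) :=
      isCompactOperator_of_locallyCompactSpace_rng
        ((1 : ℂ →L[ℂ] ℂ).smulRight (b n))
    have h2 := (h1.comp_clm (innerSL ℂ (b n))).smul (w n : ℂ)
    convert! h2 using 1
  refine ⟨∑ n ∈ S, R n, ?_, ?_⟩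
  · change IsCompactOperator (∑ n ∈ S, R n : H →L[ℂ] H)
    have : ∀ T : Finset ι, IsCompactOperator (∑ n ∈ T, R n : H →L[ℂ] H) := by
      intro T
      induction T using Finset.induction_on with
      | empty => simpa using isCompactOperator_zero
      | insert n T hn ih => rw [Finset.sum_insert hn]; exact (hR n).add ih
    exact this S
  · rw [dist_eq_norm]
    refine lt_of_le_of_lt (ContinuousLinearMap.opNorm_le_bound _ (by positivity : 0 ≤ ε / 2)
      fun f => ?_) (half_lt_self hε)
    refine le_of_sq_le_sq ?_ (by positivity)
    rw [mul_pow]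
    refine hasSum_le (fun n => ?_) (HilbertBasis.hasSum_norm_sq b _)
      ((HilbertBasis.hasSum_norm_sq b f).mul_left ((ε / 2) ^ 2))
    have h3 : b.repr ((∑ m ∈ S, R m : H →L[ℂ] H) f) n = if n ∈ S then w n * b.repr f n else 0 := by
      rw [HilbertBasis.repr_apply_apply, _root_.sum_apply, inner_sum]
      simp only [R, _root_.smul_apply, ContinuousLinearMap.smulRight_apply,
        innerSL_apply_apply, inner_smul_right,
        orthonormal_iff_ite.1 b.orthonormal, HilbertBasis.repr_apply_apply]
      simp
    have h4 : b.repr ((diagOp b hw - ∑ m ∈ S, R m) f) n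
        = if n ∈ S then 0 else w n * b.repr f n := by
      rw [_root_.sub_apply, map_sub, lp.coeFn_sub, Pi.sub_apply, h3, repr_diagOp]
      split_ifs <;> simp
    rw [h4]
    split_ifs with hn
    · rw [norm_zero, zero_pow two_ne_zero]; positivity
    · have : |w n| < ε / 2 := by simpa [hS] using hn
      rw [norm_mul, Complex.norm_real, Real.norm_eq_abs, mul_pow]
      gcongr

end Diagonal

/-! ### The form domain as the range of a compact operator; the spectral gap. -/

section Sobolev

variable {d : ℕ} {α : ℝ}

lemma abs_apply_le_norm_freq (n : Fin d → ℤ) (i : Fin d) : 2 * Real.pi * |(n i : ℝ)| ≤ ‖freq n‖ := by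
  have h1 : ‖freq n i‖ ≤ ‖freq n‖ := PiLp.norm_apply_le _ i
  rwa [freq_apply, norm_mul, Real.norm_of_nonneg (by positivity), Real.norm_eq_abs] at h1

/-- The norm of the Sobolev space `H̃^{α/2}(Ω)`. -/
def sobolevNorm (α : ℝ) (u : L2 d) : ℝ := Real.sqrt (‖u‖ ^ 2 + (energy α 0 u).toReal / 2)

lemma sobolevNorm_sq (u : L2 d) : sobolevNorm α u ^ 2 = ‖u‖ ^ 2 + (energy α 0 u).toReal / 2 :=
  Real.sq_sqrt (by positivity)

lemma sobolevNorm_nonneg (u : L2 d) : 0 ≤ sobolevNorm α u := Real.sqrt_nonneg _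

lemma norm_le_sobolevNorm (u : L2 d) : ‖u‖ ≤ sobolevNorm α u := by
  refine Real.le_sqrt_of_sq_le ?_
  have : 0 ≤ (energy α 0 u).toReal / 2 := by positivity
  linarith

lemma repr_one (n : Fin d → ℤ) : (fourierBasis d).repr (one d) n = if n = 0 then 1 else 0 := by
  rw [HilbertBasis.repr_apply_apply, ← fourierBasis_zero,
    orthonormal_iff_ite.1 (fourierBasis d).orthonormal]

lemma repr_zero_of_inner {v : L2 d} (hv1 : inner ℂ (one d) v = 0) : (fourierBasis d).repr v 0 = 0 := by
  rw [HilbertBasis.repr_apply_apply, fourierBasis_zero, hv1]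

lemma two_pi_le_norm_freq {n : Fin d → ℤ} (hn : n ≠ 0) : 2 * Real.pi ≤ ‖freq n‖ := by
  obtain ⟨i, hi⟩ := Function.ne_iff.1 hn
  refine le_trans ?_ (abs_apply_le_norm_freq n i)
  have h1 : (1 : ℝ) ≤ |(n i : ℝ)| := by exact_mod_cast Int.one_le_abs hi
  nlinarith [Real.pi_pos]

/-- The restriction |ξ| ≤ π enters here: π is half the smallest nonzero frequency, so ξ moves a
nonzero frequency by at most half its length. -/
lemma norm_freq_div_two_le {ξ : E d} {n : Fin d → ℤ} (hn : n ≠ 0) (hξ : ‖ξ‖ ≤ Real.pi) :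
    ‖freq n‖ / 2 ≤ ‖ξ + freq n‖ := by
  have h1 := two_pi_le_norm_freq hn
  have h2 := norm_sub_le (ξ + freq n) ξ
  rw [add_sub_cancel_left] at h2
  linarith

variable [NeZero d]

lemma hasSum_energy (hα₁ : 1 < α) (hα₂ : α < 2) {ξ : E d} {u : L2 d} (h : energy α ξ u < ⊤) :
    HasSum (fun n => 2 * c0 d α * ‖ξ + freq n‖ ^ α * ‖(fourierBasis d).repr u n‖ ^ 2)
      (energy α ξ u).toReal := by
  have hc := (c0_pos (d := d) hα₁ hα₂).le
  have h0 : ∀ n, 0 ≤ 2 * c0 d α * ‖ξ + freq n‖ ^ α * ‖(fourierBasis d).repr u n‖ ^ 2 :=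
    fun n => by positivity
  rw [energy_eq hα₁ hα₂] at h ⊢
  have h1 := ENNReal.summable_toReal h.ne
  simp only [ENNReal.toReal_ofReal (h0 _)] at h1
  rw [← ENNReal.ofReal_tsum_of_nonneg h0 h1, ENNReal.toReal_ofReal (tsum_nonneg h0)]
  exact h1.hasSum

lemma energy_lt_top_of_summable (hα₁ : 1 < α) (hα₂ : α < 2) {ξ : E d} {u : L2 d}
    (h : Summable fun n => ‖ξ + freq n‖ ^ α * ‖(fourierBasis d).repr u n‖ ^ 2) :
    energy α ξ u < ⊤ := by
  have hc := (c0_pos (d := d) hα₁ hα₂).le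
  have h0 : ∀ n, 0 ≤ 2 * c0 d α * ‖ξ + freq n‖ ^ α * ‖(fourierBasis d).repr u n‖ ^ 2 :=
    fun n => by positivity
  have h1 : Summable fun n => 2 * c0 d α * ‖ξ + freq n‖ ^ α * ‖(fourierBasis d).repr u n‖ ^ 2 := by
    simpa only [mul_assoc] using h.mul_left (2 * c0 d α)
  rw [energy_eq hα₁ hα₂, ← ENNReal.ofReal_tsum_of_nonneg h0 h1]
  exact ENNReal.ofReal_lt_top

lemma add_rpow_le {a b : ℝ} (ha : 0 ≤ a) (hb : 0 ≤ b) (hα : 0 ≤ α) :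
    (a + b) ^ α ≤ 2 ^ α * (a ^ α + b ^ α) := by
  have ha' := Real.rpow_nonneg ha α
  have hb' := Real.rpow_nonneg hb α
  rcases le_total a b with h | h
  · calc (a + b) ^ α ≤ (2 * b) ^ α := Real.rpow_le_rpow (by positivity) (by linarith) hα
      _ = 2 ^ α * b ^ α := Real.mul_rpow (by norm_num) hb
      _ ≤ _ := by gcongr; linarith
  · calc (a + b) ^ α ≤ (2 * a) ^ α := Real.rpow_le_rpow (by positivity) (by linarith) hα
      _ = 2 ^ α * a ^ α := Real.mul_rpow (by norm_num) ha
      _ ≤ _ := by gcongr; linarith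

lemma summable_of_mem_perH (hα₁ : 1 < α) (hα₂ : α < 2) {u : L2 d} (hu : u ∈ perH d (α / 2)) :
    Summable fun n => ‖freq n‖ ^ α * ‖(fourierBasis d).repr u n‖ ^ 2 := by
  have hc := (c0_pos (d := d) hα₁ hα₂)
  have h1 := (hasSum_energy hα₁ hα₂ ((mem_perH_iff hα₁ hα₂).1 hu)).summable.mul_left
    (2 * c0 d α)⁻¹
  refine h1.congr fun n => ?_
  rw [zero_add]
  field_simp

/-- The form domain does not depend on ξ, since `|ξ+2πn|^α` is at most a multiple of `|ξ|^α +
|2πn|^α`. -/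
lemma energy_lt_top (hα₁ : 1 < α) (hα₂ : α < 2) {u : L2 d} (hu : u ∈ perH d (α / 2)) (ξ : E d) :
    energy α ξ u < ⊤ := by
  have h1 := summable_of_mem_perH hα₁ hα₂ hu
  refine energy_lt_top_of_summable hα₁ hα₂ ?_
  refine ((((hasSum_sq_repr u).summable.mul_left (‖ξ‖ ^ α)).add h1).mul_left
    (2 ^ α)).of_nonneg_of_le (fun n => by positivity) fun n => ?_
  rw [← add_mul, ← mul_assoc]
  refine mul_le_mul_of_nonneg_right ?_ (by positivity)
  exact (Real.rpow_le_rpow (norm_nonneg _) (norm_add_le _ _) (by linarith)).trans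
    (add_rpow_le (norm_nonneg _) (norm_nonneg _) (by linarith))

/-- The squared Sobolev weight `(1 + c₀|2πn|^α)`. -/
def sobolevWeight (d : ℕ) [NeZero d] (α : ℝ) (n : Fin d → ℤ) : ℝ := 1 + c0 d α * ‖freq n‖ ^ α

lemma one_le_sobolevWeight (hα₁ : 1 < α) (hα₂ : α < 2) (n : Fin d → ℤ) :
    1 ≤ sobolevWeight d α n := by
  have hc := (c0_pos (d := d) hα₁ hα₂).le
  unfold sobolevWeight
  have : 0 ≤ c0 d α * ‖freq n‖ ^ α := by positivity
  linarith

lemma abs_inv_sqrt_sobolevWeight_le (hα₁ : 1 < α) (hα₂ : α < 2) (n : Fin d → ℤ) :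
    |(Real.sqrt (sobolevWeight d α n))⁻¹| ≤ 1 := by
  have h1 := one_le_sobolevWeight hα₁ hα₂ n
  rw [abs_of_nonneg (by positivity)]
  exact inv_le_one_of_one_le₀ (Real.one_le_sqrt.2 h1)

/-- The operator `(1 + A)^{-1/2}`, where `A` is generated by the isotropic form. -/
def sobolevOp (hα₁ : 1 < α) (hα₂ : α < 2) : L2 d →L[ℂ] L2 d :=
  diagOp (fourierBasis d) (abs_inv_sqrt_sobolevWeight_le hα₁ hα₂)

lemma isCompactOperator_sobolevOp (hα₁ : 1 < α) (hα₂ : α < 2) :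
    IsCompactOperator (sobolevOp (d := d) hα₁ hα₂) := by
  refine isCompactOperator_diagOp _ _ fun ε hε => ?_
  have hc := c0_pos (d := d) hα₁ hα₂
  -- If the weight at n is at least ε, then `|2πn|^α` ≤ M - 1. The added 1 makes |2πn| ≤ `|2πn|^α`
  -- available as soon as |2πn| > M, a contradiction.
  set M : ℝ := 1 + (ε ^ 2)⁻¹ / c0 d α with hM
  have hM1 : 1 ≤ M := by rw [hM]; have : 0 ≤ (ε ^ 2)⁻¹ / c0 d α := by positivity
                         linarith
  refine (Set.finite_Icc (fun _ : Fin d => -⌈M⌉) (fun _ => ⌈M⌉)).subset fun n hn => ?_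
  have h1 := one_le_sobolevWeight hα₁ hα₂ n
  have hs : 0 < Real.sqrt (sobolevWeight d α n) := Real.sqrt_pos.2 (by linarith)
  have h2 : ε * Real.sqrt (sobolevWeight d α n) ≤ 1 := by
    have h3 : ε ≤ (Real.sqrt (sobolevWeight d α n))⁻¹ := by
      have : ε ≤ |(Real.sqrt (sobolevWeight d α n))⁻¹| := hn
      rwa [abs_of_nonneg (by positivity)] at this
    calc _ ≤ (Real.sqrt (sobolevWeight d α n))⁻¹ * Real.sqrt (sobolevWeight d α n) := by gcongr
      _ = 1 := inv_mul_cancel₀ hs.ne'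
  have h3 : ε ^ 2 * sobolevWeight d α n ≤ 1 := by
    have := pow_le_pow_left₀ (by positivity) h2 2
    rwa [mul_pow, Real.sq_sqrt (by linarith), one_pow] at this
  have h4 : ‖freq n‖ ^ α ≤ (ε ^ 2)⁻¹ / c0 d α := by
    rw [le_div_iff₀ hc, ← one_div, le_div_iff₀ (by positivity)]
    unfold sobolevWeight at h3
    nlinarith [sq_nonneg ε]
  have h5 : ‖freq n‖ ≤ M := by
    by_contra hcon
    push Not at hcon
    have : ‖freq n‖ ≤ ‖freq n‖ ^ α := Real.self_le_rpow_of_one_le (hM1.trans hcon.le) hα₁.le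
    linarith
  have h6 : ∀ i, |n i| ≤ ⌈M⌉ := fun i => by
    have h7 := abs_apply_le_norm_freq n i
    have h8 : |(n i : ℝ)| ≤ M := by nlinarith [Real.pi_gt_three, abs_nonneg (n i : ℝ)]
    exact_mod_cast h8.trans (Int.le_ceil M)
  exact ⟨fun i => (abs_le.1 (h6 i)).1, fun i => (abs_le.1 (h6 i)).2⟩

lemma sq_inv_sqrt_sobolevWeight (hα₁ : 1 < α) (hα₂ : α < 2) (n : Fin d → ℤ) :
    (Real.sqrt (sobolevWeight d α n))⁻¹ ^ 2 * sobolevWeight d α n = 1 := by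
  have h1 := one_le_sobolevWeight hα₁ hα₂ n
  rw [inv_pow, Real.sq_sqrt (by linarith), inv_mul_cancel₀ (by linarith)]

lemma sobolevOp_mem (hα₁ : 1 < α) (hα₂ : α < 2) (f : L2 d) :
    sobolevOp hα₁ hα₂ f ∈ perH d (α / 2) := by
  have hc := c0_pos (d := d) hα₁ hα₂
  rw [mem_perH_iff hα₁ hα₂]
  refine energy_lt_top_of_summable hα₁ hα₂ ?_
  refine ((hasSum_sq_repr f).summable.mul_left (c0 d α)⁻¹).of_nonneg_of_le
    (fun n => by positivity) fun n => ?_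
  have h1 := sq_inv_sqrt_sobolevWeight hα₁ hα₂ n
  rw [sobolevOp, repr_diagOp, norm_mul, Complex.norm_real, Real.norm_eq_abs, mul_pow, sq_abs,
    zero_add, ← mul_assoc]
  refine mul_le_mul_of_nonneg_right ?_ (by positivity)
  rw [← one_div (c0 d α), le_div_iff₀ hc]
  unfold sobolevWeight at h1 ⊢
  nlinarith [sq_nonneg (Real.sqrt (1 + c0 d α * ‖freq n‖ ^ α))⁻¹]

/-- The isometry converts bounds in the Sobolev norm into bounds in the norm of `L₂(Ω)`, as the
abstract Lax-Milgram lemmas require. -/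
lemma sobolevNorm_sobolevOp (hα₁ : 1 < α) (hα₂ : α < 2) (f : L2 d) :
    sobolevNorm α (sobolevOp hα₁ hα₂ f) = ‖f‖ := by
  have h1 := hasSum_energy hα₁ hα₂ ((mem_perH_iff hα₁ hα₂).1 (sobolevOp_mem hα₁ hα₂ f))
  have h2 := hasSum_sq_repr (sobolevOp hα₁ hα₂ f)
  have h3 := h2.add (h1.div_const 2)
  rw [← sobolevNorm_sq] at h3
  have h4 : sobolevNorm α (sobolevOp hα₁ hα₂ f) ^ 2 = ‖f‖ ^ 2 := by
    refine h3.unique ?_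
    convert! hasSum_sq_repr f using 2 with n
    have h5 := sq_inv_sqrt_sobolevWeight hα₁ hα₂ n
    rw [sobolevOp, repr_diagOp, norm_mul, Complex.norm_real, Real.norm_eq_abs, mul_pow, sq_abs,
      zero_add]
    unfold sobolevWeight at h5 ⊢
    linear_combination ‖(fourierBasis d).repr f n‖ ^ 2 * h5
  exact (sq_eq_sq₀ (sobolevNorm_nonneg _) (norm_nonneg _)).1 h4

/-- `H̃^{α/2}(Ω)` as the range of `sobolevOp`. -/
def sobolevEquiv (hα₁ : 1 < α) (hα₂ : α < 2) : L2 d ≃ₗ[ℂ] perH d (α / 2) :=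
  LinearEquiv.ofBijective
    ((sobolevOp hα₁ hα₂).toLinearMap.codRestrict (perH d (α / 2)) (sobolevOp_mem hα₁ hα₂)) <| by
  have hw : ∀ n : Fin d → ℤ, (Real.sqrt (sobolevWeight d α n) : ℂ) ≠ 0 := fun n =>
    Complex.ofReal_ne_zero.2
      (Real.sqrt_pos.2 (lt_of_lt_of_le one_pos (one_le_sobolevWeight hα₁ hα₂ n))).ne'
  constructor
  · rw [← LinearMap.ker_eq_bot, LinearMap.ker_eq_bot']
    intro f hf
    have h1 : sobolevOp hα₁ hα₂ f = 0 := congrArg Subtype.val hf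
    have h2 : sobolevNorm α (0 : L2 d) = 0 := by
      have := sobolevNorm_sobolevOp hα₁ hα₂ (0 : L2 d)
      rwa [map_zero, norm_zero] at this
    rw [← norm_eq_zero, ← sobolevNorm_sobolevOp hα₁ hα₂ f, h1, h2]
  · rintro ⟨u, hu⟩
    have h1 := summable_of_mem_perH hα₁ hα₂ hu
    -- The preimage has the coefficients of u multiplied by the square root of the weight; they are
    -- square summable because u has finite energy.
    have hmem : Memℓp (fun n => (Real.sqrt (sobolevWeight d α n) : ℂ) * (fourierBasis d).repr u n)
        2 := by
      refine memℓp_gen (((hasSum_sq_repr u).summable.add (h1.mul_left (c0 d α))).congr fun n => ?_)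
      have h3 := one_le_sobolevWeight hα₁ hα₂ n
      simp only [norm_mul, Complex.norm_real, Real.norm_eq_abs, ENNReal.toReal_ofNat,
        Real.rpow_ofNat, mul_pow, sq_abs]
      rw [Real.sq_sqrt (by linarith)]
      unfold sobolevWeight
      ring
    refine ⟨(fourierBasis d).repr.symm ⟨_, hmem⟩, Subtype.ext ?_⟩
    apply (fourierBasis d).repr.injective
    ext n
    change (fourierBasis d).repr (sobolevOp hα₁ hα₂ _) n = _
    rw [sobolevOp, repr_diagOp, LinearIsometryEquiv.apply_symm_apply]
    have := hw n
    push_cast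
    field_simp

lemma sobolevEquiv_apply (hα₁ : 1 < α) (hα₂ : α < 2) (f : L2 d) :
    (sobolevEquiv hα₁ hα₂ f : L2 d) = sobolevOp hα₁ hα₂ f := rfl

lemma exists_sobolevOp_eq (hα₁ : 1 < α) (hα₂ : α < 2) {u : L2 d} (hu : u ∈ perH d (α / 2)) :
    ∃ f, sobolevOp hα₁ hα₂ f = u := by
  obtain ⟨f, hf⟩ := (sobolevEquiv hα₁ hα₂).surjective ⟨u, hu⟩
  exact ⟨f, congrArg Subtype.val hf⟩

lemma sobolevNorm_smul (hα₁ : 1 < α) (hα₂ : α < 2) (c : ℂ) {u : L2 d} (hu : u ∈ perH d (α / 2)) :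
    sobolevNorm α (c • u) = ‖c‖ * sobolevNorm α u := by
  obtain ⟨f, rfl⟩ := exists_sobolevOp_eq hα₁ hα₂ hu
  rw [← map_smul, sobolevNorm_sobolevOp, sobolevNorm_sobolevOp, norm_smul]

lemma energy_one (hα₁ : 1 < α) (hα₂ : α < 2) (ξ : E d) :
    energy α ξ (one d) = ENNReal.ofReal (2 * c0 d α * ‖ξ‖ ^ α) := by
  rw [energy_eq hα₁ hα₂, tsum_eq_single 0]
  · simp [repr_one, freq_zero]
  · intro n hn
    simp [repr_one, hn]

lemma sobolevNorm_one (hα₁ : 1 < α) (hα₂ : α < 2) : sobolevNorm α (one d) = 1 := by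
  unfold sobolevNorm
  rw [energy_one hα₁ hα₂, norm_one, norm_zero, Real.zero_rpow (by linarith)]
  simp

/-- The form domain contains every Fourier basis vector. -/
lemma dense_perH (hα₁ : 1 < α) (hα₂ : α < 2) : Dense (perH d (α / 2) : Set (L2 d)) := by
  refine (Submodule.dense_iff_topologicalClosure_eq_top).2 (eq_top_iff.2 ?_)
  rw [← (fourierBasis d).dense_span]
  refine Submodule.topologicalClosure_mono (Submodule.span_le.2 ?_)
  rintro _ ⟨n, rfl⟩
  rw [SetLike.mem_coe, mem_perH_iff hα₁ hα₂]
  refine energy_lt_top_of_summable hα₁ hα₂ (summable_of_ne_finset_zero (s := {n}) fun m hm => ?_)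
  rw [HilbertBasis.repr_apply_apply, orthonormal_iff_ite.1 (fourierBasis d).orthonormal,
    if_neg (by simpa using hm)]
  simp

section SpectralGap

variable {ξ : E d} {v : L2 d}

/-- The spectral gap of the isotropic operator. -/
lemma energy_lower_bound (hα₁ : 1 < α) (hα₂ : α < 2) (hξ : ‖ξ‖ ≤ Real.pi)
    (hv : v ∈ perH d (α / 2)) :
    2 * c0 d α * Real.pi ^ α * ‖v‖ ^ 2
      ≤ 2 * c0 d α * Real.pi ^ α * ‖(inner ℂ (one d) v : ℂ)‖ ^ 2 + (energy α ξ v).toReal := by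
  have hc := c0_pos (d := d) hα₁ hα₂
  refine hasSum_le (fun n => ?_) ((hasSum_sq_repr v).mul_left (2 * c0 d α * Real.pi ^ α))
    ((hasSum_ite_eq (0 : Fin d → ℤ)
      (2 * c0 d α * Real.pi ^ α * ‖(inner ℂ (one d) v : ℂ)‖ ^ 2)).add
      (hasSum_energy hα₁ hα₂ (energy_lt_top hα₁ hα₂ hv ξ)))
  rcases eq_or_ne n 0 with rfl | hn
  · rw [if_pos rfl, HilbertBasis.repr_apply_apply, fourierBasis_zero]
    exact le_add_of_nonneg_right (by positivity)
  · have h1 := norm_freq_div_two_le hn hξ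
    have h2 := two_pi_le_norm_freq hn
    have h3 : Real.pi ≤ ‖ξ + freq n‖ := by linarith
    rw [if_neg hn, zero_add]
    gcongr

lemma two_rpow_le_four (hα₂ : α < 2) : (2 : ℝ) ^ α ≤ 4 :=
  (Real.rpow_le_rpow_of_exponent_le (by norm_num) hα₂.le).trans (by norm_num)

/-- No restriction on ξ and no orthogonality are needed, at the price of a term in ‖v‖²; this
suffices for the coercivity of a(ξ) + 1. -/
lemma energy_zero_le (hα₁ : 1 < α) (hα₂ : α < 2) (ξ : E d) (hv : v ∈ perH d (α / 2)) :
    (energy α 0 v).toReal ≤ 4 * (energy α ξ v).toReal + 8 * c0 d α * ‖ξ‖ ^ α * ‖v‖ ^ 2 := by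
  have hc := c0_pos (d := d) hα₁ hα₂
  refine hasSum_le (fun n => ?_) (hasSum_energy hα₁ hα₂ (energy_lt_top hα₁ hα₂ hv 0))
    (((hasSum_energy hα₁ hα₂ (energy_lt_top hα₁ hα₂ hv ξ)).mul_left 4).add
      ((hasSum_sq_repr v).mul_left (8 * c0 d α * ‖ξ‖ ^ α)))
  have h1 : ‖freq n‖ ≤ ‖ξ + freq n‖ + ‖ξ‖ := by
    simpa using norm_sub_le (ξ + freq n) ξ
  have h2 : ‖freq n‖ ^ α ≤ 4 * (‖ξ + freq n‖ ^ α + ‖ξ‖ ^ α) :=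
    (Real.rpow_le_rpow (norm_nonneg _) h1 (by linarith)).trans
      ((add_rpow_le (norm_nonneg _) (norm_nonneg _) (by linarith)).trans
        (mul_le_mul_of_nonneg_right (two_rpow_le_four hα₂) (by positivity)))
  rw [zero_add]
  calc 2 * c0 d α * ‖freq n‖ ^ α * ‖(fourierBasis d).repr v n‖ ^ 2
      ≤ 2 * c0 d α * (4 * (‖ξ + freq n‖ ^ α + ‖ξ‖ ^ α)) * ‖(fourierBasis d).repr v n‖ ^ 2 := by
        gcongr
    _ = _ := by ring

/-- Without the zeroth coefficient, |2πn| ≤ 2|ξ+2πn| holds at every frequency that matters, so no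
lower-order term appears. -/
lemma energy_comparison (hα₁ : 1 < α) (hα₂ : α < 2) (hξ : ‖ξ‖ ≤ Real.pi)
    (hv : v ∈ perH d (α / 2)) (hv1 : inner ℂ (one d) v = 0) :
    (energy α 0 v).toReal ≤ 4 * (energy α ξ v).toReal := by
  have hc := c0_pos (d := d) hα₁ hα₂
  refine hasSum_le (fun n => ?_) (hasSum_energy hα₁ hα₂ (energy_lt_top hα₁ hα₂ hv 0))
    ((hasSum_energy hα₁ hα₂ (energy_lt_top hα₁ hα₂ hv ξ)).mul_left 4)
  rcases eq_or_ne n 0 with rfl | hn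
  · rw [repr_zero_of_inner hv1]; simp
  · have h1 : ‖freq n‖ ≤ 2 * ‖ξ + freq n‖ := by linarith [norm_freq_div_two_le hn hξ]
    have h2 : ‖freq n‖ ^ α ≤ 4 * ‖ξ + freq n‖ ^ α := by
      calc ‖freq n‖ ^ α ≤ (2 * ‖ξ + freq n‖) ^ α :=
            Real.rpow_le_rpow (norm_nonneg _) h1 (by linarith)
        _ = 2 ^ α * ‖ξ + freq n‖ ^ α := Real.mul_rpow (by norm_num) (norm_nonneg _)
        _ ≤ 4 * ‖ξ + freq n‖ ^ α :=
            mul_le_mul_of_nonneg_right (two_rpow_le_four hα₂) (by positivity)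
    rw [zero_add]
    calc 2 * c0 d α * ‖freq n‖ ^ α * ‖(fourierBasis d).repr v n‖ ^ 2
        ≤ 2 * c0 d α * (4 * ‖ξ + freq n‖ ^ α) * ‖(fourierBasis d).repr v n‖ ^ 2 := by gcongr
      _ = _ := by ring

end SpectralGap

end Sobolev

/-! ### Boundedness of the forms and the expansion of a(ξ). -/

section JumpForms

variable {d : ℕ} {α mlo mhi : ℝ} {μ : E d → E d → ℝ}

/-- The measure `dx dy` on `Ω × ℝ^d`. -/
abbrev jumpMeasure (d : ℕ) : Measure (E d × E d) := (cellMeasure d).prod volume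

lemma jumpMeasure_le : jumpMeasure d ≤ volume := by
  rw [Measure.volume_eq_prod]
  exact Measure.prod_mono Measure.restrict_le_self le_rfl

lemma ae_jumpMeasure {P : E d → Prop} (h : ∀ᵐ x, P x) : ∀ᵐ p ∂jumpMeasure d, P p.1 ∧ P p.2 :=
  (Measure.quasiMeasurePreserving_fst.ae (ae_restrict_of_ae h)).and
    (Measure.quasiMeasurePreserving_snd.ae h)

lemma perExt_add_ae (u v : L2 d) :
    perExt ((u + v : L2 d) : E d → ℂ) =ᵐ[volume] fun x => perExt (u : E d → ℂ) x
      + perExt (v : E d → ℂ) x :=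
  perExt_congr (Lp.coeFn_add u v)

lemma perExt_smul_ae (c : ℂ) (u : L2 d) :
    perExt ((c • u : L2 d) : E d → ℂ) =ᵐ[volume] fun x => c * perExt (u : E d → ℂ) x :=
  perExt_congr (Lp.coeFn_smul c u)

section Integrability

lemma lintegral_jump (ξ : E d) (u : L2 d) :
    ∫⁻ p, ‖kernel α (p.1 - p.2) * ‖twist ξ u p.1 - twist ξ u p.2‖ ^ 2‖ₑ ∂jumpMeasure d
      = energy α ξ u := by
  refine lintegral_congr fun p => ?_
  rw [Real.enorm_of_nonneg (mul_nonneg (kernel_nonneg _) (by positivity)),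
    ENNReal.ofReal_mul (kernel_nonneg _), ENNReal.ofReal_pow (norm_nonneg _), ofReal_norm]

lemma integrable_jump {ξ : E d} {u : L2 d} (h : energy α ξ u < ⊤) :
    Integrable (fun p => kernel α (p.1 - p.2) * ‖twist ξ u p.1 - twist ξ u p.2‖ ^ 2)
      (jumpMeasure d) := by
  have hm := measurable_twist ξ u
  refine ⟨Measurable.aestronglyMeasurable (by fun_prop), ?_⟩
  unfold HasFiniteIntegral
  rwa [lintegral_jump]

lemma integral_jump (ξ : E d) (u : L2 d) :
    ∫ p, kernel α (p.1 - p.2) * ‖twist ξ u p.1 - twist ξ u p.2‖ ^ 2 ∂jumpMeasure d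
      = (energy α ξ u).toReal := by
  have hm := measurable_twist ξ u
  rw [← lintegral_jump, integral_eq_lintegral_of_nonneg_ae
    (Filter.Eventually.of_forall fun p => mul_nonneg (kernel_nonneg _) (by positivity))
    (Measurable.aestronglyMeasurable (by fun_prop))]
  congr 1
  refine lintegral_congr fun p => ?_
  rw [Real.enorm_of_nonneg (mul_nonneg (kernel_nonneg _) (by positivity))]

variable {k : E d → ℝ} {M : ℝ}

lemma lintegral_weight (hk : Measurable k) (hk0 : ∀ z, 0 ≤ k z)
    (hM : ∫⁻ z, ENNReal.ofReal (k z) = ENNReal.ofReal M) (u : L2 d) :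
    ∫⁻ p, ENNReal.ofReal (k (p.1 - p.2) * (‖perExt (u : E d → ℂ) p.1‖ ^ 2
        + ‖perExt (u : E d → ℂ) p.2‖ ^ 2)) ∂jumpMeasure d
      = ENNReal.ofReal (2 * M * ‖u‖ ^ 2) := by
  have hum : Measurable (u : E d → ℂ) := (Lp.stronglyMeasurable u).measurable
  have hc := measurable_cellRep (d := d)
  have h1 : ∀ p : E d × E d, ENNReal.ofReal (k (p.1 - p.2) * (‖perExt (u : E d → ℂ) p.1‖ ^ 2
        + ‖perExt (u : E d → ℂ) p.2‖ ^ 2))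
      = ENNReal.ofReal (k (p.1 - p.2)) * ‖(u : E d → ℂ) (cellRep p.1)‖ₑ ^ 2
        + ENNReal.ofReal (k (p.1 - p.2)) * ‖(u : E d → ℂ) (cellRep p.2)‖ₑ ^ 2 := by
    intro p
    rw [ENNReal.ofReal_mul (hk0 _), ENNReal.ofReal_add (by positivity) (by positivity),
      ENNReal.ofReal_pow (norm_nonneg _), ENNReal.ofReal_pow (norm_nonneg _), ofReal_norm,
      ofReal_norm, mul_add]
    rfl
  simp_rw [h1]
  rw [lintegral_add_right _ (by fun_prop),
    lintegral_cell_prod_fst (k := fun z => ENNReal.ofReal (k z))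
      (h := fun x => ‖(u : E d → ℂ) x‖ₑ ^ 2) (by fun_prop) (by fun_prop),
    lintegral_cell_prod_snd (k := fun z => ENNReal.ofReal (k z))
      (h := fun x => ‖(u : E d → ℂ) x‖ₑ ^ 2) (by fun_prop) (by fun_prop),
    lintegral_enorm_sq, hM, ← two_mul, mul_assoc, ENNReal.ofReal_mul (by norm_num),
    ENNReal.ofReal_mul' (by positivity), ENNReal.ofReal_ofNat, ENNReal.ofReal_pow (norm_nonneg _),
    ofReal_norm]

lemma integrable_weight (hk : Measurable k) (hk0 : ∀ z, 0 ≤ k z)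
    (hM : ∫⁻ z, ENNReal.ofReal (k z) = ENNReal.ofReal M) (u : L2 d) :
    Integrable (fun p => k (p.1 - p.2) * (‖perExt (u : E d → ℂ) p.1‖ ^ 2
        + ‖perExt (u : E d → ℂ) p.2‖ ^ 2)) (jumpMeasure d) := by
  have hm := measurable_perExt u
  refine ⟨Measurable.aestronglyMeasurable (by fun_prop), ?_⟩
  rw [hasFiniteIntegral_iff_ofReal
    (Filter.Eventually.of_forall fun p => mul_nonneg (hk0 _) (by positivity)),
    lintegral_weight hk hk0 hM]
  exact ENNReal.ofReal_lt_top

lemma integral_weight (hk : Measurable k) (hk0 : ∀ z, 0 ≤ k z)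
    (hM : ∫⁻ z, ENNReal.ofReal (k z) = ENNReal.ofReal M) (hM0 : 0 ≤ M) (u : L2 d) :
    ∫ p, k (p.1 - p.2) * (‖perExt (u : E d → ℂ) p.1‖ ^ 2
        + ‖perExt (u : E d → ℂ) p.2‖ ^ 2) ∂jumpMeasure d = 2 * M * ‖u‖ ^ 2 := by
  have hm := measurable_perExt u
  rw [integral_eq_lintegral_of_nonneg_ae
    (Filter.Eventually.of_forall fun p => mul_nonneg (hk0 _) (by positivity))
    (Measurable.aestronglyMeasurable (by fun_prop)), lintegral_weight hk hk0 hM,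
    ENNReal.toReal_ofReal (by positivity)]

end Integrability

namespace IsCoefficient

lemma ae_bounds (hμ : IsCoefficient mlo mhi μ) :
    ∀ᵐ p ∂jumpMeasure d, mlo ≤ μ p.1 p.2 ∧ μ p.1 p.2 ≤ mhi :=
  ae_mono jumpMeasure_le hμ.bounds

lemma aestronglyMeasurable_jump (hμ : IsCoefficient mlo mhi μ) :
    AEStronglyMeasurable (fun p : E d × E d => μ p.1 p.2) (jumpMeasure d) :=
  hμ.aestronglyMeasurable.mono_measure jumpMeasure_le

lemma lo_le_hi (hμ : IsCoefficient mlo mhi μ) : mlo ≤ mhi := by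
  obtain ⟨p, hp⟩ := hμ.bounds.exists
  exact hp.1.trans hp.2

end IsCoefficient

/-- The integrand of `a(ξ)[u,v]`. -/
def aIntegrand (α : ℝ) (μ : E d → E d → ℝ) (ξ : E d) (u v : L2 d) (p : E d × E d) : ℂ :=
  ((μ p.1 p.2 / ‖p.1 - p.2‖ ^ ((d : ℝ) + α) : ℝ) : ℂ) *
    ((twist ξ u p.1 - twist ξ u p.2) * star (twist ξ v p.1 - twist ξ v p.2))

/-- The integrand of `a^{(j)}[u,v]`. -/
def ajIntegrand (α : ℝ) (μ : E d → E d → ℝ) (j : Fin d) (u v : L2 d) (p : E d × E d) : ℂ :=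
  ((μ p.1 p.2 * (p.1 j - p.2 j) / ‖p.1 - p.2‖ ^ ((d : ℝ) + α) : ℝ) : ℂ) *
    (I * perExt (u : E d → ℂ) p.1 * star (perExt (v : E d → ℂ) p.2)
      - I * perExt (u : E d → ℂ) p.2 * star (perExt (v : E d → ℂ) p.1))

lemma aForm_eq (ξ : E d) (u v : L2 d) :
    aForm α μ ξ u v = (1 / 2 : ℂ) * ∫ p, aIntegrand α μ ξ u v p ∂jumpMeasure d := rfl

lemma ajForm_eq (j : Fin d) (u v : L2 d) :
    ajForm α μ j u v = -(1 / 2 : ℂ) * ∫ p, ajIntegrand α μ j u v p ∂jumpMeasure d := rfl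

/-- The majorant of the integrand of `a(ξ)[u,v]`. -/
def aMajorant (α mhi : ℝ) (ξ : E d) (u v : L2 d) (p : E d × E d) : ℝ :=
  mhi / 2 * (kernel α (p.1 - p.2) * ‖twist ξ u p.1 - twist ξ u p.2‖ ^ 2
    + kernel α (p.1 - p.2) * ‖twist ξ v p.1 - twist ξ v p.2‖ ^ 2)

/-- The majorant of the terms without increments. -/
def wMajorant (mhi : ℝ) (k : E d → ℝ) (u v : L2 d) (p : E d × E d) : ℝ :=
  mhi / 2 * (k (p.1 - p.2) * (‖perExt (u : E d → ℂ) p.1‖ ^ 2 + ‖perExt (u : E d → ℂ) p.2‖ ^ 2)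
    + k (p.1 - p.2) * (‖perExt (v : E d → ℂ) p.1‖ ^ 2 + ‖perExt (v : E d → ℂ) p.2‖ ^ 2))

lemma norm_coefficient_le {m K : ℝ} (hmlo : 0 < mlo) (hm : mlo ≤ m ∧ m ≤ mhi) (hK : 0 ≤ K) :
    ‖((m * K : ℝ) : ℂ)‖ ≤ mhi * K := by
  rw [Complex.norm_real, Real.norm_of_nonneg (mul_nonneg (hmlo.le.trans hm.1) hK)]
  exact mul_le_mul_of_nonneg_right hm.2 hK

lemma norm_aIntegrand_le (hmlo : 0 < mlo) (hμ : IsCoefficient mlo mhi μ) (ξ : E d) (u v : L2 d) :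
    ∀ᵐ p ∂jumpMeasure d, ‖aIntegrand α μ ξ u v p‖ ≤ aMajorant α mhi ξ u v p := by
  filter_upwards [hμ.ae_bounds] with p hp
  have h1 := norm_coefficient_le hmlo hp (kernel_nonneg (α := α) (p.1 - p.2))
  unfold aIntegrand aMajorant
  rw [div_eq_mul_inv, norm_mul, norm_mul, norm_star]
  set x := ‖twist ξ u p.1 - twist ξ u p.2‖
  set y := ‖twist ξ v p.1 - twist ξ v p.2‖
  have hk := kernel_nonneg (α := α) (p.1 - p.2)
  have hmhi : 0 ≤ mhi := (hmlo.trans_le (hp.1.trans hp.2)).le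
  calc _ ≤ mhi * kernel α (p.1 - p.2) * (x * y) := by gcongr; exact h1
    _ ≤ mhi * kernel α (p.1 - p.2) * (1 / 2 * (x ^ 2 + y ^ 2)) := by
        refine mul_le_mul_of_nonneg_left ?_ (mul_nonneg hmhi hk)
        nlinarith [sq_nonneg (x - y)]
    _ = _ := by ring

/-- For small r the difference of products is rewritten through the increments a - a' and b - b',
and Young's inequality turns the factor r into r² on the remaining terms. For large r the factor r
is already integrable against the kernel. Without this cancellation the first-order kernel would be
too singular at the diagonal. -/
lemma jump_product_le (a a' b b' : ℂ) {r : ℝ} (hr : 0 ≤ r) :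
    r * ‖a * star b' - a' * star b‖ ≤ 1 / 2 * (‖a - a'‖ ^ 2 + ‖b - b'‖ ^ 2)
      + 1 / 2 * jumpWeight r * (‖a‖ ^ 2 + ‖a'‖ ^ 2 + (‖b‖ ^ 2 + ‖b'‖ ^ 2)) := by
  unfold jumpWeight
  rcases le_total r 1 with h | h
  · have h2 : r ^ 2 ≤ r := by nlinarith
    rw [min_eq_right h2]
    have h1 : a * star b' - a' * star b = (a - a') * star b' - a' * star (b - b') := by
      rw [star_sub]; ring
    have h3 : ‖a * star b' - a' * star b‖ ≤ ‖a - a'‖ * ‖b'‖ + ‖a'‖ * ‖b - b'‖ := by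
      rw [h1]
      refine (norm_sub_le _ _).trans (le_of_eq ?_)
      rw [norm_mul, norm_mul, norm_star, norm_star]
    have h4 := mul_le_mul_of_nonneg_left h3 hr
    nlinarith [sq_nonneg (‖a - a'‖ - r * ‖b'‖), sq_nonneg (‖b - b'‖ - r * ‖a'‖),
      sq_nonneg (r * ‖a‖), sq_nonneg (r * ‖b‖)]
  · have h2 : r ≤ r ^ 2 := by nlinarith
    rw [min_eq_left h2]
    have h3 : ‖a * star b' - a' * star b‖ ≤ ‖a‖ * ‖b'‖ + ‖a'‖ * ‖b‖ := by
      refine (norm_sub_le _ _).trans (le_of_eq ?_)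
      rw [norm_mul, norm_mul, norm_star, norm_star]
    have h4 := mul_le_mul_of_nonneg_left h3 hr
    nlinarith [mul_nonneg hr (sq_nonneg (‖a‖ - ‖b'‖)), mul_nonneg hr (sq_nonneg (‖a'‖ - ‖b‖)),
      sq_nonneg ‖a - a'‖, sq_nonneg ‖b - b'‖]

lemma norm_ajIntegrand_le (hmlo : 0 < mlo) (hμ : IsCoefficient mlo mhi μ) (j : Fin d)
    (u v : L2 d) :
    ∀ᵐ p ∂jumpMeasure d, ‖ajIntegrand α μ j u v p‖ ≤ aMajorant α mhi 0 u v p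
      + wMajorant mhi (fun z => jumpWeight ‖z‖ * kernel α z) u v p := by
  filter_upwards [hμ.ae_bounds] with p hp
  have h1 := norm_coefficient_le hmlo hp (kernel_nonneg (α := α) (p.1 - p.2))
  unfold aMajorant wMajorant
  simp only [twist_zero]
  have h2 : ajIntegrand α μ j u v p = ((μ p.1 p.2 * kernel α (p.1 - p.2) : ℝ) : ℂ) *
      (((p.1 j - p.2 j : ℝ) : ℂ) * I * (perExt (u : E d → ℂ) p.1 * star (perExt (v : E d → ℂ) p.2)
      - perExt (u : E d → ℂ) p.2 * star (perExt (v : E d → ℂ) p.1))) := by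
    unfold ajIntegrand kernel
    push_cast
    ring
  rw [h2]
  set a := perExt (u : E d → ℂ) p.1
  set a' := perExt (u : E d → ℂ) p.2
  set b := perExt (v : E d → ℂ) p.1
  set b' := perExt (v : E d → ℂ) p.2
  have hj : |p.1 j - p.2 j| ≤ ‖p.1 - p.2‖ := by
    simpa using PiLp.norm_apply_le (p.1 - p.2) j
  have hk := kernel_nonneg (α := α) (p.1 - p.2)
  have hmhi : 0 ≤ mhi := (hmlo.trans_le (hp.1.trans hp.2)).le
  rw [norm_mul, norm_mul, norm_mul, Complex.norm_I, mul_one, Complex.norm_real ((p.1 j - p.2 j : ℝ)),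
    Real.norm_eq_abs]
  calc _ ≤ mhi * kernel α (p.1 - p.2) * (‖p.1 - p.2‖ * ‖a * star b' - a' * star b‖) := by
        gcongr
    _ ≤ mhi * kernel α (p.1 - p.2) * (1 / 2 * (‖a - a'‖ ^ 2 + ‖b - b'‖ ^ 2)
          + 1 / 2 * jumpWeight ‖p.1 - p.2‖ * (‖a‖ ^ 2 + ‖a'‖ ^ 2 + (‖b‖ ^ 2 + ‖b'‖ ^ 2))) :=
        mul_le_mul_of_nonneg_left (jump_product_le a a' b b' (norm_nonneg _))
          (mul_nonneg hmhi hk)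
    _ = _ := by ring

section Measurability

lemma aestronglyMeasurable_aIntegrand (hμ : IsCoefficient mlo mhi μ) (ξ : E d) (u v : L2 d) :
    AEStronglyMeasurable (aIntegrand α μ ξ u v) (jumpMeasure d) := by
  have h1 := hμ.aestronglyMeasurable_jump
  have h2 := measurable_twist ξ u
  have h3 := measurable_twist ξ v
  have h4 : Measurable fun p : E d × E d => (‖p.1 - p.2‖ ^ ((d : ℝ) + α))⁻¹ := by fun_prop
  have h5 : Measurable fun p : E d × E d =>
      (twist ξ u p.1 - twist ξ u p.2) * star (twist ξ v p.1 - twist ξ v p.2) := by fun_prop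
  exact (Complex.continuous_ofReal.comp_aestronglyMeasurable
    (h1.mul h4.aestronglyMeasurable)).mul h5.aestronglyMeasurable

lemma aestronglyMeasurable_ajIntegrand (hμ : IsCoefficient mlo mhi μ) (j : Fin d) (u v : L2 d) :
    AEStronglyMeasurable (ajIntegrand α μ j u v) (jumpMeasure d) := by
  have h1 := hμ.aestronglyMeasurable_jump
  have h2 := measurable_perExt u
  have h3 := measurable_perExt v
  have h4 : Measurable fun p : E d × E d => (‖p.1 - p.2‖ ^ ((d : ℝ) + α))⁻¹ := by fun_prop
  have h6 : Measurable fun p : E d × E d => p.1 j - p.2 j := by fun_prop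
  have h5 : Measurable fun p : E d × E d =>
      (I * perExt (u : E d → ℂ) p.1 * star (perExt (v : E d → ℂ) p.2)
      - I * perExt (u : E d → ℂ) p.2 * star (perExt (v : E d → ℂ) p.1)) := by fun_prop
  exact (Complex.continuous_ofReal.comp_aestronglyMeasurable
    ((h1.mul h6.aestronglyMeasurable).mul h4.aestronglyMeasurable)).mul h5.aestronglyMeasurable

end Measurability

lemma integrable_aMajorant {ξ : E d} {u v : L2 d} (hu : energy α ξ u < ⊤) (hv : energy α ξ v < ⊤) :
    Integrable (aMajorant α mhi ξ u v) (jumpMeasure d) :=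
  ((integrable_jump hu).add (integrable_jump hv)).const_mul _

lemma integral_aMajorant {ξ : E d} {u v : L2 d} (hu : energy α ξ u < ⊤) (hv : energy α ξ v < ⊤) :
    ∫ p, aMajorant α mhi ξ u v p ∂jumpMeasure d
      = mhi / 2 * ((energy α ξ u).toReal + (energy α ξ v).toReal) := by
  unfold aMajorant
  rw [integral_const_mul, integral_add (integrable_jump hu) (integrable_jump hv), integral_jump,
    integral_jump]

lemma integrable_wMajorant {k : E d → ℝ} {M : ℝ} (hk : Measurable k) (hk0 : ∀ z, 0 ≤ k z)
    (hM : ∫⁻ z, ENNReal.ofReal (k z) = ENNReal.ofReal M) (u v : L2 d) :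
    Integrable (wMajorant mhi k u v) (jumpMeasure d) :=
  ((integrable_weight hk hk0 hM u).add (integrable_weight hk hk0 hM v)).const_mul _

lemma integral_wMajorant {k : E d → ℝ} {M : ℝ} (hk : Measurable k) (hk0 : ∀ z, 0 ≤ k z)
    (hM : ∫⁻ z, ENNReal.ofReal (k z) = ENNReal.ofReal M) (hM0 : 0 ≤ M) (u v : L2 d) :
    ∫ p, wMajorant mhi k u v p ∂jumpMeasure d = mhi * M * (‖u‖ ^ 2 + ‖v‖ ^ 2) := by
  unfold wMajorant
  rw [integral_const_mul, integral_add (integrable_weight hk hk0 hM u)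
    (integrable_weight hk hk0 hM v), integral_weight hk hk0 hM hM0, integral_weight hk hk0 hM hM0]
  ring

lemma star_aForm (ξ : E d) (u v : L2 d) : star (aForm α μ ξ u v) = aForm α μ ξ v u := by
  rw [aForm_eq, aForm_eq, star_mul', RCLike.star_def, ← integral_conj]
  congr 1
  · simp [Complex.conj_ofNat]
  · refine integral_congr_ae (Filter.Eventually.of_forall fun p => ?_)
    simp only [aIntegrand, map_mul, Complex.conj_ofReal, RCLike.star_def, Complex.conj_conj]
    ring

lemma aForm_self (ξ : E d) (u : L2 d) :
    aForm α μ ξ u u = ((1 / 2 * ∫ p, μ p.1 p.2 * (kernel α (p.1 - p.2)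
      * ‖twist ξ u p.1 - twist ξ u p.2‖ ^ 2) ∂jumpMeasure d : ℝ) : ℂ) := by
  rw [aForm_eq, Complex.ofReal_mul, ← integral_complex_ofReal]
  congr 1
  · simp
  · refine integral_congr_ae (Filter.Eventually.of_forall fun p => ?_)
    simp only [aIntegrand, kernel, RCLike.star_def, Complex.mul_conj']
    push_cast
    ring

lemma star_ajForm (j : Fin d) (u v : L2 d) : star (ajForm α μ j u v) = ajForm α μ j v u := by
  rw [ajForm_eq, ajForm_eq, star_mul', RCLike.star_def, ← integral_conj]
  congr 1
  · simp [Complex.conj_ofNat]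
  · refine integral_congr_ae (Filter.Eventually.of_forall fun p => ?_)
    simp only [ajIntegrand, map_mul, map_sub, Complex.conj_ofReal, RCLike.star_def,
      Complex.conj_conj, Complex.conj_I]
    ring

lemma energy_le_sobolevNorm_sq (u : L2 d) :
    (energy α 0 u).toReal ≤ 2 * sobolevNorm α u ^ 2 := by
  rw [sobolevNorm_sq]
  nlinarith [sq_nonneg ‖u‖]

/-- The integrand of the second-order remainder. -/
lemma remainder_integrand_eq (ξ : E d) (u v : L2 d) (p : E d × E d) :
    aIntegrand α μ ξ u v p - aIntegrand α μ 0 u v p + ∑ j, (ξ j : ℂ) * ajIntegrand α μ j u v p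
      = ((μ p.1 p.2 * kernel α (p.1 - p.2) : ℝ) : ℂ) *
        ((1 - character ξ (p.1 - p.2) + I * ((inner ℝ ξ (p.1 - p.2) : ℝ) : ℂ))
            * (perExt (u : E d → ℂ) p.1 * star (perExt (v : E d → ℂ) p.2))
          + star (1 - character ξ (p.1 - p.2) + I * ((inner ℝ ξ (p.1 - p.2) : ℝ) : ℂ))
            * (perExt (u : E d → ℂ) p.2 * star (perExt (v : E d → ℂ) p.1))) := by
  have hin : ((inner ℝ ξ (p.1 - p.2) : ℝ) : ℂ) = ∑ j, (ξ j : ℂ) * ((p.1 j - p.2 j : ℝ) : ℂ) := by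
    rw [PiLp.inner_apply]
    push_cast
    refine Finset.sum_congr rfl fun j _ => ?_
    simp [mul_comm]
  have hsum : ∑ j, (ξ j : ℂ) * ajIntegrand α μ j u v p
      = ((μ p.1 p.2 * kernel α (p.1 - p.2) : ℝ) : ℂ) * ((inner ℝ ξ (p.1 - p.2) : ℝ) : ℂ) *
        (I * perExt (u : E d → ℂ) p.1 * star (perExt (v : E d → ℂ) p.2)
        - I * perExt (u : E d → ℂ) p.2 * star (perExt (v : E d → ℂ) p.1)) := by
    rw [hin, Finset.mul_sum, Finset.sum_mul]
    refine Finset.sum_congr rfl fun j _ => ?_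
    unfold ajIntegrand kernel
    push_cast
    ring
  have hx : ∀ x : E d, character ξ x * star (character ξ x) = 1 := fun x => by
    rw [RCLike.star_def, Complex.mul_conj', norm_character]; simp
  rw [hsum, character_sub]
  unfold aIntegrand
  simp only [twist_eq, character_zero_left, one_mul, star_add, star_sub, star_mul', star_one,
    star_star]
  have hI : star I = -I := Complex.conj_I
  have hr : star (((inner ℝ ξ (p.1 - p.2) : ℝ) : ℂ)) = ((inner ℝ ξ (p.1 - p.2) : ℝ) : ℂ) :=
    Complex.conj_ofReal _
  rw [hI, hr]
  have h1 := hx p.1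
  have h2 := hx p.2
  have hk : ((μ p.1 p.2 / ‖p.1 - p.2‖ ^ ((d : ℝ) + α) : ℝ) : ℂ)
      = ((μ p.1 p.2 * kernel α (p.1 - p.2) : ℝ) : ℂ) := by rw [kernel, div_eq_mul_inv]
  rw [hk]
  -- The diagonal products u(x)v(x)* and u(y)v(y)* cancel because the phase factors are unimodular;
  -- only the mixed products survive.
  linear_combination ((μ p.1 p.2 * kernel α (p.1 - p.2) : ℝ) : ℂ) *
    (perExt (u : E d → ℂ) p.1 * star (perExt (v : E d → ℂ) p.1) * h1
      + perExt (u : E d → ℂ) p.2 * star (perExt (v : E d → ℂ) p.2) * h2)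

variable [NeZero d]

lemma integrable_aIntegrand (hα₁ : 1 < α) (hα₂ : α < 2) (hmlo : 0 < mlo)
    (hμ : IsCoefficient mlo mhi μ) (ξ : E d) {u v : L2 d} (hu : u ∈ perH d (α / 2))
    (hv : v ∈ perH d (α / 2)) : Integrable (aIntegrand α μ ξ u v) (jumpMeasure d) :=
  (integrable_aMajorant (energy_lt_top hα₁ hα₂ hu ξ) (energy_lt_top hα₁ hα₂ hv ξ)).mono'
    (aestronglyMeasurable_aIntegrand hμ ξ u v) (norm_aIntegrand_le hmlo hμ ξ u v)

lemma integrable_jumpWeight_majorant (hα₁ : 1 < α) (hα₂ : α < 2) (u v : L2 d) :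
    Integrable (wMajorant mhi (fun z => jumpWeight ‖z‖ * kernel α z) u v) (jumpMeasure d) :=
  integrable_wMajorant (by fun_prop)
    (fun z => mul_nonneg (jumpWeight_nonneg (norm_nonneg z)) (kernel_nonneg z))
    (lintegral_kernel hα₁ hα₂) u v

lemma integrable_ajIntegrand (hα₁ : 1 < α) (hα₂ : α < 2) (hmlo : 0 < mlo)
    (hμ : IsCoefficient mlo mhi μ) (j : Fin d) {u v : L2 d} (hu : u ∈ perH d (α / 2))
    (hv : v ∈ perH d (α / 2)) : Integrable (ajIntegrand α μ j u v) (jumpMeasure d) :=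
  ((integrable_aMajorant (energy_lt_top hα₁ hα₂ hu 0) (energy_lt_top hα₁ hα₂ hv 0)).add
    (integrable_jumpWeight_majorant hα₁ hα₂ u v)).mono'
    (aestronglyMeasurable_ajIntegrand hμ j u v) (norm_ajIntegrand_le hmlo hμ j u v)

lemma isSesqOn_aForm (hα₁ : 1 < α) (hα₂ : α < 2) (hmlo : 0 < mlo)
    (hμ : IsCoefficient mlo mhi μ) (ξ : E d) : IsSesqOn (perH d (α / 2)) (aForm α μ ξ) := by
  have hadd : ∀ u ∈ perH d (α / 2), ∀ u' ∈ perH d (α / 2), ∀ v ∈ perH d (α / 2),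
      aForm α μ ξ (u + u') v = aForm α μ ξ u v + aForm α μ ξ u' v := by
    intro u hu u' hu' v hv
    rw [aForm_eq, aForm_eq, aForm_eq, ← mul_add,
      ← integral_add (integrable_aIntegrand hα₁ hα₂ hmlo hμ ξ hu hv)
        (integrable_aIntegrand hα₁ hα₂ hmlo hμ ξ hu' hv)]
    refine congrArg ((1 / 2 : ℂ) * ·) (integral_congr_ae ?_)
    filter_upwards [ae_jumpMeasure (perExt_add_ae u u')] with p hp
    simp only [aIntegrand, twist_eq, hp.1, hp.2]
    ring
  have hsmul : ∀ (c : ℂ), ∀ u ∈ perH d (α / 2), ∀ v ∈ perH d (α / 2),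
      aForm α μ ξ (c • u) v = c * aForm α μ ξ u v := by
    intro c u _ v _
    rw [aForm_eq, aForm_eq, mul_left_comm, ← integral_const_mul c]
    refine congrArg ((1 / 2 : ℂ) * ·) (integral_congr_ae ?_)
    filter_upwards [ae_jumpMeasure (perExt_smul_ae c u)] with p hp
    simp only [aIntegrand, twist_eq, hp.1, hp.2]
    ring
  -- Hermitian symmetry carries linearity over to the second argument.
  refine ⟨hadd, hsmul, fun u hu v hv v' hv' => ?_, fun c u hu v hv => ?_⟩
  · rw [← star_aForm, hadd v hv v' hv' u hu, star_add, star_aForm, star_aForm]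
  · rw [← star_aForm, hsmul c v hv u hu, star_mul', star_aForm]

lemma isSesqOn_ajForm (hα₁ : 1 < α) (hα₂ : α < 2) (hmlo : 0 < mlo)
    (hμ : IsCoefficient mlo mhi μ) (j : Fin d) : IsSesqOn (perH d (α / 2)) (ajForm α μ j) := by
  have hadd : ∀ u ∈ perH d (α / 2), ∀ u' ∈ perH d (α / 2), ∀ v ∈ perH d (α / 2),
      ajForm α μ j (u + u') v = ajForm α μ j u v + ajForm α μ j u' v := by
    intro u hu u' hu' v hv
    rw [ajForm_eq, ajForm_eq, ajForm_eq, ← mul_add,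
      ← integral_add (integrable_ajIntegrand hα₁ hα₂ hmlo hμ j hu hv)
        (integrable_ajIntegrand hα₁ hα₂ hmlo hμ j hu' hv)]
    refine congrArg (-(1 / 2 : ℂ) * ·) (integral_congr_ae ?_)
    filter_upwards [ae_jumpMeasure (perExt_add_ae u u')] with p hp
    simp only [ajIntegrand, hp.1, hp.2]
    ring
  have hsmul : ∀ (c : ℂ), ∀ u ∈ perH d (α / 2), ∀ v ∈ perH d (α / 2),
      ajForm α μ j (c • u) v = c * ajForm α μ j u v := by
    intro c u _ v _
    rw [ajForm_eq, ajForm_eq, mul_left_comm, ← integral_const_mul c]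
    refine congrArg (-(1 / 2 : ℂ) * ·) (integral_congr_ae ?_)
    filter_upwards [ae_jumpMeasure (perExt_smul_ae c u)] with p hp
    simp only [ajIntegrand, hp.1, hp.2]
    ring
  refine ⟨hadd, hsmul, fun u hu v hv v' hv' => ?_, fun c u hu v hv => ?_⟩
  · rw [← star_ajForm, hadd v hv v' hv' u hu, star_add, star_ajForm, star_ajForm]
  · rw [← star_ajForm, hsmul c v hv u hu, star_mul', star_ajForm]

/-- Two-sided comparison of `a(ξ)` with the isotropic form. -/
lemma aForm_self_bounds (hα₁ : 1 < α) (hα₂ : α < 2) (hmlo : 0 < mlo)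
    (hμ : IsCoefficient mlo mhi μ) (ξ : E d) {u : L2 d} (hu : u ∈ perH d (α / 2)) :
    mlo / 2 * (energy α ξ u).toReal ≤ (aForm α μ ξ u u).re ∧
      (aForm α μ ξ u u).re ≤ mhi / 2 * (energy α ξ u).toReal := by
  have hj := integrable_jump (energy_lt_top hα₁ hα₂ hu ξ)
  have h0 : ∀ p : E d × E d, 0 ≤ kernel α (p.1 - p.2) * ‖twist ξ u p.1 - twist ξ u p.2‖ ^ 2 :=
    fun p => mul_nonneg (kernel_nonneg _) (by positivity)
  have hi : Integrable (fun p : E d × E d => μ p.1 p.2 * (kernel α (p.1 - p.2)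
      * ‖twist ξ u p.1 - twist ξ u p.2‖ ^ 2)) (jumpMeasure d) := by
    refine (hj.const_mul mhi).mono' (hμ.aestronglyMeasurable_jump.mul hj.1) ?_
    filter_upwards [hμ.ae_bounds] with p hp
    rw [Real.norm_of_nonneg (mul_nonneg (hmlo.le.trans hp.1) (h0 p))]
    exact mul_le_mul_of_nonneg_right hp.2 (h0 p)
  rw [aForm_self, Complex.ofReal_re, ← integral_jump]
  constructor
  · have := integral_mono_ae (hj.const_mul mlo) hi (by
      filter_upwards [hμ.ae_bounds] with p hp
      exact mul_le_mul_of_nonneg_right hp.1 (h0 p))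
    rw [integral_const_mul] at this
    linarith
  · have := integral_mono_ae hi (hj.const_mul mhi) (by
      filter_upwards [hμ.ae_bounds] with p hp
      exact mul_le_mul_of_nonneg_right hp.2 (h0 p))
    rw [integral_const_mul] at this
    linarith

lemma norm_aForm_zero_le (hα₁ : 1 < α) (hα₂ : α < 2) (hmlo : 0 < mlo)
    (hμ : IsCoefficient mlo mhi μ) {u v : L2 d} (hu : u ∈ perH d (α / 2))
    (hv : v ∈ perH d (α / 2)) :
    ‖aForm α μ 0 u v‖ ≤ mhi * sobolevNorm α u * sobolevNorm α v := by
  have hmhi := (hmlo.trans_le hμ.lo_le_hi).le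
  have key : ∀ u ∈ perH d (α / 2), ∀ v ∈ perH d (α / 2),
      ‖aForm α μ 0 u v‖ ≤ mhi / 2 * (sobolevNorm α u ^ 2 + sobolevNorm α v ^ 2) := by
    intro u hu v hv
    have hu' := energy_lt_top hα₁ hα₂ hu 0
    have hv' := energy_lt_top hα₁ hα₂ hv 0
    have h1 := norm_integral_le_of_norm_le (integrable_aMajorant (mhi := mhi) hu' hv')
      (norm_aIntegrand_le hmlo hμ 0 u v)
    rw [integral_aMajorant hu' hv'] at h1
    rw [aForm_eq, norm_mul]
    have h2 := energy_le_sobolevNorm_sq (α := α) u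
    have h3 := energy_le_sobolevNorm_sq (α := α) v
    have h4 : ‖(1 / 2 : ℂ)‖ = 1 / 2 := by simp
    rw [h4]
    nlinarith
  have := (isSesqOn_aForm hα₁ hα₂ hmlo hμ 0).norm_le_of_sq_le (fun u _ => sobolevNorm_nonneg u)
    (fun c u hu => sobolevNorm_smul hα₁ hα₂ c hu) key hu hv
  linarith

/-- Integrating the pointwise majorant bounds the form by a sum of squares; homogeneity of the
Sobolev norm then yields the product. -/
lemma norm_ajForm_le (hα₁ : 1 < α) (hα₂ : α < 2) (hmlo : 0 < mlo)
    (hμ : IsCoefficient mlo mhi μ) (j : Fin d) {u v : L2 d} (hu : u ∈ perH d (α / 2))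
    (hv : v ∈ perH d (α / 2)) :
    ‖ajForm α μ j u v‖ ≤ mhi * (1 + kernelMass d α) * sobolevNorm α u * sobolevNorm α v := by
  have hmhi := (hmlo.trans_le hμ.lo_le_hi).le
  have hM := kernelMass_nonneg (d := d) (α := α)
  have key : ∀ u ∈ perH d (α / 2), ∀ v ∈ perH d (α / 2),
      ‖ajForm α μ j u v‖ ≤ mhi * (1 + kernelMass d α) / 2
        * (sobolevNorm α u ^ 2 + sobolevNorm α v ^ 2) := by
    intro u hu v hv
    have hu' := energy_lt_top hα₁ hα₂ hu 0
    have hv' := energy_lt_top hα₁ hα₂ hv 0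
    have i1 := integrable_aMajorant (mhi := mhi) hu' hv'
    have i2 := integrable_jumpWeight_majorant (mhi := mhi) hα₁ hα₂ u v
    have h1 := norm_integral_le_of_norm_le (i1.add i2) (norm_ajIntegrand_le hmlo hμ j u v)
    simp only [Pi.add_apply] at h1
    rw [integral_add i1 i2, integral_aMajorant hu' hv', integral_wMajorant (by fun_prop)
      (fun z => mul_nonneg (jumpWeight_nonneg (norm_nonneg z)) (kernel_nonneg z))
      (lintegral_kernel hα₁ hα₂) hM] at h1
    rw [ajForm_eq, norm_mul]
    have h2 := energy_le_sobolevNorm_sq (α := α) u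
    have h3 := energy_le_sobolevNorm_sq (α := α) v
    have h4 : ‖-(1 / 2 : ℂ)‖ = 1 / 2 := by simp
    have h5 : ‖u‖ ^ 2 ≤ sobolevNorm α u ^ 2 := by gcongr; exact norm_le_sobolevNorm u
    have h6 : ‖v‖ ^ 2 ≤ sobolevNorm α v ^ 2 := by gcongr; exact norm_le_sobolevNorm v
    have h7 : mhi / 2 * ((energy α 0 u).toReal + (energy α 0 v).toReal)
        ≤ mhi / 2 * (2 * sobolevNorm α u ^ 2 + 2 * sobolevNorm α v ^ 2) := by gcongr
    have h8 : mhi * kernelMass d α * (‖u‖ ^ 2 + ‖v‖ ^ 2)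
        ≤ mhi * kernelMass d α * (sobolevNorm α u ^ 2 + sobolevNorm α v ^ 2) := by gcongr
    rw [h4]
    linarith
  have := (isSesqOn_ajForm hα₁ hα₂ hmlo hμ j).norm_le_of_sq_le (fun u _ => sobolevNorm_nonneg u)
    (fun c u hu => sobolevNorm_smul hα₁ hα₂ c hu) key hu hv
  linarith

/-- The first-order part `∑ ξ_j a^{(j)}` of `a(ξ)`. -/
def firstForm (α : ℝ) (μ : E d → E d → ℝ) (ξ : E d) (u v : L2 d) : ℂ :=
  ∑ j, (ξ j : ℂ) * ajForm α μ j u v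

lemma isSesqOn_firstForm (hα₁ : 1 < α) (hα₂ : α < 2) (hmlo : 0 < mlo)
    (hμ : IsCoefficient mlo mhi μ) (ξ : E d) :
    IsSesqOn (perH d (α / 2)) (firstForm α μ ξ) :=
  IsSesqOn.sum _ fun j => (isSesqOn_ajForm hα₁ hα₂ hmlo hμ j).const_mul _

lemma norm_firstForm_le (hα₁ : 1 < α) (hα₂ : α < 2) (hmlo : 0 < mlo)
    (hμ : IsCoefficient mlo mhi μ) (ξ : E d) {u v : L2 d} (hu : u ∈ perH d (α / 2))
    (hv : v ∈ perH d (α / 2)) :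
    ‖firstForm α μ ξ u v‖ ≤ (d * (mhi * (1 + kernelMass d α))) * ‖ξ‖ * sobolevNorm α u
      * sobolevNorm α v := by
  have h1 : ∀ j ∈ Finset.univ, ‖(ξ j : ℂ) * ajForm α μ j u v‖
      ≤ ‖ξ‖ * (mhi * (1 + kernelMass d α) * sobolevNorm α u * sobolevNorm α v) := by
    intro j _
    rw [norm_mul, Complex.norm_real]
    exact mul_le_mul (PiLp.norm_apply_le ξ j) (norm_ajForm_le hα₁ hα₂ hmlo hμ j hu hv)
      (norm_nonneg _) (norm_nonneg _)
  refine (norm_sum_le_of_le _ h1).trans (le_of_eq ?_)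
  rw [Finset.sum_const, Finset.card_univ, Fintype.card_fin, nsmul_eq_mul]
  ring

/-- The second-order remainder of `a(ξ)` is of size `|ξ|^α`. -/
lemma norm_aForm_sub_le (hα₁ : 1 < α) (hα₂ : α < 2) (hmlo : 0 < mlo)
    (hμ : IsCoefficient mlo mhi μ) (ξ : E d) {u v : L2 d} (hu : u ∈ perH d (α / 2))
    (hv : v ∈ perH d (α / 2)) :
    ‖aForm α μ ξ u v - aForm α μ 0 u v - firstForm α μ ξ u v‖
      ≤ 2 * mhi * kernelMass d α * ‖ξ‖ ^ α * ‖u‖ * ‖v‖ := by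
  have hmhi := (hmlo.trans_le hμ.lo_le_hi).le
  have hM := kernelMass_nonneg (d := d) (α := α)
  have hsesq := ((isSesqOn_aForm hα₁ hα₂ hmlo hμ ξ).sub (isSesqOn_aForm hα₁ hα₂ hmlo hμ 0)).sub
    (isSesqOn_firstForm hα₁ hα₂ hmlo hμ ξ)
  -- The rescaled Taylor weight; its total mass is proportional to `|ξ|^α`.
  set k : E d → ℝ := fun z => 2 * (jumpWeight (‖ξ‖ * ‖z‖) * kernel α z) with hk
  have hkm : Measurable k := by fun_prop
  have hk0 : ∀ z, 0 ≤ k z := fun z =>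
    mul_nonneg (by norm_num) (mul_nonneg (jumpWeight_nonneg (by positivity)) (kernel_nonneg z))
  have hkM : ∫⁻ z, ENNReal.ofReal (k z) = ENNReal.ofReal (2 * (‖ξ‖ ^ α * kernelMass d α)) := by
    rw [ENNReal.ofReal_mul (by norm_num), ← lintegral_jumpWeight_smul hα₁ hα₂ (norm_nonneg ξ),
      ← lintegral_const_mul _ (by fun_prop)]
    exact lintegral_congr fun z => ENNReal.ofReal_mul (by norm_num)
  have key : ∀ u ∈ perH d (α / 2), ∀ v ∈ perH d (α / 2),
      ‖aForm α μ ξ u v - aForm α μ 0 u v - firstForm α μ ξ u v‖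
        ≤ mhi * kernelMass d α * ‖ξ‖ ^ α * (‖u‖ ^ 2 + ‖v‖ ^ 2) := by
    intro u hu v hv
    have i1 := integrable_aIntegrand hα₁ hα₂ hmlo hμ ξ hu hv
    have i2 := integrable_aIntegrand hα₁ hα₂ hmlo hμ 0 hu hv
    have i3 : ∀ j ∈ Finset.univ, Integrable (fun p => (ξ j : ℂ) * ajIntegrand α μ j u v p)
        (jumpMeasure d) := fun j _ => (integrable_ajIntegrand hα₁ hα₂ hmlo hμ j hu hv).const_mul _
    -- The first-order integrands enter with a plus sign because a^{(j)} has the prefactor -1/2 and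
    -- a(ξ) has 1/2.
    have h1 : aForm α μ ξ u v - aForm α μ 0 u v - firstForm α μ ξ u v
        = (1 / 2 : ℂ) * ∫ p, (aIntegrand α μ ξ u v p - aIntegrand α μ 0 u v p
          + ∑ j, (ξ j : ℂ) * ajIntegrand α μ j u v p) ∂jumpMeasure d := by
      have e1 := integral_add (i1.sub i2) (integrable_finsetSum _ i3)
      have e2 := integral_sub i1 i2
      have e3 := integral_finsetSum _ i3
      simp only [Pi.sub_apply] at e1
      rw [e1, e2, e3, firstForm, aForm_eq, aForm_eq, mul_add, mul_sub, Finset.mul_sum]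
      simp only [integral_const_mul, ajForm_eq]
      rw [sub_eq_add_neg, ← Finset.sum_neg_distrib]
      congr 1
      exact Finset.sum_congr rfl fun j _ => by ring
    have h2 : ∀ᵐ p ∂jumpMeasure d, ‖aIntegrand α μ ξ u v p - aIntegrand α μ 0 u v p
        + ∑ j, (ξ j : ℂ) * ajIntegrand α μ j u v p‖ ≤ wMajorant mhi k u v p := by
      filter_upwards [hμ.ae_bounds] with p hp
      have h1 := norm_coefficient_le hmlo hp (kernel_nonneg (α := α) (p.1 - p.2))
      rw [remainder_integrand_eq]
      unfold wMajorant
      set a := perExt (u : E d → ℂ) p.1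
      set a' := perExt (u : E d → ℂ) p.2
      set b := perExt (v : E d → ℂ) p.1
      set b' := perExt (v : E d → ℂ) p.2
      set ρ := 1 - character ξ (p.1 - p.2) + I * ((inner ℝ ξ (p.1 - p.2) : ℝ) : ℂ)
      have hρ : ‖ρ‖ ≤ 2 * jumpWeight (‖ξ‖ * ‖p.1 - p.2‖) := by
        refine (norm_exp_sub_one_sub_le _).trans ?_
        have := jumpWeight_mono (abs_nonneg _) (abs_real_inner_le_norm ξ (p.1 - p.2))
        linarith
      have hkk := kernel_nonneg (α := α) (p.1 - p.2)
      have h3 : ‖ρ * (a * star b') + star ρ * (a' * star b)‖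
          ≤ 2 * jumpWeight (‖ξ‖ * ‖p.1 - p.2‖)
            * (1 / 2 * (‖a‖ ^ 2 + ‖a'‖ ^ 2 + (‖b‖ ^ 2 + ‖b'‖ ^ 2))) := by
        calc _ ≤ ‖ρ‖ * (‖a‖ * ‖b'‖ + ‖a'‖ * ‖b‖) := by
              refine (norm_add_le _ _).trans (le_of_eq ?_)
              simp only [norm_mul, norm_star]
              ring
          _ ≤ ‖ρ‖ * (1 / 2 * (‖a‖ ^ 2 + ‖a'‖ ^ 2 + (‖b‖ ^ 2 + ‖b'‖ ^ 2))) := by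
              gcongr
              nlinarith [sq_nonneg (‖a‖ - ‖b'‖), sq_nonneg (‖a'‖ - ‖b‖)]
          _ ≤ _ := by gcongr
      rw [norm_mul]
      calc _ ≤ mhi * kernel α (p.1 - p.2) * _ :=
            mul_le_mul h1 h3 (norm_nonneg _) (mul_nonneg hmhi hkk)
        _ = _ := by rw [hk]; ring
    have h3 := norm_integral_le_of_norm_le (integrable_wMajorant hkm hk0 hkM u v) h2
    rw [integral_wMajorant hkm hk0 hkM (by positivity)] at h3
    rw [h1, norm_mul]
    have h4 : ‖(1 / 2 : ℂ)‖ = 1 / 2 := by simp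
    rw [h4]
    linarith
  have := hsesq.norm_le_of_sq_le (fun u _ => norm_nonneg u) (fun c u _ => norm_smul c u) key hu hv
  linarith

end JumpForms

/-! ### Coercivity of a(ξ), the represented operators, resolvents and cell problems. -/

section Homogenization

variable {d : ℕ} {α mlo mhi : ℝ} {μ : E d → E d → ℝ}

lemma perExt_one_ae (d : ℕ) : perExt (one d : E d → ℂ) =ᵐ[volume] fun _ => 1 :=
  perExt_congr (MemLp.coeFn_toLp (memLp_const (1 : ℂ)))

lemma aForm_zero_one (v : L2 d) : aForm α μ 0 (one d) v = 0 := by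
  rw [aForm_eq, integral_eq_zero_of_ae, mul_zero]
  filter_upwards [ae_jumpMeasure (perExt_one_ae d)] with p hp
  simp [aIntegrand, twist_zero, hp.1, hp.2]

lemma aForm_zero_one_right (u : L2 d) : aForm α μ 0 u (one d) = 0 := by
  rw [← star_aForm, aForm_zero_one, star_zero]

/-- For constants the two products in the integrand cancel. Consequently the eigenvalue has no term
linear in ξ. -/
lemma ajForm_one_one (j : Fin d) : ajForm α μ j (one d) (one d) = 0 := by
  rw [ajForm_eq, integral_eq_zero_of_ae, mul_zero]
  filter_upwards [ae_jumpMeasure (perExt_one_ae d)] with p hp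
  simp [ajIntegrand, hp.1, hp.2]

lemma inner_one_one (d : ℕ) : inner ℂ (one d) (one d) = 1 := by
  simp [inner_self_eq_norm_sq_to_K, norm_one]

lemma rpow_le_four_mul {t : ℝ} (hα₁ : 1 < α) (hα₂ : α < 2) (ht : 0 ≤ t) (ht4 : t ≤ 4) :
    t ^ α ≤ 4 * t := by
  rcases le_total t 1 with h | h
  · have := Real.rpow_le_rpow_of_exponent_ge_of_imp ht h hα₁.le (fun _ _ => by linarith)
    rw [Real.rpow_one] at this
    linarith
  · have := Real.rpow_le_rpow_of_exponent_le h hα₂.le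
    rw [Real.rpow_two] at this
    nlinarith

lemma sq_le_four_mul_rpow {t : ℝ} (hα₁ : 1 < α) (hα₂ : α < 2) (ht : 0 ≤ t) (ht4 : t ≤ 4) :
    t ^ 2 ≤ 4 * t ^ α := by
  rcases le_total t 1 with h | h
  · have := Real.rpow_le_rpow_of_exponent_ge_of_imp ht h hα₂.le (fun _ _ => by linarith)
    rw [Real.rpow_two] at this
    linarith [Real.rpow_nonneg ht α]
  · have := Real.rpow_le_rpow_of_exponent_le h hα₁.le
    rw [Real.rpow_one] at this
    nlinarith

lemma delta0_rpow (hα : 0 < α) (hmlo : 0 < mlo) (hmhi : 0 < mhi) :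
    delta0 α mlo mhi ^ α = Real.pi ^ α * (mlo / (3 * mhi)) := by
  unfold delta0
  rw [Real.mul_rpow Real.pi_pos.le (by positivity), ← Real.rpow_mul (by positivity),
    one_div_mul_cancel hα.ne', Real.rpow_one]

lemma delta0_le_pi (hα : 0 < α) (hmlo : 0 < mlo) (h : mlo ≤ mhi) :
    delta0 α mlo mhi ≤ Real.pi := by
  have hmhi := hmlo.trans_le h
  unfold delta0
  refine mul_le_of_le_one_right Real.pi_pos.le (Real.rpow_le_one (by positivity) ?_ (by positivity))
  rw [div_le_one (by positivity)]
  linarith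

/-- The bound of the forms `a^{(j)}`. -/
def ajConst (d : ℕ) (α mhi : ℝ) : ℝ := mhi * (1 + kernelMass d α)

lemma ajConst_nonneg (hmhi : 0 ≤ mhi) : 0 ≤ ajConst d α mhi :=
  mul_nonneg hmhi (by linarith [kernelMass_nonneg (d := d) (α := α)])

lemma norm_inner_le_sobolevNorm (u v : L2 d) :
    ‖(inner ℂ v u : ℂ)‖ ≤ sobolevNorm α u * sobolevNorm α v := by
  refine (norm_inner_le_norm v u).trans ?_
  rw [mul_comm]
  exact mul_le_mul (norm_le_sobolevNorm u) (norm_le_sobolevNorm v) (norm_nonneg _)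
    (sobolevNorm_nonneg u)

variable [NeZero d]

/-- The coercivity constant of `a(ξ)` on the orthogonal complement of `𝟏_Ω`. -/
def gapConst (d : ℕ) [NeZero d] (α mlo : ℝ) : ℝ := mlo * min (c0 d α * Real.pi ^ α / 2) (1 / 8)

lemma gapConst_pos (hα₁ : 1 < α) (hα₂ : α < 2) (hmlo : 0 < mlo) : 0 < gapConst d α mlo := by
  have hc := c0_pos (d := d) hα₁ hα₂
  exact mul_pos hmlo (lt_min (by positivity) (by norm_num))

lemma aForm_self_nonneg (hα₁ : 1 < α) (hα₂ : α < 2) (hmlo : 0 < mlo)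
    (hμ : IsCoefficient mlo mhi μ) (ξ : E d) {u : L2 d} (hu : u ∈ perH d (α / 2)) :
    0 ≤ (aForm α μ ξ u u).re :=
  le_trans (by positivity) (aForm_self_bounds hα₁ hα₂ hmlo hμ ξ hu).1

lemma aForm_lower (hα₁ : 1 < α) (hα₂ : α < 2) (hmlo : 0 < mlo) (hμ : IsCoefficient mlo mhi μ)
    {ξ : E d} (hξ : ‖ξ‖ ≤ Real.pi) {v : L2 d} (hv : v ∈ perH d (α / 2))
    (hv1 : inner ℂ (one d) v = 0) : d0 d α mlo * ‖v‖ ^ 2 ≤ (aForm α μ ξ v v).re := by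
  have h1 := energy_lower_bound hα₁ hα₂ hξ hv
  rw [hv1, norm_zero] at h1
  have h2 := (aForm_self_bounds hα₁ hα₂ hmlo hμ ξ hv).1
  unfold d0
  nlinarith

/-- One half of the energy at ξ pays for ‖v‖² through the gap, the other half for the energy at 0
through the comparison with factor 4; hence the minimum of two constants. -/
lemma aForm_coercive (hα₁ : 1 < α) (hα₂ : α < 2) (hmlo : 0 < mlo) (hμ : IsCoefficient mlo mhi μ)
    {ξ : E d} (hξ : ‖ξ‖ ≤ Real.pi) {v : L2 d} (hv : v ∈ perH d (α / 2))
    (hv1 : inner ℂ (one d) v = 0) :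
    gapConst d α mlo * sobolevNorm α v ^ 2 ≤ (aForm α μ ξ v v).re := by
  have h1 := energy_lower_bound hα₁ hα₂ hξ hv
  rw [hv1, norm_zero] at h1
  have h2 := (aForm_self_bounds hα₁ hα₂ hmlo hμ ξ hv).1
  have h3 := energy_comparison hα₁ hα₂ hξ hv hv1
  rw [sobolevNorm_sq, gapConst, mul_assoc]
  refine le_trans ?_ h2
  rw [show mlo / 2 * (energy α ξ v).toReal = mlo * ((energy α ξ v).toReal / 2) by ring]
  refine mul_le_mul_of_nonneg_left ?_ hmlo.le
  have h4 : min (c0 d α * Real.pi ^ α / 2) (1 / 8) * ‖v‖ ^ 2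
      ≤ c0 d α * Real.pi ^ α / 2 * ‖v‖ ^ 2 :=
    mul_le_mul_of_nonneg_right (min_le_left _ _) (by positivity)
  have h5 : min (c0 d α * Real.pi ^ α / 2) (1 / 8) * ((energy α 0 v).toReal / 2)
      ≤ 1 / 8 * ((energy α 0 v).toReal / 2) :=
    mul_le_mul_of_nonneg_right (min_le_right _ _) (by positivity)
  rw [mul_add]
  nlinarith

lemma norm_remainder_le (hα₁ : 1 < α) (hα₂ : α < 2) (hmlo : 0 < mlo)
    (hμ : IsCoefficient mlo mhi μ) (ξ : E d) {u v : L2 d} (hu : u ∈ perH d (α / 2))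
    (hv : v ∈ perH d (α / 2)) :
    ‖aForm α μ ξ u v - aForm α μ 0 u v - firstForm α μ ξ u v‖
      ≤ 2 * mhi * kernelMass d α * ‖ξ‖ ^ α * sobolevNorm α u * sobolevNorm α v := by
  have hmhi := (hmlo.trans_le hμ.lo_le_hi).le
  have hM := kernelMass_nonneg (d := d) (α := α)
  refine (norm_aForm_sub_le hα₁ hα₂ hmlo hμ ξ hu hv).trans ?_
  have h1 := norm_le_sobolevNorm (α := α) u
  have h2 := norm_le_sobolevNorm (α := α) v
  have h3 := sobolevNorm_nonneg (α := α) u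
  gcongr

/-- The constant may depend on ξ: the bound is used only to construct 𝕋(ξ) and the resolvent. -/
lemma exists_norm_aForm_sub_le (hα₁ : 1 < α) (hα₂ : α < 2) (hmlo : 0 < mlo)
    (hμ : IsCoefficient mlo mhi μ) (ξ : E d) :
    ∃ C, ∀ u ∈ perH d (α / 2), ∀ v ∈ perH d (α / 2),
      ‖aForm α μ ξ u v - aForm α μ 0 u v‖ ≤ C * sobolevNorm α u * sobolevNorm α v := by
  refine ⟨2 * mhi * kernelMass d α * ‖ξ‖ ^ α + d * (mhi * (1 + kernelMass d α)) * ‖ξ‖,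
    fun u hu v hv => ?_⟩
  have h1 := norm_remainder_le hα₁ hα₂ hmlo hμ ξ hu hv
  have h2 := norm_firstForm_le hα₁ hα₂ hmlo hμ ξ hu hv
  have h3 := norm_add_le (aForm α μ ξ u v - aForm α μ 0 u v - firstForm α μ ξ u v)
    (firstForm α μ ξ u v)
  rw [sub_add_cancel] at h3
  linarith

/-- A bounded sesquilinear form on `𝔇` is represented by an operator in `𝔇`. -/
lemma exists_represents (hα₁ : 1 < α) (hα₂ : α < 2) (hmlo : 0 < mlo)
    (hμ : IsCoefficient mlo mhi μ) {b : L2 d → L2 d → ℂ} (hb : IsSesqOn (perH d (α / 2)) b)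
    {C : ℝ} (hC : ∀ u ∈ perH d (α / 2), ∀ v ∈ perH d (α / 2),
      ‖b u v‖ ≤ C * sobolevNorm α u * sobolevNorm α v) :
    Represents α mhi μ b (formOperator α mhi μ b) := by
  have hmhi := (hmlo.trans_le hμ.lo_le_hi).le
  have hex : ∃ T, Represents α mhi μ b T := by
    have hmem := sobolevOp_mem (d := d) hα₁ hα₂
    refine ((isSesqOn_aForm hα₁ hα₂ hmlo hμ 0).add
      ((IsSesqOn.inner _).const_mul (mhi : ℂ))).exists_represents hb (sobolevEquiv hα₁ hα₂)
      (sobolevEquiv_apply hα₁ hα₂) (C := 2 * mhi) (C' := C) hmlo (fun f g => ?_) (fun f g => ?_)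
      (fun f => ?_)
    · rw [← sobolevNorm_sobolevOp hα₁ hα₂ f, ← sobolevNorm_sobolevOp hα₁ hα₂ g]
      refine (norm_add_le _ _).trans ?_
      have h1 := norm_aForm_zero_le hα₁ hα₂ hmlo hμ (hmem f) (hmem g)
      have h2 := mul_le_mul_of_nonneg_left
        (norm_inner_le_sobolevNorm (α := α) (sobolevOp hα₁ hα₂ f) (sobolevOp hα₁ hα₂ g)) hmhi
      rw [norm_mul, Complex.norm_real, Real.norm_of_nonneg hmhi]
      linarith
    · rw [← sobolevNorm_sobolevOp hα₁ hα₂ f, ← sobolevNorm_sobolevOp hα₁ hα₂ g]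
      exact hC _ (hmem f) _ (hmem g)
    · rw [← sobolevNorm_sobolevOp hα₁ hα₂ f, sobolevNorm_sq, Complex.add_re, Complex.re_ofReal_mul,
        inner_self_eq_norm_sq_to_K]
      have h1 := (aForm_self_bounds hα₁ hα₂ hmlo hμ 0 (hmem f)).1
      have h2 : mlo * ‖sobolevOp hα₁ hα₂ f‖ ^ 2 ≤ mhi * ‖sobolevOp hα₁ hα₂ f‖ ^ 2 :=
        mul_le_mul_of_nonneg_right hμ.lo_le_hi (by positivity)
      have h3 : (((‖sobolevOp hα₁ hα₂ f‖ : ℂ)) ^ 2).re = ‖sobolevOp hα₁ hα₂ f‖ ^ 2 := by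
        rw [← Complex.ofReal_pow, Complex.ofReal_re]
      simp only [Complex.coe_algebraMap]
      rw [h3]
      linarith
  rw [formOperator, dif_pos hex]
  exact hex.choose_spec

lemma represents_opTj (hα₁ : 1 < α) (hα₂ : α < 2) (hmlo : 0 < mlo)
    (hμ : IsCoefficient mlo mhi μ) (j : Fin d) :
    Represents α mhi μ (ajForm α μ j) (opTj α mhi μ j) :=
  exists_represents hα₁ hα₂ hmlo hμ (isSesqOn_ajForm hα₁ hα₂ hmlo hμ j) fun _ hu _ hv =>
    norm_ajForm_le hα₁ hα₂ hmlo hμ j hu hv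

lemma represents_opT (hα₁ : 1 < α) (hα₂ : α < 2) (hmlo : 0 < mlo)
    (hμ : IsCoefficient mlo mhi μ) (ξ : E d) :
    Represents α mhi μ (fun u v => aForm α μ ξ u v - aForm α μ 0 u v) (opT α mhi μ ξ) := by
  obtain ⟨C, hC⟩ := exists_norm_aForm_sub_le hα₁ hα₂ hmlo hμ ξ
  exact exists_represents hα₁ hα₂ hmlo hμ
    ((isSesqOn_aForm hα₁ hα₂ hmlo hμ ξ).sub (isSesqOn_aForm hα₁ hα₂ hmlo hμ 0)) hC

/-- The resolvent of `𝔸(ξ)` at `-1`. -/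
lemma exists_isShiftedInverse (hα₁ : 1 < α) (hα₂ : α < 2) (hmlo : 0 < mlo)
    (hμ : IsCoefficient mlo mhi μ) (ξ : E d) :
    ∃ R : L2 d →L[ℂ] L2 d, IsShiftedInverse (perH d (α / 2)) (aForm α μ ξ) R ∧
      IsCompactOperator R := by
  have hmem := sobolevOp_mem (d := d) hα₁ hα₂
  have hc0 := c0_pos (d := d) hα₁ hα₂
  obtain ⟨C, hC⟩ := exists_norm_aForm_sub_le hα₁ hα₂ hmlo hμ ξ
  -- The first two summands pay for ‖u‖² and for the lower-order term of the comparison with energy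
  -- 0; 4/μ₋ converts the energy at ξ into a(ξ).
  set M : ℝ := 1 + 4 * c0 d α * ‖ξ‖ ^ α + 4 / mlo with hM
  have hM0 : 0 < M := by positivity
  refine Exists.elim (((isSesqOn_aForm hα₁ hα₂ hmlo hμ ξ).add
    (IsSesqOn.inner _)).exists_solution (sobolevEquiv hα₁ hα₂) (sobolevEquiv_apply hα₁ hα₂)
    (C := C + mhi + 1) (inv_pos.2 hM0) (fun f g => ?_) (fun f => ?_)
    (isCompactOperator_sobolevOp hα₁ hα₂)) fun R ⟨h1, h2, h3⟩ => ⟨R, ⟨h1, h2⟩, h3⟩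
  · rw [← sobolevNorm_sobolevOp hα₁ hα₂ f, ← sobolevNorm_sobolevOp hα₁ hα₂ g]
    set u := sobolevOp hα₁ hα₂ f
    set v := sobolevOp hα₁ hα₂ g
    have e1 := hC u (hmem f) v (hmem g)
    have e2 := norm_aForm_zero_le hα₁ hα₂ hmlo hμ (hmem f) (hmem g)
    have e3 := norm_inner_le_sobolevNorm (α := α) u v
    have e4 := norm_add_le (aForm α μ ξ u v - aForm α μ 0 u v) (aForm α μ 0 u v)
    rw [sub_add_cancel] at e4
    refine (norm_add_le _ _).trans ?_
    linarith
  · rw [← sobolevNorm_sobolevOp hα₁ hα₂ f, sobolevNorm_sq, Complex.add_re,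
      inner_self_eq_norm_sq_to_K]
    set u := sobolevOp hα₁ hα₂ f
    have e1 := (aForm_self_bounds hα₁ hα₂ hmlo hμ ξ (hmem f)).1
    have e2 := energy_zero_le hα₁ hα₂ ξ (hmem f)
    have h3 : (((‖u‖ : ℂ)) ^ 2).re = ‖u‖ ^ 2 := by rw [← Complex.ofReal_pow, Complex.ofReal_re]
    simp only [Complex.coe_algebraMap]
    rw [h3, inv_mul_le_iff₀ hM0]
    have e3 : M * (mlo / 2 * (energy α ξ u).toReal + ‖u‖ ^ 2)
        ≤ M * ((aForm α μ ξ u u).re + ‖u‖ ^ 2) := by gcongr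
    refine le_trans ?_ e3
    have e4 : 0 ≤ (1 + 4 * c0 d α * ‖ξ‖ ^ α) * (mlo / 2 * (energy α ξ u).toReal) := by positivity
    have e5 : 0 ≤ 4 / mlo * ‖u‖ ^ 2 := by positivity
    have e6 : 4 / mlo * (mlo / 2 * (energy α ξ u).toReal) = 2 * (energy α ξ u).toReal := by
      field_simp; ring
    rw [hM]
    linarith

/-- Solutions of `𝔸(0) w = f` orthogonal to `𝟏_Ω`. -/
lemma exists_cell_solution (hα₁ : 1 < α) (hα₂ : α < 2) (hmlo : 0 < mlo)
    (hμ : IsCoefficient mlo mhi μ) :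
    ∃ G : L2 d →L[ℂ] L2 d, (∀ f, G f ∈ perH d (α / 2)) ∧
      ∀ f, inner ℂ (one d) f = 0 → inner ℂ (one d) (G f) = 0 ∧ (G f, f) ∈ opGraph α μ 0 := by
  have hmem := sobolevOp_mem (d := d) hα₁ hα₂
  have hc0 := c0_pos (d := d) hα₁ hα₂
  have hmhi := (hmlo.trans_le hμ.lo_le_hi).le
  -- The rank-one form (u,𝟏)(𝟏,v) removes the kernel of a(0), so Lax-Milgram applies on the whole
  -- domain.
  have hs : IsSesqOn (perH d (α / 2)) fun u v : L2 d =>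
      inner ℂ (one d) u * inner ℂ v (one d) :=
    { add_left := fun u _ u' _ v _ => by rw [inner_add_right, add_mul]
      smul_left := fun c u _ v _ => by rw [inner_smul_right, mul_assoc]
      add_right := fun u _ v _ v' _ => by rw [inner_add_left, mul_add]
      smul_right := fun c u _ v _ => by rw [inner_smul_left, mul_left_comm]; rfl }
  set K : ℝ := 2 * c0 d α * Real.pi ^ α with hK
  have hK0 : 0 < K := by positivity
  set M : ℝ := 1 + (1 + K⁻¹ * 2) / mlo + K⁻¹ with hM
  have hM0 : 0 < M := by positivity
  have h1N := sobolevNorm_one (d := d) hα₁ hα₂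
  refine Exists.elim (((isSesqOn_aForm hα₁ hα₂ hmlo hμ 0).add hs).exists_solution
    (sobolevEquiv hα₁ hα₂) (sobolevEquiv_apply hα₁ hα₂)
    (C := mhi + 1) (inv_pos.2 hM0) (fun f g => ?_) (fun f => ?_)
    (isCompactOperator_sobolevOp hα₁ hα₂)) fun G ⟨h1, h2, _⟩ => ?_
  · rw [← sobolevNorm_sobolevOp hα₁ hα₂ f, ← sobolevNorm_sobolevOp hα₁ hα₂ g]
    set u := sobolevOp hα₁ hα₂ f
    set v := sobolevOp hα₁ hα₂ g
    have e2 := norm_aForm_zero_le hα₁ hα₂ hmlo hμ (hmem f) (hmem g)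
    have e3 := norm_inner_le_sobolevNorm (α := α) u (one d)
    have e4 := norm_inner_le_sobolevNorm (α := α) (one d) v
    rw [h1N, mul_one] at e3
    rw [h1N, one_mul] at e4
    refine (norm_add_le _ _).trans ?_
    rw [norm_mul]
    have e5 := mul_le_mul e3 e4 (norm_nonneg _) (sobolevNorm_nonneg u)
    linarith
  · rw [← sobolevNorm_sobolevOp hα₁ hα₂ f, sobolevNorm_sq, Complex.add_re]
    set u := sobolevOp hα₁ hα₂ f
    have e1 := (aForm_self_bounds hα₁ hα₂ hmlo hμ 0 (hmem f)).1
    have e2 := energy_lower_bound hα₁ hα₂ (ξ := 0) (by simpa using Real.pi_pos.le) (hmem f)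
    have h3 : (inner ℂ (one d) u * inner ℂ u (one d) : ℂ).re = ‖(inner ℂ (one d) u : ℂ)‖ ^ 2 := by
      rw [← inner_conj_symm u (one d), Complex.mul_conj', ← Complex.ofReal_pow, Complex.ofReal_re]
    rw [h3, inv_mul_le_iff₀ hM0]
    set s := ‖(inner ℂ (one d) u : ℂ)‖ ^ 2
    set E₀ := (energy α 0 u).toReal
    have hE₀ : 0 ≤ E₀ := ENNReal.toReal_nonneg
    have hs0 : 0 ≤ s := by positivity
    have e0 : ‖u‖ ^ 2 ≤ s + K⁻¹ * E₀ := by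
      refine le_of_mul_le_mul_left (a := K) ?_ hK0
      rw [mul_add, mul_inv_cancel_left₀ hK0.ne']
      exact e2
    have e3 : M * (mlo / 2 * E₀ + s) ≤ M * ((aForm α μ 0 u u).re + s) := by gcongr
    refine le_trans ?_ e3
    have e4 : (1 + K⁻¹ * 2) / mlo * (mlo / 2 * E₀) = (1 / 2 + K⁻¹) * E₀ := by
      field_simp
    have e5 : 0 ≤ ((1 + K⁻¹ * 2) / mlo + K⁻¹) * s := by positivity
    have e6 : 0 ≤ (1 + K⁻¹) * (mlo / 2 * E₀) := by positivity
    rw [hM]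
    linarith
  · refine ⟨G, h1, fun f hf => ?_⟩
    -- Testing with 𝟏 kills a(0), so the solution is orthogonal to 𝟏 whenever f is; the added form
    -- then vanishes and the original equation remains.
    have h3 : inner ℂ (one d) (G f) = 0 := by
      have := h2 f (one d) (one_mem_perH d _)
      rwa [aForm_zero_one_right, zero_add, inner_one_one, mul_one, hf] at this
    refine ⟨h3, h1 f, fun v hv => ?_⟩
    have := h2 f v hv
    rwa [h3, zero_mul, add_zero] at this

end Homogenization

/-! ### The reduced inverse, the cell solutions and the operators G_{jk}. -/

section ReducedInverse

variable {d : ℕ} {α mlo mhi : ℝ} {μ : E d → E d → ℝ}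

lemma coe_projP (s : ℝ) (f : L2 d) : (projP d s f : L2 d) = inner ℂ (one d) f • one d := rfl

lemma norm_inner_one_le (f : L2 d) : ‖(inner ℂ (one d) f : ℂ)‖ ≤ ‖f‖ := by
  simpa [norm_one] using norm_inner_le_norm (𝕜 := ℂ) (one d) f

lemma inner_one_sub_projP (s : ℝ) (f : L2 d) : inner ℂ (one d) (f - projP d s f) = 0 := by
  rw [coe_projP, inner_sub_right, inner_smul_right, inner_one_one, mul_one, sub_self]

lemma norm_sub_projP_le (s : ℝ) (f : L2 d) : ‖f - projP d s f‖ ≤ 2 * ‖f‖ := by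
  refine (norm_sub_le _ _).trans ?_
  rw [coe_projP, norm_smul, norm_one, mul_one]
  linarith [norm_inner_one_le f]

/-- Since a(0)[·,𝟏] = 0, only the `L₂` part of the inner product of 𝔇 survives against 𝟏. This is
the origin of the factors μ₊ in the expansion. -/
lemma Represents.mul_inner_one {b : L2 d → L2 d → ℂ}
    {T : perH d (α / 2) →ₗ[ℂ] perH d (α / 2)} (hT : Represents α mhi μ b T)
    (u : perH d (α / 2)) : (mhi : ℂ) * inner ℂ (one d) (T u : L2 d) = b u (one d) := by
  have := hT u ⟨one d, one_mem_perH d _⟩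
  rwa [innerD, aForm_zero_one_right, zero_add] at this

lemma Represents.projP_apply {b : L2 d → L2 d → ℂ}
    {T : perH d (α / 2) →ₗ[ℂ] perH d (α / 2)} (hT : Represents α mhi μ b T)
    (u : perH d (α / 2)) :
    (mhi : ℂ) • (projP d (α / 2) (T u) : L2 d) = b u (one d) • one d := by
  rw [coe_projP, smul_smul, hT.mul_inner_one]

lemma projP_eq_smul (f : L2 d) : projP d (α / 2) f
    = (inner ℂ (one d) f : ℂ) • (⟨one d, one_mem_perH d _⟩ : perH d (α / 2)) := rfl

lemma IsSesqOn.sum_smul_left {D : Submodule ℂ (L2 d)} {b : L2 d → L2 d → ℂ} (hb : IsSesqOn D b)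
    {ι : Type*} (s : Finset ι) (x : ι → ℂ) (w : ι → D) {v : L2 d} (hv : v ∈ D) :
    b (∑ i ∈ s, x i • w i : D) v = ∑ i ∈ s, x i * b (w i) v := by
  classical
  induction s using Finset.induction_on with
  | empty =>
    have := hb.smul_left 0 0 D.zero_mem v hv
    simpa using this
  | insert i s hi ih =>
    rw [Finset.sum_insert hi, Finset.sum_insert hi, Submodule.coe_add,
      hb.add_left _ (SetLike.coe_mem _) _ (SetLike.coe_mem _) _ hv, ih, Submodule.coe_smul,
      hb.smul_left _ _ (SetLike.coe_mem _) _ hv]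

variable [NeZero d]

/-- Coercivity at ξ = 0 on the complement of 𝟏, divided once by the norm of w. -/
lemma sobolevNorm_le_of_norm_aForm_le (hα₁ : 1 < α) (hα₂ : α < 2) (hmlo : 0 < mlo)
    (hμ : IsCoefficient mlo mhi μ) {w : L2 d} (hw : w ∈ perH d (α / 2))
    (hw1 : inner ℂ (one d) w = 0) {B : ℝ} (hB : 0 ≤ B)
    (h : ‖aForm α μ 0 w w‖ ≤ B * sobolevNorm α w) :
    sobolevNorm α w ≤ B / gapConst d α mlo := by
  have hc := gapConst_pos (d := d) hα₁ hα₂ hmlo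
  have h1 := aForm_coercive hα₁ hα₂ hmlo hμ (ξ := 0) (by simpa using Real.pi_pos.le) hw hw1
  have h2 := h1.trans ((Complex.re_le_norm _).trans h)
  rcases (sobolevNorm_nonneg (α := α) w).eq_or_lt with h0 | h0
  · rw [← h0]; positivity
  · rw [le_div_iff₀ hc]
    nlinarith

lemma opGraph_unique (hα₁ : 1 < α) (hα₂ : α < 2) (hmlo : 0 < mlo)
    (hμ : IsCoefficient mlo mhi μ) {w w' f : L2 d} (hw : inner ℂ (one d) w = 0)
    (hw' : inner ℂ (one d) w' = 0) (h : (w, f) ∈ opGraph α μ 0) (h' : (w', f) ∈ opGraph α μ 0) :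
    w = w' := by
  have hz : w - w' ∈ perH d (α / 2) := Submodule.sub_mem _ h.1 h'.1
  have h0 : aForm α μ 0 (w - w') (w - w') = 0 := by
    rw [(isSesqOn_aForm hα₁ hα₂ hmlo hμ 0).sub_left h.1 h'.1 hz, h.2 _ hz, h'.2 _ hz, sub_self]
  have h1 := sobolevNorm_le_of_norm_aForm_le hα₁ hα₂ hmlo hμ hz
    (by rw [inner_sub_right, hw, hw', sub_self]) le_rfl (by rw [h0, norm_zero, zero_mul])
  rw [zero_div] at h1
  exact sub_eq_zero.1 (norm_le_zero_iff.1 ((norm_le_sobolevNorm _).trans h1))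

lemma existsUnique_cell_solution (hα₁ : 1 < α) (hα₂ : α < 2) (hmlo : 0 < mlo)
    (hμ : IsCoefficient mlo mhi μ) (f : L2 d) (hf : inner ℂ (one d) f = 0) :
    ∃! w : L2 d, inner ℂ (one d) w = 0 ∧ (w, f) ∈ opGraph α μ 0 := by
  obtain ⟨G, -, hG⟩ := exists_cell_solution hα₁ hα₂ hmlo hμ
  exact ⟨G f, hG f hf, fun w hw =>
    opGraph_unique hα₁ hα₂ hmlo hμ hw.1 (hG f hf).1 hw.2 (hG f hf).2⟩

lemma isReducedInverse_opR (hα₁ : 1 < α) (hα₂ : α < 2) (hmlo : 0 < mlo)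
    (hμ : IsCoefficient mlo mhi μ) : IsReducedInverse α μ (opR α μ) := by
  have hex : ∃ R, IsReducedInverse α μ R := by
    obtain ⟨G, hGm, hG⟩ := exists_cell_solution hα₁ hα₂ hmlo hμ
    refine ⟨(G.toLinearMap.codRestrict _ hGm) ∘ₗ
      (LinearMap.id - (perH d (α / 2)).subtype ∘ₗ projP d (α / 2)), fun f => ?_⟩
    have h := hG (f - projP d (α / 2) f) (inner_one_sub_projP _ f)
    simpa only [LinearMap.comp_apply, LinearMap.sub_apply, LinearMap.id_apply,
      Submodule.subtype_apply, LinearMap.codRestrict_apply, ContinuousLinearMap.coe_coe] using h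
  rw [opR, dif_pos hex]
  exact hex.choose_spec

lemma norm_opR_le (hα₁ : 1 < α) (hα₂ : α < 2) (hmlo : 0 < mlo)
    (hμ : IsCoefficient mlo mhi μ) (f : L2 d) :
    ‖(opR α μ f : L2 d)‖ ≤ 2 / gapConst d α mlo * ‖f‖ := by
  obtain ⟨h1, h2, h3⟩ := isReducedInverse_opR hα₁ hα₂ hmlo hμ f
  refine (norm_le_sobolevNorm (α := α) _).trans ?_
  rw [div_mul_eq_mul_div]
  refine sobolevNorm_le_of_norm_aForm_le hα₁ hα₂ hmlo hμ h2 h1 (by positivity) ?_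
  rw [h3 _ h2, mul_comm]
  refine (norm_inner_le_norm _ _).trans (mul_le_mul (norm_le_sobolevNorm _)
    (norm_sub_projP_le _ f) (norm_nonneg _) (sobolevNorm_nonneg _))

/-- The solution `w_k` of the cell problem `a(0)[w_k,v] = a^{(k)}[𝟏_Ω,v]`. -/
def cellSolution (α mhi : ℝ) (μ : E d → E d → ℝ) (k : Fin d) : perH d (α / 2) :=
  opTj α mhi μ k ⟨one d, one_mem_perH d _⟩
    + (mhi : ℂ) • opR α μ (opTj α mhi μ k ⟨one d, one_mem_perH d _⟩ : L2 d)

/-- This is a^{(k)}[𝟏,𝟏] = 0 in operator form; it makes the projection `P^⊥` in G_{jk} act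
trivially. -/
lemma inner_one_opTj_one (hα₁ : 1 < α) (hα₂ : α < 2) (hmlo : 0 < mlo)
    (hμ : IsCoefficient mlo mhi μ) (k : Fin d) :
    inner ℂ (one d) (opTj α mhi μ k ⟨one d, one_mem_perH d _⟩ : L2 d) = 0 := by
  have h := (represents_opTj hα₁ hα₂ hmlo hμ k).mul_inner_one ⟨one d, one_mem_perH d _⟩
  rw [ajForm_one_one] at h
  exact (mul_eq_zero.1 h).resolve_left
    (Complex.ofReal_ne_zero.2 (hmlo.trans_le hμ.lo_le_hi).ne')

lemma inner_one_cellSolution (hα₁ : 1 < α) (hα₂ : α < 2) (hmlo : 0 < mlo)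
    (hμ : IsCoefficient mlo mhi μ) (k : Fin d) :
    inner ℂ (one d) (cellSolution α mhi μ k : L2 d) = 0 := by
  rw [cellSolution, Submodule.coe_add, Submodule.coe_smul, inner_add_right, inner_smul_right,
    inner_one_opTj_one hα₁ hα₂ hmlo hμ, (isReducedInverse_opR hα₁ hα₂ hmlo hμ _).1, mul_zero,
    add_zero]

/-- By definition 𝕋_k𝟏 solves the problem for a(0) + μ₊. The summand with the reduced inverse adds
μ₊(𝕋_k𝟏, v), exactly what the L₂ term lacks; no projection is left over because 𝕋_k𝟏 ⊥ 𝟏. -/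
lemma aForm_cellSolution (hα₁ : 1 < α) (hα₂ : α < 2) (hmlo : 0 < mlo)
    (hμ : IsCoefficient mlo mhi μ) (k : Fin d) {v : L2 d} (hv : v ∈ perH d (α / 2)) :
    aForm α μ 0 (cellSolution α mhi μ k) v = ajForm α μ k (one d) v := by
  have h0 := isSesqOn_aForm hα₁ hα₂ hmlo hμ 0
  have h1 := represents_opTj hα₁ hα₂ hmlo hμ k ⟨one d, one_mem_perH d _⟩ ⟨v, hv⟩
  have h2 := (isReducedInverse_opR hα₁ hα₂ hmlo hμ
    (opTj α mhi μ k ⟨one d, one_mem_perH d _⟩ : L2 d)).2.2 v hv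
  rw [coe_projP, inner_one_opTj_one hα₁ hα₂ hmlo hμ, zero_smul, sub_zero] at h2
  rw [cellSolution, Submodule.coe_add, Submodule.coe_smul,
    h0.add_left _ (SetLike.coe_mem _) _ (Submodule.smul_mem _ _ (SetLike.coe_mem _)) _ hv,
    h0.smul_left _ _ (SetLike.coe_mem _) _ hv]
  rw [innerD] at h1
  rw [← h1]
  exact congrArg _ (congrArg _ h2)

lemma sobolevNorm_cellSolution_le (hα₁ : 1 < α) (hα₂ : α < 2) (hmlo : 0 < mlo)
    (hμ : IsCoefficient mlo mhi μ) (k : Fin d) :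
    sobolevNorm α (cellSolution α mhi μ k : L2 d) ≤ ajConst d α mhi / gapConst d α mlo := by
  have hmhi := (hmlo.trans_le hμ.lo_le_hi).le
  refine sobolevNorm_le_of_norm_aForm_le hα₁ hα₂ hmlo hμ (SetLike.coe_mem _)
    (inner_one_cellSolution hα₁ hα₂ hmlo hμ k) (ajConst_nonneg hmhi) ?_
  rw [aForm_cellSolution hα₁ hα₂ hmlo hμ k (SetLike.coe_mem _)]
  have := norm_ajForm_le hα₁ hα₂ hmlo hμ k (one_mem_perH d _)
    (SetLike.coe_mem (cellSolution α mhi μ k))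
  rwa [sobolevNorm_one hα₁ hα₂, mul_one] at this

lemma mul_opPTP_apply (hα₁ : 1 < α) (hα₂ : α < 2) (hmlo : 0 < mlo)
    (hμ : IsCoefficient mlo mhi μ) (ξ : E d) (u : L2 d) :
    (mhi : ℂ) • opPTP α mhi μ ξ u
      = (aForm α μ ξ (one d) (one d) * inner ℂ (one d) u) • one d := by
  have h : opPTP α mhi μ ξ u
      = (projP d (α / 2) (opT α mhi μ ξ (projP d (α / 2) u)) : L2 d) := rfl
  rw [h, projP_eq_smul u, map_smul, Submodule.coe_smul, map_smul, Submodule.coe_smul, smul_comm,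
    (represents_opT hα₁ hα₂ hmlo hμ ξ).projP_apply, aForm_zero_one, sub_zero, smul_smul, mul_comm]

/-- Both terms of G_{jk} have the shape -μ₊P𝕋_j(·), and their arguments 𝕋_k𝟏 and μ₊R_0^⊥(0)𝕋_k𝟏 add
up to the cell solution. -/
lemma opG_apply (hα₁ : 1 < α) (hα₂ : α < 2) (hmlo : 0 < mlo)
    (hμ : IsCoefficient mlo mhi μ) (j k : Fin d) (u : L2 d) :
    opG α mhi μ j k u
      = (-(ajForm α μ j (cellSolution α mhi μ k) (one d) * inner ℂ (one d) u)) • one d := by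
  set g := opTj α mhi μ k ⟨one d, one_mem_perH d _⟩ with hg
  have hg0 : projP d (α / 2) (g : L2 d) = 0 := by
    rw [projP_eq_smul, hg, inner_one_opTj_one hα₁ hα₂ hmlo hμ, zero_smul]
  have hj := represents_opTj hα₁ hα₂ hmlo hμ j
  have hgu : opTj α mhi μ k (projP d (α / 2) u) = (inner ℂ (one d) u : ℂ) • g := by
    rw [projP_eq_smul, map_smul]
  have h : opG α mhi μ j k u
      = (-(mhi : ℂ)) • (projP d (α / 2) (opTj α mhi μ j
          (opTj α mhi μ k (projP d (α / 2) u)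
            - projP d (α / 2) (opTj α mhi μ k (projP d (α / 2) u) : L2 d))) : L2 d)
        - ((mhi : ℂ) ^ 2) • (projP d (α / 2) (opTj α mhi μ j
          (opR α μ (opTj α mhi μ k (projP d (α / 2) u) : L2 d))) : L2 d) := rfl
  rw [h, hgu]
  simp only [Submodule.coe_smul, map_smul, hg0, smul_zero, sub_zero]
  rw [neg_smul, pow_two, mul_smul, smul_comm (mhi : ℂ) (inner ℂ (one d) u : ℂ),
    smul_comm (mhi : ℂ) (inner ℂ (one d) u : ℂ), hj.projP_apply, hj.projP_apply]
  rw [cellSolution, Submodule.coe_add, Submodule.coe_smul,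
    (isSesqOn_ajForm hα₁ hα₂ hmlo hμ j).add_left _ (SetLike.coe_mem _) _
      (Submodule.smul_mem _ _ (SetLike.coe_mem _)) _ (one_mem_perH d _),
    (isSesqOn_ajForm hα₁ hα₂ hmlo hμ j).smul_left _ _ (SetLike.coe_mem _) _ (one_mem_perH d _)]
  module

lemma norm_opG_le (hα₁ : 1 < α) (hα₂ : α < 2) (hmlo : 0 < mlo)
    (hμ : IsCoefficient mlo mhi μ) (j k : Fin d) (u : L2 d) :
    ‖opG α mhi μ j k u‖ ≤ ajConst d α mhi ^ 2 / gapConst d α mlo * ‖u‖ := by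
  have hmhi := (hmlo.trans_le hμ.lo_le_hi).le
  have h1 := norm_ajForm_le hα₁ hα₂ hmlo hμ j (SetLike.coe_mem (cellSolution α mhi μ k))
    (one_mem_perH d _)
  rw [sobolevNorm_one hα₁ hα₂, mul_one] at h1
  have h2 : ‖ajForm α μ j (cellSolution α mhi μ k) (one d)‖
      ≤ ajConst d α mhi ^ 2 / gapConst d α mlo := by
    refine h1.trans ((mul_le_mul_of_nonneg_left (sobolevNorm_cellSolution_le hα₁ hα₂ hmlo hμ k)
      (ajConst_nonneg hmhi)).trans (le_of_eq ?_))
    ring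
  rw [opG_apply hα₁ hα₂ hmlo hμ, norm_smul, norm_one, mul_one, norm_neg, norm_mul]
  exact mul_le_mul h2 (norm_inner_one_le u) (norm_nonneg _) ((norm_nonneg _).trans h2)

/-- The solution of the cell problem in the direction `ξ`. -/
def directionalCellSolution (α mhi : ℝ) (μ : E d → E d → ℝ) (ξ : E d) : perH d (α / 2) :=
  ∑ k, (ξ k : ℂ) • cellSolution α mhi μ k

lemma aForm_directionalCellSolution (hα₁ : 1 < α) (hα₂ : α < 2) (hmlo : 0 < mlo)
    (hμ : IsCoefficient mlo mhi μ) (ξ : E d) {v : L2 d} (hv : v ∈ perH d (α / 2)) :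
    aForm α μ 0 (directionalCellSolution α mhi μ ξ) v = firstForm α μ ξ (one d) v := by
  rw [directionalCellSolution, (isSesqOn_aForm hα₁ hα₂ hmlo hμ 0).sum_smul_left _ _ _ hv]
  exact Finset.sum_congr rfl fun k _ => by rw [aForm_cellSolution hα₁ hα₂ hmlo hμ k hv]

lemma inner_one_directionalCellSolution (hα₁ : 1 < α) (hα₂ : α < 2) (hmlo : 0 < mlo)
    (hμ : IsCoefficient mlo mhi μ) (ξ : E d) :
    inner ℂ (one d) (directionalCellSolution α mhi μ ξ : L2 d) = 0 := by
  rw [directionalCellSolution, Submodule.coe_sum, inner_sum]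
  refine Finset.sum_eq_zero fun k _ => ?_
  rw [Submodule.coe_smul, inner_smul_right, inner_one_cellSolution hα₁ hα₂ hmlo hμ, mul_zero]

lemma sum_opG_apply (hα₁ : 1 < α) (hα₂ : α < 2) (hmlo : 0 < mlo)
    (hμ : IsCoefficient mlo mhi μ) (ξ : E d) (u : L2 d) :
    ∑ j, ∑ k, ((ξ j * ξ k : ℝ) : ℂ) • opG α mhi μ j k u
      = (-(firstForm α μ ξ (directionalCellSolution α mhi μ ξ) (one d)
          * inner ℂ (one d) u)) • one d := by
  simp only [opG_apply hα₁ hα₂ hmlo hμ, smul_smul, ← Finset.sum_smul]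
  congr 1
  rw [firstForm, Finset.sum_mul, ← Finset.sum_neg_distrib]
  refine Finset.sum_congr rfl fun j _ => ?_
  rw [directionalCellSolution,
    (isSesqOn_ajForm hα₁ hα₂ hmlo hμ j).sum_smul_left _ _ _ (one_mem_perH d _), Finset.mul_sum,
    Finset.sum_mul, ← Finset.sum_neg_distrib]
  refine Finset.sum_congr rfl fun k _ => ?_
  push_cast
  ring

lemma isPerturbation_aForm (hα₁ : 1 < α) (hα₂ : α < 2) (hmlo : 0 < mlo)
    (hμ : IsCoefficient mlo mhi μ) {ξ : E d} (hξ : ‖ξ‖ ≤ Real.pi) :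
    IsPerturbation (perH d (α / 2)) (sobolevNorm α) (aForm α μ 0) (aForm α μ ξ) (firstForm α μ ξ)
      (one d) ‖ξ‖ (‖ξ‖ ^ α) (2 * mhi * kernelMass d α) (d * ajConst d α mhi) (gapConst d α mlo)
      (d0 d α mlo) := by
  have hmhi := (hmlo.trans_le hμ.lo_le_hi).le
  have hM := kernelMass_nonneg (d := d) (α := α)
  have hc0 := c0_pos (d := d) hα₁ hα₂
  have hB := ajConst_nonneg (d := d) (α := α) hmhi
  have h4 : ‖ξ‖ ≤ 4 := hξ.trans Real.pi_le_four
  exact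
    { sesq₀ := isSesqOn_aForm hα₁ hα₂ hmlo hμ 0
      sesq := isSesqOn_aForm hα₁ hα₂ hmlo hμ ξ
      sesq₁ := isSesqOn_firstForm hα₁ hα₂ hmlo hμ ξ
      mem := one_mem_perH d _
      norm_e := norm_one d
      N_e := sobolevNorm_one hα₁ hα₂
      norm_le := fun u _ => norm_le_sobolevNorm u
      rem_le := fun u hu v hv => norm_remainder_le hα₁ hα₂ hmlo hμ ξ hu hv
      first_le := fun u hu v hv => norm_firstForm_le hα₁ hα₂ hmlo hμ ξ hu hv
      coercive₀ := fun v hv h => aForm_coercive hα₁ hα₂ hmlo hμ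
        (by simpa using Real.pi_pos.le) hv h
      coercive := fun v hv h => aForm_coercive hα₁ hα₂ hmlo hμ hξ hv h
      lower := fun v hv h => aForm_lower hα₁ hα₂ hmlo hμ hξ hv h
      kernel_left := fun v _ => aForm_zero_one v
      kernel_right := fun v _ => aForm_zero_one_right v
      first_e := by simp [firstForm, ajForm_one_one]
      t_nonneg := norm_nonneg ξ
      p_nonneg := by positivity
      t_le := h4
      p_le := rpow_le_four_mul hα₁ hα₂ (norm_nonneg ξ) h4
      t_sq_le := sq_le_four_mul_rpow hα₁ hα₂ (norm_nonneg ξ) h4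
      C₁_nonneg := by positivity
      C₂_nonneg := by positivity
      c_pos := gapConst_pos hα₁ hα₂ hmlo
      γ_pos := by unfold d0; positivity }

/-- The upper bound on μ gives at most `μ₊c₀|ξ|^α`, and δ₀ is the radius at which this equals d₀/3.
-/
lemma aForm_one_one_le (hα₁ : 1 < α) (hα₂ : α < 2) (hmlo : 0 < mlo)
    (hμ : IsCoefficient mlo mhi μ) {ξ : E d} (hξ : ‖ξ‖ ≤ delta0 α mlo mhi) :
    (aForm α μ ξ (one d) (one d)).re ≤ d0 d α mlo / 3 := by
  have hmhi := hmlo.trans_le hμ.lo_le_hi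
  have hc0 := c0_pos (d := d) hα₁ hα₂
  refine (aForm_self_bounds hα₁ hα₂ hmlo hμ ξ (one_mem_perH d _)).2.trans ?_
  rw [energy_one hα₁ hα₂, ENNReal.toReal_ofReal (by positivity)]
  have h1 : ‖ξ‖ ^ α ≤ Real.pi ^ α * (mlo / (3 * mhi)) := by
    rw [← delta0_rpow (by linarith) hmlo hmhi]
    exact Real.rpow_le_rpow (norm_nonneg _) hξ (by linarith)
  calc mhi / 2 * (2 * c0 d α * ‖ξ‖ ^ α)
      ≤ mhi / 2 * (2 * c0 d α * (Real.pi ^ α * (mlo / (3 * mhi)))) := by gcongr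
    _ = d0 d α mlo / 3 := by unfold d0; field_simp

end ReducedInverse

end LevyHom

end

/-! ### The theorem: the abstract expansion applied to a(ξ). -/

theorem proposition3p5 (d : ℕ) [NeZero d] (α : ℝ) (hα₁ : 1 < α) (hα₂ : α < 2)
    (mlo mhi : ℝ) (hmlo : 0 < mlo) :
    ∃ C₇ C₈ : ℝ, ∀ μ : LevyHom.E d → LevyHom.E d → ℝ, LevyHom.IsCoefficient mlo mhi μ →
      -- the operators `𝕋_j` are well defined
      (∀ j, LevyHom.Represents α mhi μ (LevyHom.ajForm α μ j) (LevyHom.opTj α mhi μ j)) ∧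
      -- `𝔸(0)` is invertible on the complement of `𝟏_Ω`, and `R_0^⊥(0)` is well defined and bounded
      (∀ f : LevyHom.L2 d, inner ℂ (LevyHom.one d) f = 0 →
        ∃! w : LevyHom.L2 d, inner ℂ (LevyHom.one d) w = 0 ∧ (w, f) ∈ LevyHom.opGraph α μ 0) ∧
      LevyHom.IsReducedInverse α μ (LevyHom.opR α μ) ∧
      (∃ C : ℝ, ∀ f : LevyHom.L2 d, ‖(LevyHom.opR α μ f : LevyHom.L2 d)‖ ≤ C * ‖f‖) ∧
      -- the operators `G_{jk}` are bounded
      (∀ j k, ∀ u : LevyHom.L2 d, ‖LevyHom.opG α mhi μ j k u‖ ≤ C₇ * ‖u‖) ∧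
      ∀ ξ : LevyHom.E d, ‖ξ‖ ≤ LevyHom.delta0 α mlo mhi →
        -- `𝕋(ξ)` is well defined
        LevyHom.Represents α mhi μ
          (fun u v => LevyHom.aForm α μ ξ u v - LevyHom.aForm α μ 0 u v)
          (LevyHom.opT α mhi μ ξ) ∧
        -- `𝔸(ξ)` has a complete system of eigenvectors
        LevyHom.spectralSubspace α μ ξ Set.univ = ⊤ ∧
        -- the expansion of `𝔸(ξ) F(ξ)`
        ∃ Φ : LevyHom.L2 d →L[ℂ] LevyHom.L2 d, ‖Φ‖ ≤ C₈ * ‖ξ‖ ^ (1 + α) ∧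
          ∀ u : LevyHom.L2 d,
            (LevyHom.opF α mlo μ ξ u,
              (mhi : ℂ) • LevyHom.opPTP α mhi μ ξ u
                + ∑ j, ∑ k, ((ξ j * ξ k : ℝ) : ℂ) • LevyHom.opG α mhi μ j k u + Φ u)
              ∈ LevyHom.opGraph α μ ξ := by
  set C₁ := 2 * mhi * LevyHom.kernelMass d α
  set C₂ := d * LevyHom.ajConst d α mhi
  set c := LevyHom.gapConst d α mlo
  refine ⟨LevyHom.ajConst d α mhi ^ 2 / c,
    4 * LevyHom.eigConst C₁ C₂ c * LevyHom.corrConst C₁ C₂ c + LevyHom.remConst C₁ C₂ c,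
    fun μ hμ => ⟨LevyHom.represents_opTj hα₁ hα₂ hmlo hμ,
      LevyHom.existsUnique_cell_solution hα₁ hα₂ hmlo hμ,
      LevyHom.isReducedInverse_opR hα₁ hα₂ hmlo hμ,
      ⟨_, LevyHom.norm_opR_le hα₁ hα₂ hmlo hμ⟩,
      LevyHom.norm_opG_le hα₁ hα₂ hmlo hμ, fun ξ hξ => ?_⟩⟩
  obtain ⟨R, hR, hK⟩ := LevyHom.exists_isShiftedInverse hα₁ hα₂ hmlo hμ ξ
  have hsesq := LevyHom.isSesqOn_aForm hα₁ hα₂ hmlo hμ ξ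
  have hsymm : ∀ u ∈ LevyHom.perH d (α / 2), ∀ v ∈ LevyHom.perH d (α / 2),
      star (LevyHom.aForm α μ ξ u v) = LevyHom.aForm α μ ξ v u :=
    fun u _ v _ => LevyHom.star_aForm ξ u v
  refine ⟨LevyHom.represents_opT hα₁ hα₂ hmlo hμ ξ,
    hR.closure_span_eigenvectors hK hsesq (LevyHom.dense_perH hα₁ hα₂) hsymm, ?_⟩
  have hpert := LevyHom.isPerturbation_aForm hα₁ hα₂ hmlo hμ
    (hξ.trans (LevyHom.delta0_le_pi (by linarith) hmlo hμ.lo_le_hi))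
  obtain ⟨Φ, hΦ, h⟩ := hpert.exists_expansion hsymm
    (fun u hu => LevyHom.aForm_self_nonneg hα₁ hα₂ hmlo hμ ξ hu) hR hK
    (LevyHom.aForm_one_one_le hα₁ hα₂ hmlo hμ hξ)
    (SetLike.coe_mem (LevyHom.directionalCellSolution α mhi μ ξ))
    (LevyHom.inner_one_directionalCellSolution hα₁ hα₂ hmlo hμ ξ)
    (fun v hv => LevyHom.aForm_directionalCellSolution hα₁ hα₂ hmlo hμ ξ hv)
    (V := LevyHom.spectralSubspace α μ ξ (Set.Icc 0 (LevyHom.d0 d α mlo / 3))) rfl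
  refine ⟨Φ, ?_, fun u => ?_⟩
  -- The abstract error t · p is here |ξ| · `|ξ|^α`.
  · rwa [Real.rpow_add' (norm_nonneg ξ) (by linarith), Real.rpow_one]
  · rw [LevyHom.mul_opPTP_apply hα₁ hα₂ hmlo hμ, LevyHom.sum_opG_apply hα₁ hα₂ hmlo hμ, ← add_smul,
      ← sub_eq_add_neg, ← sub_mul]
    exact h u
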